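/- All logarithms are to base $2$. Let $(\mathcal Y,\mu)$ be a $\sigma$-finite measure space, let $\mathcal P(\mathcal Y)$ be the set of probability measures on $\mathcal Y$ that are absolutely continuous with respect to $\mu$, and write $p=dP/d\mu$ for the density of $P\in\mathcal P(\mathcal Y)$; similarly $\mathcal P(\mathcal Y^n)$ with $\mu^{n}$. Let $(\tilde{\mathcal X},d)$ be a metric space, let $W_x\in\mathcal P(\mathcal Y)$ for every $x\in\tilde{\mathcal X}$ (the channel), with density $w_x$, and let $\mathcal X\subset\tilde{\mathcal X}$ be finite. For $x\in\tilde{\mathcal X}^n$ put $W^n_x=W_{x_1}\otimes\cdots\otimes W_{x_n}$. $D(P\|Q)$ is the Kullback–Leibler divergence and, for $\alpha>1$, $D_\alpha(P\|Q)=\frac1{\alpha-1}\log\mathbb E_P[(p(Y)/q(Y))^{\alpha-1}]$. $\mathbb E_x,\mathbb V_x$ are expectation and variance under $W_x$. **Conditions.** (W2): $\min_{x\in\mathcal X}\min_{P} D\big(\sum_{x'\neq x}P(x')W_{x'}\,\big\|\,W_x\big)>0$, where $P$ runs over the probability distributions on $\mathcal X\setminus\{x\}$ (a minimum over the empty set is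 $+\infty$). (W3): there are measurable functions $\xi_x:\mathcal Y\to\mathbb R$, $x\in\tilde{\mathcal X}$, with $\mathbb E_x[\xi_x(Y)]=0$ for all $x\in\tilde{\mathcal X}$, with $\sup_{x\in\tilde{\mathcal X}}\mathbb V_x[\xi_x(Y)]<\infty$, and with $$-\tfrac1t\log\sup_{x\in\mathcal X,\;x'\in\tilde{\mathcal X},\;d(x,x')\ge r}\mathbb E_{x'}\big[2^{t(\xi_x(Y)-\xi_{x'}(Y))}\big]>0\qquad\text{for all } r>0,\ t\in(0,\tfrac12).$$ **Codes.** A (stochastic) code of block length $n$ consists of integers $0<\mathsf L<\mathsf M$, an encoder $\phi$ that assigns to each message $m\in\{1,\dots,\mathsf M\}$ a probability distribution $P_m$ on $\mathcal X^n$, and a measurable decoder $\Psi$ that assigns to each $y\in\mathcal Y^n$ a set $\Psi(y)\subset\{1,\dots,\mathsf M\}$ of at most $\mathsf L$ messages. It is deterministic if every $P_m$ is a point mass. Put $W_{\phi(m)}=\sum_{x}P_m(x)W^n_x$ and $$\epsilon_A=\max_m W_{\phi(m)}\{y: m\notin\Psi(y)\},$$ let $\delta_{D'}$ be the supremum over $x\in\tilde{\mathcal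 X}^n$ of the second largest (with multiplicity) of the numbers $W^n_x\{y:m\in\Psi(y)\}$, $m=1,\dots,\mathsf M$, and put $$E(\phi)=\log\mathsf M-\min_{Q\in\mathcal P(\mathcal Y^n)}\sum_{m}\tfrac1{\mathsf M}D(W_{\phi(m)}\|Q),$$ $$E_\alpha(\phi)=\log\mathsf M-\min_{Q\in\mathcal P(\mathcal Y^n)}\tfrac1{\alpha-1}\log\sum_m\tfrac1{\mathsf M}2^{(\alpha-1)D_\alpha(W_{\phi(m)}\|Q)}.$$ **Achievable regions.** $\mathcal R^L_{(u,s)}$ is the set of triples $(R_1,R_2,R_3)$ of positive reals for which there is a sequence of codes, one of each block length $n$, with $\epsilon_A\to0$, $\delta_{D'}\to0$, $\frac1n\log\mathsf M_n\to R_1$, $\frac1n\log\mathsf L_n\to R_2$ and $\liminf_n\frac1nE(\phi_n)\ge R_3$. $\mathcal R^L_{(u,d)}$ is defined in the same way with deterministic codes. $\mathcal R^{L,\alpha}_{(u,s)}$ and $\mathcal R^{L,\alpha}_{(u,d)}$ are defined in the same way with $E_\alpha$ in place of $E$. **Single-letter regions.** For a probability distribution $P$ on $\mathcal X$ put $W_P=\sum_xP(x)W_x$,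 $I(X;Y)_P=\sum_xP(x)D(W_x\|W_P)$, $$I_\alpha(X;Y)_P=\min_{Q\in\mathcal P(\mathcal Y)}\tfrac1{\alpha-1}\log\sum_xP(x)\,\mathbb E_x\big[(w_x(Y)/q(Y))^{\alpha-1}\big],$$ and let $H(X)_P$, $H(X|Y)_P$ be the entropy of $X$ and its conditional entropy given $Y$ when $X\sim P$ and $Y\sim W_x$ given $X=x$. For a finite set $\mathcal U$ and a probability distribution $P$ on $\mathcal U\times\mathcal X$, let $I(X;Y|U)_P$, $I_\alpha(X;Y|U)_P$, $H(X|U)_P$, $H(X|YU)_P$ be the averages over $u\sim P_U$ of $I(X;Y)$, $I_\alpha(X;Y)$, $H(X)$, $H(X|Y)$ at $P_{X|U=u}$. Let $\mathcal C$, $\mathcal C^s$, $\mathcal C_\alpha$ be the sets of triples of positive reals $(R_1,R_2,R_3)$ such that, for some finite $\mathcal U$ and some probability distribution $P$ on $\mathcal U\times\mathcal X$, $$0<R_1-R_2<I(X;Y|U)_P,\qquad R_1<H(X|U)_P,$$ and, respectively, $R_3\le R_1-I(X;Y|U)_P$ (for $\mathcal C$), $R_3\le H(X|YU)_P$ (for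 $\mathcal C^s$), $R_3<R_1-I_\alpha(X;Y|U)_P$ (for $\mathcal C_\alpha$). **Claim.** If (W2) and (W3) hold, then $$\overline{\mathcal R^L_{(u,d)}}=\overline{\mathcal C},\qquad \overline{\mathcal R^L_{(u,s)}}\subset\overline{\mathcal C^s},$$ and for every $\alpha>1$ $$\mathcal C_\alpha\subset\mathcal R^{L,\alpha}_{(u,d)}\subset\mathcal R^{L,\alpha}_{(u,s)}.$$ -/

import Mathlib

open MeasureTheory ProbabilityTheory Filter Topology
open scoped ENNReal

noncomputable section

namespace SecureList

/-! ### Base-2 logarithm and exponential, probability measures with a density -/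

/-- `log₂ : [0,∞] → [-∞,∞]`, with `log₂ 0 = -∞` and `log₂ ∞ = ∞`. -/
def log2 (x : ℝ≥0∞) : EReal := ENNReal.log x / ((Real.log 2 : ℝ) : EReal)

/-- `x ↦ 2 ^ x : [-∞,∞] → [0,∞]`. -/
def exp2 (x : EReal) : ℝ≥0∞ := EReal.exp (((Real.log 2 : ℝ) : EReal) * x)

/-- The probability measures that are absolutely continuous with respect to `μ`. -/
def acProb {Ω : Type*} [MeasurableSpace Ω] (μ : Measure Ω) : Set (Measure Ω) :=
  {Q | IsProbabilityMeasure Q ∧ Q ≪ μ}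

/-- Kullback–Leibler divergence of two probability measures, in bits. -/
def klDiv2 {Ω : Type*} [MeasurableSpace Ω] (P Q : Measure Ω) : ℝ≥0∞ :=
  InformationTheory.klDiv P Q / ENNReal.ofReal (Real.log 2)

/-- `E_P[(p / q) ^ (α - 1)]`, where `p` and `q` are the densities of `P` and `Q` with respect
to `μ`. It is infinite if `α > 1` and `P` is not absolutely continuous with respect to `Q`. -/
def renyiMoment {Ω : Type*} [MeasurableSpace Ω] (α : ℝ) (μ P Q : Measure Ω) : ℝ≥0∞ :=
  ∫⁻ y, (P.rnDeriv μ y / Q.rnDeriv μ y) ^ (α - 1) ∂P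

/-- Rényi divergence `D_α(P‖Q) = (α - 1)⁻¹ log₂ E_P[(p / q) ^ (α - 1)]`. -/
def renyiDiv {Ω : Type*} [MeasurableSpace Ω] (α : ℝ) (μ P Q : Measure Ω) : EReal :=
  ((1 / (α - 1) : ℝ) : EReal) * log2 (renyiMoment α μ P Q)

/-! ### Single-letter information quantities

`A` is a finite input alphabet, `V` a channel from `A` to `Y`, and `P` a probability
distribution on `A` (an element of `stdSimplex ℝ A`). -/

section SingleLetter

variable {A : Type*} [Fintype A] {Y : Type*} [MeasurableSpace Y]

/-- The output distribution `∑ a, P a • V a`. -/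
def mixture (P : A → ℝ) (V : A → Measure Y) : Measure Y :=
  ∑ a, ENNReal.ofReal (P a) • V a

/-- Shannon entropy, in bits. -/
def entropy (P : A → ℝ) : ℝ := -∑ a, P a * Real.logb 2 (P a)

/-- `I(X;Y)_P = ∑ a, P a * D(V a ‖ ∑ b, P b • V b)`. -/
def mutualInfo (V : A → Measure Y) (P : A → ℝ) : ℝ≥0∞ :=
  ∑ a, ENNReal.ofReal (P a) * klDiv2 (V a) (mixture P V)

/-- `I_α(X;Y)_P`, the infimum over `Q` of the Rényi divergence of order `α` between the joint
distribution `P a • V a` of input and output and the product `P a • Q`. The factor `P a` cancels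
in the ratio of the two densities. -/
def renyiInfo (α : ℝ) (μ : Measure Y) (V : A → Measure Y) (P : A → ℝ) : EReal :=
  ⨅ Q ∈ acProb μ, ((1 / (α - 1) : ℝ) : EReal) *
    log2 (∑ a, ENNReal.ofReal (P a) * renyiMoment α μ (V a) Q)

/-- The density at `y` of the output distribution. -/
def outDensity (μ : Measure Y) (V : A → Measure Y) (P : A → ℝ) (y : Y) : ℝ :=
  ∑ a, P a * ((V a).rnDeriv μ y).toReal

/-- The conditional distribution of the input given the output `y`. -/
def posterior (μ : Measure Y) (V : A → Measure Y) (P : A → ℝ) (y : Y) (a : A) : ℝ :=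
  P a * ((V a).rnDeriv μ y).toReal / outDensity μ V P y

/-- `H(X|Y)_P = ∫ H(P_{X|Y=y}) p(y) μ(dy)`. -/
def condEntropyY (μ : Measure Y) (V : A → Measure Y) (P : A → ℝ) : ℝ :=
  ∫ y, entropy (posterior μ V P y) * outDensity μ V P y ∂μ

/-! The same quantities conditioned on an auxiliary variable with values in a finite set `U`.
Now `P` is a probability distribution on `U × A`. -/

variable {U : Type*} [Fintype U]

/-- `P_U`. -/
def margU (P : U × A → ℝ) (u : U) : ℝ := ∑ a, P (u, a)

/-- `P_{X|U=u}`. -/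
def condU (P : U × A → ℝ) (u : U) (a : A) : ℝ := P (u, a) / margU P u

/-- `I(X;Y|U)_P`. -/
def mutualInfoU (V : A → Measure Y) (P : U × A → ℝ) : ℝ≥0∞ :=
  ∑ u, ENNReal.ofReal (margU P u) * mutualInfo V (condU P u)

/-- `I_α(X;Y|U)_P`. -/
def renyiInfoU (α : ℝ) (μ : Measure Y) (V : A → Measure Y) (P : U × A → ℝ) : EReal :=
  ∑ u, ((margU P u : ℝ) : EReal) * renyiInfo α μ V (condU P u)

/-- `H(X|U)_P`. -/
def condEntropyU (P : U × A → ℝ) : ℝ :=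
  -∑ u, ∑ a, P (u, a) * Real.logb 2 (P (u, a) / margU P u)

/-- `H(X|YU)_P`. -/
def condEntropyYU (μ : Measure Y) (V : A → Measure Y) (P : U × A → ℝ) : ℝ :=
  ∑ u, margU P u * condEntropyY μ V (condU P u)

/-! ### The single-letter regions of triples `(R₁, R₂, R₃)` -/

/-- The region `𝒞`. -/
def regionC (V : A → Measure Y) : Set (ℝ × ℝ × ℝ) :=
  {R | ∃ (k : ℕ) (P : Fin k × A → ℝ), P ∈ stdSimplex ℝ (Fin k × A) ∧
    0 < R.1 - R.2.1 ∧ ((R.1 - R.2.1 : ℝ) : EReal) < (mutualInfoU V P : EReal) ∧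
    (R.2.2 : EReal) ≤ (R.1 : EReal) - (mutualInfoU V P : EReal) ∧
    R.1 < condEntropyU P ∧
    0 < R.1 ∧ 0 < R.2.1 ∧ 0 < R.2.2}

/-- The region `𝒞^s`. -/
def regionCs (μ : Measure Y) (V : A → Measure Y) : Set (ℝ × ℝ × ℝ) :=
  {R | ∃ (k : ℕ) (P : Fin k × A → ℝ), P ∈ stdSimplex ℝ (Fin k × A) ∧
    0 < R.1 - R.2.1 ∧ ((R.1 - R.2.1 : ℝ) : EReal) < (mutualInfoU V P : EReal) ∧
    R.2.2 ≤ condEntropyYU μ V P ∧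
    R.1 < condEntropyU P ∧
    0 < R.1 ∧ 0 < R.2.1 ∧ 0 < R.2.2}

/-- The region `𝒞_α`. -/
def regionCα (α : ℝ) (μ : Measure Y) (V : A → Measure Y) : Set (ℝ × ℝ × ℝ) :=
  {R | ∃ (k : ℕ) (P : Fin k × A → ℝ), P ∈ stdSimplex ℝ (Fin k × A) ∧
    0 < R.1 - R.2.1 ∧ ((R.1 - R.2.1 : ℝ) : EReal) < (mutualInfoU V P : EReal) ∧
    (R.2.2 : EReal) < (R.1 : EReal) - renyiInfoU α μ V P ∧
    R.1 < condEntropyU P ∧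
    0 < R.1 ∧ 0 < R.2.1 ∧ 0 < R.2.2}

/-! ### Condition (W2) -/

/-- Non-redundancy: the divergence from a mixture of the `V b`, `b ≠ a`, to `V a` is bounded
away from zero. -/
def CondW2 (V : A → Measure Y) : Prop :=
  0 < ⨅ (a : A) (P : A → ℝ) (_ : P ∈ stdSimplex ℝ A ∧ P a = 0), klDiv2 (mixture P V) (V a)

end SingleLetter

/-! ### The channel with input space `X` and honest input alphabet `𝒳 ⊆ X` -/

section Channel

variable {X : Type*} {Y : Type*} [MeasurableSpace Y]

/-- The channel restricted to the inputs that honest Alice can use. -/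
def honest (W : X → Measure Y) (𝒳 : Finset X) : 𝒳 → Measure Y := fun x => W x

/-- The memoryless extension: `n` independent uses of the channel. -/
def prodChannel (W : X → Measure Y) (n : ℕ) (x : Fin n → X) : Measure (Fin n → Y) :=
  Measure.pi fun i => W (x i)

/-- `sup E_{x'}[2 ^ (t (ξ_x(Y) - ξ_{x'}(Y)))]` over `x ∈ 𝒳` and all inputs `x'` at distance at
least `r` from `x`. -/
def supMoment [MetricSpace X] (W : X → Measure Y) (𝒳 : Finset X) (ξ : X → Y → ℝ) (t r : ℝ) :
    ℝ≥0∞ :=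
  ⨆ (x ∈ 𝒳) (x' : X) (_ : r ≤ dist x x'),
    ∫⁻ y, ENNReal.ofReal ((2 : ℝ) ^ (t * (ξ x y - ξ x' y))) ∂(W x')

/-- Condition (W3). -/
def CondW3 [MetricSpace X] (W : X → Measure Y) (𝒳 : Finset X) : Prop :=
  ∃ ξ : X → Y → ℝ, (∀ x, Measurable (ξ x)) ∧
    (∀ x, Integrable (ξ x) (W x) ∧ ∫ y, ξ x y ∂(W x) = 0) ∧
    (∀ r : ℝ, 0 < r → ∀ t ∈ Set.Ioo (0 : ℝ) (1 / 2),
      (0 : EReal) < ((-1 / t : ℝ) : EReal) * log2 (supMoment W 𝒳 ξ t r)) ∧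
    ⨆ x, evariance (ξ x) (W x) < ∞

/-! ### Codes for secure list decoding -/

/-- A code of block length `n` with `M` messages and list size `L < M`, for honest inputs in
`𝒳`: a stochastic encoder, which assigns to a message a distribution on `𝒳ⁿ`, and a decoder,
which assigns to an output in `Yⁿ` a list of at most `L` messages. -/
structure ListCode (𝒳 : Finset X) (Y : Type*) [MeasurableSpace Y] (n : ℕ) where
  M : ℕ
  L : ℕ
  L_pos : 0 < L
  L_lt_M : L < M
  enc : Fin M → (Fin n → 𝒳) → ℝ
  enc_mem : ∀ m, enc m ∈ stdSimplex ℝ (Fin n → 𝒳)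
  dec : (Fin n → Y) → Finset (Fin M)
  measurableSet_dec : ∀ m, MeasurableSet {y | m ∈ dec y}
  card_dec_le : ∀ y, (dec y).card ≤ L

namespace ListCode

variable {𝒳 : Finset X} {n : ℕ}

/-- The encoder is deterministic: it assigns to each message the point mass at some input. -/
def IsDeterministic (c : ListCode 𝒳 Y n) : Prop := ∀ m, ∃ x, c.enc m x = 1

/-- The distribution of the output when the message `m` is encoded. -/
def out (c : ListCode 𝒳 Y n) (W : X → Measure Y) (m : Fin c.M) : Measure (Fin n → Y) :=
  mixture (c.enc m) fun x => prodChannel W n fun i => (x i : X)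

/-- `ε_A`: the largest probability that the list misses the encoded message. -/
def errA (c : ListCode 𝒳 Y n) (W : X → Measure Y) : ℝ≥0∞ :=
  ⨆ m, c.out W m {y | m ∉ c.dec y}

/-- `δ_{D',x}`: the second largest (counted with multiplicity) of the probabilities, over the
messages `m`, that the list contains `m` when `x` is sent. -/
def bindAt (c : ListCode 𝒳 Y n) (W : X → Measure Y) (x : Fin n → X) : ℝ≥0∞ :=
  ⨆ (m : Fin c.M) (m' : Fin c.M) (_ : m ≠ m'),
    min (prodChannel W n x {y | m ∈ c.dec y}) (prodChannel W n x {y | m' ∈ c.dec y})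

/-- `δ_{D'}`: dishonest Alice may send any sequence of inputs in `X`. -/
def bindD (c : ListCode 𝒳 Y n) (W : X → Measure Y) : ℝ≥0∞ := ⨆ x : Fin n → X, c.bindAt W x

/-- `E(φ) = log M - min_Q ∑ m, (1 / M) D(W_{φ(m)} ‖ Q)`. -/
def equivocation (c : ListCode 𝒳 Y n) (μ : Measure Y) (W : X → Measure Y) : EReal :=
  ((Real.logb 2 c.M : ℝ) : EReal) -
    ((⨅ Q ∈ acProb (Measure.pi fun _ : Fin n => μ),
      ∑ m, (c.M : ℝ≥0∞)⁻¹ * klDiv2 (c.out W m) Q : ℝ≥0∞) : EReal)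

/-- `E_α(φ) =
log M - min_Q (α - 1)⁻¹ log₂ ∑ m, (1 / M) 2 ^ ((α - 1) D_α(W_{φ(m)} ‖ Q))`. -/
def renyiEquivocation (c : ListCode 𝒳 Y n) (α : ℝ) (μ : Measure Y) (W : X → Measure Y) : EReal :=
  ((Real.logb 2 c.M : ℝ) : EReal) -
    ⨅ Q ∈ acProb (Measure.pi fun _ : Fin n => μ), ((1 / (α - 1) : ℝ) : EReal) *
      log2 (∑ m, (c.M : ℝ≥0∞)⁻¹ *
        exp2 (((α - 1 : ℝ) : EReal) * renyiDiv α (Measure.pi fun _ : Fin n => μ) (c.out W m) Q))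

end ListCode

/-! ### Ultimately achievable rate triples -/

variable {𝒳 : Finset X}

/-- `ε_A` and `δ_{D'}` tend to zero. -/
def UltimatelySecure (W : X → Measure Y) (c : ∀ n, ListCode 𝒳 Y n) : Prop :=
  Tendsto (fun n => (c n).errA W) atTop (𝓝 0) ∧ Tendsto (fun n => (c n).bindD W) atTop (𝓝 0)

/-- The message size and the list size have exponential rates `R₁` and `R₂`. -/
def HasRates (c : ∀ n, ListCode 𝒳 Y n) (R₁ R₂ : ℝ) : Prop :=
  Tendsto (fun n : ℕ => (1 / n : ℝ) * Real.logb 2 (c n).M) atTop (𝓝 R₁) ∧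
    Tendsto (fun n : ℕ => (1 / n : ℝ) * Real.logb 2 (c n).L) atTop (𝓝 R₂)

/-- The ultimately stochastically achievable rate triples (with positive rates). -/
def regionUS (μ : Measure Y) (W : X → Measure Y) (𝒳 : Finset X) : Set (ℝ × ℝ × ℝ) :=
  {R | (0 < R.1 ∧ 0 < R.2.1 ∧ 0 < R.2.2) ∧ ∃ c : ∀ n, ListCode 𝒳 Y n,
    UltimatelySecure W c ∧ HasRates c R.1 R.2.1 ∧
    (R.2.2 : EReal) ≤
      liminf (fun n : ℕ => ((1 / n : ℝ) : EReal) * (c n).equivocation μ W) atTop}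

/-- The ultimately deterministically achievable rate triples (with positive rates). -/
def regionUD (μ : Measure Y) (W : X → Measure Y) (𝒳 : Finset X) : Set (ℝ × ℝ × ℝ) :=
  {R | (0 < R.1 ∧ 0 < R.2.1 ∧ 0 < R.2.2) ∧ ∃ c : ∀ n, ListCode 𝒳 Y n,
    (∀ n, (c n).IsDeterministic) ∧
    UltimatelySecure W c ∧ HasRates c R.1 R.2.1 ∧
    (R.2.2 : EReal) ≤
      liminf (fun n : ℕ => ((1 / n : ℝ) : EReal) * (c n).equivocation μ W) atTop}

/-- The `α`-ultimately stochastically achievable rate triples (with positive rates). -/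
def regionUSα (α : ℝ) (μ : Measure Y) (W : X → Measure Y) (𝒳 : Finset X) : Set (ℝ × ℝ × ℝ) :=
  {R | (0 < R.1 ∧ 0 < R.2.1 ∧ 0 < R.2.2) ∧ ∃ c : ∀ n, ListCode 𝒳 Y n,
    UltimatelySecure W c ∧ HasRates c R.1 R.2.1 ∧
    (R.2.2 : EReal) ≤
      liminf (fun n : ℕ => ((1 / n : ℝ) : EReal) * (c n).renyiEquivocation α μ W) atTop}

/-- The `α`-ultimately deterministically achievable rate triples (with positive rates). -/
def regionUDα (α : ℝ) (μ : Measure Y) (W : X → Measure Y) (𝒳 : Finset X) : Set (ℝ × ℝ × ℝ) :=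
  {R | (0 < R.1 ∧ 0 < R.2.1 ∧ 0 < R.2.2) ∧ ∃ c : ∀ n, ListCode 𝒳 Y n,
    (∀ n, (c n).IsDeterministic) ∧
    UltimatelySecure W c ∧ HasRates c R.1 R.2.1 ∧
    (R.2.2 : EReal) ≤
      liminf (fun n : ℕ => ((1 / n : ℝ) : EReal) * (c n).renyiEquivocation α μ W) atTop}

end Channel

end SecureList

end

set_option linter.unusedSectionVars false

namespace SecureList

/-! ### Product measures -/

section Pi

variable {Y : Type*} [MeasurableSpace Y]

/-! Converse. Send a uniformly distributed message and let Xⁿ, Yⁿ be the input and the output.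
Fano's inequality for lists (`fano_list`) gives log M − log L ≤ I(Xⁿ;Yⁿ) + o(n). The binding
condition says that for each input sequence at most one message is listed with non-negligible
probability; a correctly decoded message is therefore nearly a function of Xⁿ, and log M + e ≤ H(Xⁿ)
+ o(n), where e is the mean entropy of the encoder (`log_card_add_ent_le`). The equivocation is at
most log M − I(Xⁿ;Yⁿ) + e (`infoD_sub_le_avg_klDiv`), hence at most H(Xⁿ) − I(Xⁿ;Yⁿ) + o(n), and e =
0 for a deterministic encoder. `code_converse` collects these bounds.

The information enters with both signs, so single-letterization must reproduce it exactly. The chain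
rule `infoD_prodDens` conditions each new letter on the past output and is an equality; the same
conditioning can only increase the entropy (`ent_le_marg_add`). The pair (I/n, H/n) is thus replaced
by an average of single-letter pairs, a point of the closed convex hull of all pairs (I(X;Y)_P,
H(X)_P) (`exists_infoHull_nDens`). A point of the hull is a choice of auxiliary variable U and of P.
Condition (W2) makes the information positive whenever the entropy is, so a small perturbation of
the rates restores the strict inequalities (`regionUD_subset`, `regionUS_subset`).

Achievability. Fix a sequence u₁, u₂, … with letter frequencies P_U and weigh input sequences by the
product of the laws P_{X|U=uᵢ}. Codewords are selected one after the other from a typical set and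
then expurgated (`exists_expurgated`), so that each codeword has few false candidates in a
likelihood test and no other codeword in a small Hamming ball. This is possible below the
information and the entropy, respectively. The decoder also requires the test built from ξ in (W3):
a sequence that dishonest Alice sends is far from one of any two distant codewords, and so fails at
least one of the two tests (`far_or_far`, `prodChannel_testSet_le`). `exists_listCode` is the
one-block construction and `exists_listCode_seq` its asymptotic form.

The typical set in `exists_listCode_seq` is arbitrary up to its weight, and the equivocation is
controlled through this freedom. For E, codewords are required to have a divergence sum of at most
n(I + τ) from the product output law (`regionC_subset`). For E_α, they are required to have Rényi
moments, relative to a product of near-optimal Q_u, of at most four times the mean bound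
(`regionCα_subset`). In both cases a product measure as Q bounds the minimum in the definition of
equivocation. -/

lemma lintegral_pi_prod {n : ℕ} (ν : Fin n → Measure Y) [∀ i, SigmaFinite (ν i)]
    (f : Fin n → Y → ℝ≥0∞) (hf : ∀ i, Measurable (f i)) :
    ∫⁻ y, ∏ i, f i (y i) ∂(Measure.pi ν) = ∏ i, ∫⁻ y, f i y ∂(ν i) := by
  induction n with
  | zero => simp
  | succ n ih =>
    rw [← ((measurePreserving_piFinSuccAbove ν 0).symm
      (MeasurableEquiv.piFinSuccAbove (fun _ => Y) 0)).lintegral_comp_emb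
      (MeasurableEquiv.measurableEmbedding _)]
    simp only [Fin.prod_univ_succ, MeasurableEquiv.piFinSuccAbove_symm_apply,
      Fin.insertNthEquiv_apply, Fin.insertNth_zero, Fin.cons_zero, Fin.cons_succ,
      Fin.zero_succAbove, cast_eq]
    rw [lintegral_prod_mul (f := f 0) (g := fun y : Fin n → Y => ∏ i, f i.succ (y i))
      (hf 0).aemeasurable
      (Finset.measurable_prod _ fun i _ => (hf i.succ).comp (measurable_pi_apply i)).aemeasurable]
    rw [ih (fun i => ν i.succ) (fun i => f i.succ) (fun i => hf _)]

lemma pi_withDensity {n : ℕ} (ν : Fin n → Measure Y) [∀ i, SigmaFinite (ν i)]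
    (f : Fin n → Y → ℝ≥0∞) (hf : ∀ i, Measurable (f i))
    [∀ i, SigmaFinite ((ν i).withDensity (f i))] :
    Measure.pi (fun i => (ν i).withDensity (f i)) =
      (Measure.pi ν).withDensity (fun y => ∏ i, f i (y i)) := by
  refine Measure.pi_eq fun s hs => ?_
  rw [withDensity_apply _ (MeasurableSet.univ_pi hs), ← lintegral_indicator (.univ_pi hs)]
  have : (Set.univ.pi s).indicator (fun y : Fin n → Y => ∏ i, f i (y i)) =
      fun y => ∏ i, (s i).indicator (f i) (y i) := by
    ext y
    by_cases h : y ∈ Set.univ.pi s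
    · rw [Set.indicator_of_mem h]
      exact Finset.prod_congr rfl fun i _ => (Set.indicator_of_mem (h i trivial) _).symm
    · rw [Set.indicator_of_notMem h]
      simp only [Set.mem_pi, Set.mem_univ, true_imp_iff, not_forall] at h
      obtain ⟨i, hi⟩ := h
      exact (Finset.prod_eq_zero (Finset.mem_univ i) (Set.indicator_of_notMem hi _)).symm
  rw [this, lintegral_pi_prod ν _ fun i => (hf i).indicator (hs i)]
  exact Finset.prod_congr rfl fun i _ => by
    rw [lintegral_indicator (hs i), withDensity_apply _ (hs i)]

/-- Chebyshev's inequality for a sum of independent coordinates. -/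
lemma pi_sum_le_sub_le {n : ℕ} (ν : Fin n → Measure Y) [∀ i, IsProbabilityMeasure (ν i)]
    (f : Fin n → Y → ℝ) (hf : ∀ i, MemLp (f i) 2 (ν i)) (C : ℝ)
    (hC : ∀ i, Var[f i; ν i] ≤ C) {η : ℝ} (hη : 0 < η) (hn : 0 < n) :
    Measure.pi ν {y | η * n ≤ |∑ i, f i (y i) - ∑ i, ∫ z, f i z ∂(ν i)|} ≤
      ENNReal.ofReal (C / (η ^ 2 * n)) := by
  have hn' : (0 : ℝ) < n := by exact_mod_cast hn
  have hmem : ∀ i, MemLp (fun y : Fin n → Y => f i (y i)) 2 (Measure.pi ν) := fun i =>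
    (hf i).comp_measurePreserving (measurePreserving_eval ν i)
  have hS : MemLp (fun y : Fin n → Y => ∑ i, f i (y i)) 2 (Measure.pi ν) :=
    memLp_finsetSum _ fun i _ => hmem i
  have hE : ∫ y, ∑ i, f i (y i) ∂(Measure.pi ν) = ∑ i, ∫ z, f i z ∂(ν i) := by
    rw [integral_finsetSum _ fun i _ => (hmem i).integrable (by norm_num)]
    exact Finset.sum_congr rfl fun i _ => integral_comp_eval (hf i).aestronglyMeasurable
  have h := meas_ge_le_variance_div_sq hS (c := η * n) (by positivity)
  rw [hE] at h
  refine h.trans (ENNReal.ofReal_le_ofReal ?_)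
  have hV : Var[fun y : Fin n → Y => ∑ i, f i (y i); Measure.pi ν] ≤ n * C := by
    have := variance_sum_pi (μ := ν) (X := f) hf
    rw [show (fun y : Fin n → Y => ∑ i, f i (y i)) = ∑ i, fun y : Fin n → Y => f i (y i) by
      ext; simp, this]
    calc ∑ i, Var[f i; ν i] ≤ ∑ _i : Fin n, C := Finset.sum_le_sum fun i _ => hC i
      _ = n * C := by simp
  calc _ ≤ n * C / (η * n) ^ 2 := by gcongr
    _ = C / (η ^ 2 * n) := by field_simp

end Pi

/-! ### Divergence from densities and the variational lower bound -/

section Divergence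

variable {Ω : Type*} [MeasurableSpace Ω]

lemma withDensity_div_ae (ν : Measure Ω) {p q : Ω → ℝ} (hp : Measurable p)
    (hq : Measurable q) (hq0 : ∀ y, 0 ≤ q y)
    (hac : ∀ y, q y = 0 → p y = 0) :
    ν.withDensity (fun y => ENNReal.ofReal (p y)) =
      (ν.withDensity fun y => ENNReal.ofReal (q y)).withDensity
        fun y => ENNReal.ofReal (p y / q y) := by
  rw [← withDensity_mul _ (by fun_prop) (by fun_prop)]
  congr 1
  ext y
  simp only [Pi.mul_apply]
  rw [← ENNReal.ofReal_mul (hq0 y)]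
  rcases (hq0 y).eq_or_lt with h | h
  · simp [← h, hac y h.symm]
  · rw [mul_div_cancel₀ _ h.ne']

lemma llr_withDensity_ae (ν : Measure Ω) {p q : Ω → ℝ} (hp : Measurable p)
    (hq : Measurable q) (hp0 : ∀ y, 0 ≤ p y) (hq0 : ∀ y, 0 ≤ q y)
    (hac : ∀ y, q y = 0 → p y = 0)
    [SigmaFinite (ν.withDensity fun y => ENNReal.ofReal (q y))] :
    llr (ν.withDensity fun y => ENNReal.ofReal (p y))
      (ν.withDensity fun y => ENNReal.ofReal (q y))
      =ᵐ[ν.withDensity fun y => ENNReal.ofReal (p y)] fun y => Real.log (p y / q y) := by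
  have h := withDensity_div_ae ν hp hq hq0 hac
  have h1 : (ν.withDensity fun y => ENNReal.ofReal (p y)) ≪
      (ν.withDensity fun y => ENNReal.ofReal (q y)) := by
    rw [h]; exact withDensity_absolutelyContinuous _ _
  have h2 := Measure.rnDeriv_withDensity (ν.withDensity fun y => ENNReal.ofReal (q y))
    (f := fun y => ENNReal.ofReal (p y / q y)) (by fun_prop)
  rw [← h] at h2
  filter_upwards [h1.ae_le h2] with y hy
  rw [llr_def]
  simp only [hy]
  rw [ENNReal.toReal_ofReal (div_nonneg (hp0 y) (hq0 y))]

/-- The divergence of two probability measures in terms of their densities. -/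
lemma klDiv_withDensity (ν : Measure Ω) {p q : Ω → ℝ} (hp : Measurable p)
    (hq : Measurable q) (hp0 : ∀ y, 0 ≤ p y) (hq0 : ∀ y, 0 ≤ q y)
    (hac : ∀ y, q y = 0 → p y = 0) {P Q : Measure Ω}
    [IsProbabilityMeasure P] [IsProbabilityMeasure Q]
    (hP : P = ν.withDensity fun y => ENNReal.ofReal (p y))
    (hQ : Q = ν.withDensity fun y => ENNReal.ofReal (q y))
    (hint : Integrable (fun y => Real.log (p y / q y)) P) :
    0 ≤ ∫ y, Real.log (p y / q y) ∂P ∧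
      InformationTheory.klDiv P Q = ENNReal.ofReal (∫ y, Real.log (p y / q y) ∂P) := by
  have : SigmaFinite (ν.withDensity fun y => ENNReal.ofReal (q y)) := by rw [← hQ]; infer_instance
  have hl := llr_withDensity_ae ν hp hq hp0 hq0 hac
  rw [← hP, ← hQ] at hl
  have h1 : P ≪ Q := by
    rw [hP, withDensity_div_ae ν hp hq hq0 hac, ← hQ]
    exact withDensity_absolutelyContinuous _ _
  have hint' := (integrable_congr hl).2 hint
  refine ⟨?_, ?_⟩
  · have := InformationTheory.integral_llr_add_sub_measure_univ_nonneg h1 hint'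
    rwa [integral_congr_ae hl, probReal_univ, probReal_univ, add_sub_cancel_right] at this
  · rw [InformationTheory.klDiv_of_ac_of_integrable h1 hint']
    simp [integral_congr_ae hl]

/-- The variational lower bound on the divergence. -/
lemma le_klDiv {P Q : Measure Ω} [IsProbabilityMeasure P] [IsProbabilityMeasure Q]
    {g : Ω → ℝ} (hg0 : ∀ y, 0 ≤ g y) (hgP : ∀ᵐ y ∂P, 0 < g y)
    (hlog : Integrable (fun y => Real.log (g y)) P) (hg : Integrable g Q) :
    ENNReal.ofReal (∫ y, Real.log (g y) ∂P - ∫ y, g y ∂Q + 1) ≤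
      InformationTheory.klDiv P Q := by
  by_cases hac : P ≪ Q
  swap
  · simp [InformationTheory.klDiv_of_not_ac hac]
  by_cases hint : Integrable (llr P Q) P
  swap
  · simp [InformationTheory.klDiv_of_not_integrable hint]
  rw [InformationTheory.klDiv_of_ac_of_integrable hac hint]
  apply ENNReal.ofReal_le_ofReal
  simp only [probReal_univ, add_sub_cancel_right]
  set ρ : Ω → ℝ := fun y => (P.rnDeriv Q y).toReal with hρ
  have hρ0 : ∀ y, 0 ≤ ρ y := fun y => ENNReal.toReal_nonneg
  have hρpos : ∀ᵐ y ∂P, 0 < ρ y := by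
    filter_upwards [Measure.rnDeriv_pos hac, hac.ae_le (Measure.rnDeriv_lt_top P Q)] with y hy hy'
    exact ENNReal.toReal_pos hy.ne' hy'.ne
  -- Equality fails only where ρ = 0, since division by zero gives 0 there. This inequality
  -- suffices: the bound log(g/ρ) ≤ g/ρ − 1 is integrated against P and the integral of g/ρ is
  -- carried over to Q.
  have hmul : ∀ y, ρ y * (g y / ρ y) ≤ g y := by
    intro y
    rcases (hρ0 y).eq_or_lt with h | h
    · simp [← h, hg0 y]
    · rw [mul_div_cancel₀ _ h.ne']
  have hmeas : Measurable ρ := (Measure.measurable_rnDeriv P Q).ennreal_toReal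
  have hI : Integrable (fun y => ρ y * (g y / ρ y)) Q := by
    refine hg.mono (hmeas.aemeasurable.mul
      (hg.aestronglyMeasurable.aemeasurable.div hmeas.aemeasurable)).aestronglyMeasurable ?_
    filter_upwards with y
    rw [Real.norm_of_nonneg (mul_nonneg (hρ0 y) (div_nonneg (hg0 y) (hρ0 y))),
      Real.norm_of_nonneg (hg0 y)]
    exact hmul y
  have hI' : Integrable (fun y => g y / ρ y) P :=
    (integrable_rnDeriv_smul_iff hac (f := fun y => g y / ρ y)).1 hI
  have h1 : ∫ y, g y / ρ y ∂P ≤ ∫ y, g y ∂Q := by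
    rw [← integral_rnDeriv_smul hac (f := fun y => g y / ρ y)]
    exact integral_mono hI hg hmul
  have h2 : ∫ y, Real.log (g y) - llr P Q y ∂P ≤ ∫ y, g y / ρ y - 1 ∂P := by
    refine integral_mono_ae (hlog.sub hint) (hI'.sub (integrable_const 1)) ?_
    filter_upwards [hgP, hρpos] with y h3 h4
    rw [llr_def]
    change Real.log (g y) - Real.log (ρ y) ≤ _
    rw [← Real.log_div h3.ne' h4.ne']
    exact Real.log_le_sub_one_of_pos (by positivity)
  rw [integral_sub hlog hint, integral_sub hI' (integrable_const 1)] at h2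
  simp only [integral_const, probReal_univ, smul_eq_mul, mul_one] at h2
  linarith

end Divergence

/-! ### Information quantities of a family of densities, in nats -/

/-- `v` is a family of probability densities with respect to `ν`. -/
structure IsDensity {A Ω : Type*} [MeasurableSpace Ω] (ν : Measure Ω) (v : A → Ω → ℝ) : Prop where
  meas : ∀ a, Measurable (v a)
  nonneg : ∀ a y, 0 ≤ v a y
  integrable : ∀ a, Integrable (v a) ν
  integral_eq : ∀ a, ∫ y, v a y ∂ν = 1

section Info

variable {A : Type*} [Fintype A] {Ω : Type*} [MeasurableSpace Ω]

/-- The density of the output distribution. -/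
noncomputable def mixDens (v : A → Ω → ℝ) (P : A → ℝ) (y : Ω) : ℝ := ∑ a, P a * v a y

/-- The mutual information in nats. -/
noncomputable def infoD (ν : Measure Ω) (v : A → Ω → ℝ) (P : A → ℝ) : ℝ :=
  ∫ y, ∑ a, P a * (v a y * Real.log (v a y / mixDens v P y)) ∂ν

/-- The Shannon entropy in nats. -/
noncomputable def ent (P : A → ℝ) : ℝ := ∑ a, (P a).negMulLog

/-- The posterior distribution of the input. -/
noncomputable def post (v : A → Ω → ℝ) (P : A → ℝ) (y : Ω) (a : A) : ℝ :=
  P a * v a y / mixDens v P y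

lemma stdSimplex_le_one {P : A → ℝ} (hP : P ∈ stdSimplex ℝ A) (a : A) : P a ≤ 1 := by
  rw [← hP.2]
  exact Finset.single_le_sum (fun b _ => hP.1 b) (Finset.mem_univ a)

lemma ent_nonneg {P : A → ℝ} (hP : P ∈ stdSimplex ℝ A) : 0 ≤ ent P :=
  Finset.sum_nonneg fun a _ => Real.negMulLog_nonneg (hP.1 a) (stdSimplex_le_one hP a)

lemma ent_le_card {P : A → ℝ} (hP : P ∈ stdSimplex ℝ A) : ent P ≤ Fintype.card A := by
  calc ent P ≤ ∑ _a : A, (1 : ℝ) := Finset.sum_le_sum fun a _ => by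
        have := Real.negMulLog_le_one_sub_self (hP.1 a)
        linarith [hP.1 a]
    _ = _ := by simp

variable {ν : Measure Ω} {v : A → Ω → ℝ} {P : A → ℝ}

lemma mixDens_nonneg (hv : IsDensity ν v) (hP : P ∈ stdSimplex ℝ A) (y : Ω) :
    0 ≤ mixDens v P y :=
  Finset.sum_nonneg fun a _ => mul_nonneg (hP.1 a) (hv.nonneg a y)

lemma mul_le_mixDens (hv : IsDensity ν v) (hP : P ∈ stdSimplex ℝ A) (y : Ω) (a : A) :
    P a * v a y ≤ mixDens v P y :=
  Finset.single_le_sum (f := fun a => P a * v a y)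
    (fun b _ => mul_nonneg (hP.1 b) (hv.nonneg b y)) (Finset.mem_univ a)

lemma measurable_mixDens (hv : IsDensity ν v) (P : A → ℝ) : Measurable (mixDens v P) :=
  Finset.measurable_sum _ fun a _ => (hv.meas a).const_mul _

lemma integrable_mixDens (hv : IsDensity ν v) (P : A → ℝ) : Integrable (mixDens v P) ν :=
  integrable_finsetSum _ fun a _ => (hv.integrable a).const_mul _

lemma integral_mixDens (hv : IsDensity ν v) (hP : P ∈ stdSimplex ℝ A) :
    ∫ y, mixDens v P y ∂ν = 1 := by
  unfold mixDens
  rw [integral_finsetSum _ fun a _ => (hv.integrable a).const_mul _]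
  simp_rw [integral_const_mul, hv.integral_eq, mul_one]
  exact hP.2

lemma post_mem (hv : IsDensity ν v) (hP : P ∈ stdSimplex ℝ A) {y : Ω}
    (hy : mixDens v P y ≠ 0) : post v P y ∈ stdSimplex ℝ A := by
  refine ⟨fun a => div_nonneg (mul_nonneg (hP.1 a) (hv.nonneg a y)) (mixDens_nonneg hv hP y), ?_⟩
  unfold post
  rw [← Finset.sum_div]
  exact div_self hy

/-- Valid also where the output density vanishes: all P a * v a y are then zero, so no exceptional
set has to be carried along. -/
lemma mixDens_mul_post (hv : IsDensity ν v) (hP : P ∈ stdSimplex ℝ A) (y : Ω) (a : A) :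
    mixDens v P y * post v P y a = P a * v a y := by
  unfold post
  by_cases hy : mixDens v P y = 0
  · have := mul_le_mixDens hv hP y a
    have h2 := mul_nonneg (hP.1 a) (hv.nonneg a y)
    rw [hy] at this
    rw [hy, zero_mul]
    linarith
  · field_simp

lemma log_ratio_eq (hv : IsDensity ν v) (hP : P ∈ stdSimplex ℝ A) {y : Ω} {a : A}
    (ha : 0 < P a) (hva : 0 < v a y) :
    Real.log (v a y / mixDens v P y) = Real.log (post v P y a) - Real.log (P a) := by
  have hm : 0 < mixDens v P y := (mul_pos ha hva).trans_le (mul_le_mixDens hv hP y a)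
  unfold post
  rw [← Real.log_div (by positivity) ha.ne']
  congr 1
  field_simp

/-- This rewrites the log-likelihood ratio through the posterior probability, which lies in [0,1].
The unbounded logarithm becomes `negMulLog` of a bounded quantity, and integrability of the
information density for a finite input alphabet follows with no assumption on the channel. -/
lemma info_term_eq (hv : IsDensity ν v) (hP : P ∈ stdSimplex ℝ A) (y : Ω) (a : A) :
    P a * (v a y * Real.log (v a y / mixDens v P y)) =
      -(mixDens v P y * (post v P y a).negMulLog) - v a y * (P a * Real.log (P a)) := by
  have h := mixDens_mul_post hv hP y a
  rcases (hP.1 a).eq_or_lt with ha | ha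
  · have : post v P y a = 0 := by simp [post, ← ha]
    simp [← ha, this]
  rcases (hv.nonneg a y).eq_or_lt with hva | hva
  · have : post v P y a = 0 := by simp [post, ← hva]
    simp [← hva, this]
  rw [log_ratio_eq hv hP ha hva, Real.negMulLog]
  linear_combination (-Real.log (post v P y a)) * h

lemma measurable_post (hv : IsDensity ν v) (P : A → ℝ) (a : A) :
    Measurable fun y => post v P y a :=
  ((hv.meas a).const_mul _).div (measurable_mixDens hv P)

/-- Since 0 ≤ `negMulLog` ≤ 1 on [0,1], the output density itself dominates the integrand. -/
lemma integrable_mixDens_mul_negMulLog (hv : IsDensity ν v) (hP : P ∈ stdSimplex ℝ A) (a : A) :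
    Integrable (fun y => mixDens v P y * (post v P y a).negMulLog) ν := by
  refine (integrable_mixDens hv P).mono ((measurable_mixDens hv P).mul
    (Real.continuous_negMulLog.measurable.comp (measurable_post hv P a))).aestronglyMeasurable ?_
  filter_upwards with y
  have h0 := mixDens_nonneg hv hP y
  rw [Real.norm_eq_abs, Real.norm_eq_abs, abs_mul, abs_of_nonneg h0]
  by_cases hy : mixDens v P y = 0
  · simp [hy]
  have hp := post_mem hv hP hy
  have h1 := Real.negMulLog_nonneg (hp.1 a) (stdSimplex_le_one hp a)
  have h2 := Real.negMulLog_le_one_sub_self (hp.1 a)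
  rw [abs_of_nonneg h1]
  nlinarith [hp.1 a]

lemma integrable_info_term (hv : IsDensity ν v) (hP : P ∈ stdSimplex ℝ A) (a : A) :
    Integrable (fun y => P a * (v a y * Real.log (v a y / mixDens v P y))) ν := by
  simp_rw [info_term_eq hv hP]
  exact (integrable_mixDens_mul_negMulLog hv hP a).neg.sub ((hv.integrable a).mul_const _)

lemma integrable_info_sum (hv : IsDensity ν v) (hP : P ∈ stdSimplex ℝ A) :
    Integrable (fun y => ∑ a, P a * (v a y * Real.log (v a y / mixDens v P y))) ν :=
  integrable_finsetSum _ fun a _ => integrable_info_term hv hP a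

/-- `H(X|Y) = H(X) - I(X;Y)`. -/
lemma integral_ent_post (hv : IsDensity ν v) (hP : P ∈ stdSimplex ℝ A) :
    ∫ y, mixDens v P y * ent (post v P y) ∂ν = ent P - infoD ν v P := by
  have hI : ∀ a, Integrable (fun y => -(mixDens v P y * (post v P y a).negMulLog) -
      v a y * (P a * Real.log (P a))) ν := fun a =>
    (integrable_mixDens_mul_negMulLog hv hP a).neg.sub ((hv.integrable a).mul_const _)
  unfold infoD ent
  simp_rw [info_term_eq hv hP, Finset.mul_sum]
  rw [integral_finsetSum _ fun a _ => integrable_mixDens_mul_negMulLog hv hP a,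
    integral_finsetSum _ fun a _ => hI a, ← Finset.sum_sub_distrib]
  refine Finset.sum_congr rfl fun a _ => ?_
  have h1 : Integrable (fun y => -(mixDens v P y * (post v P y a).negMulLog)) ν :=
    (integrable_mixDens_mul_negMulLog hv hP a).neg
  rw [integral_sub h1 ((hv.integrable a).mul_const _),
    integral_neg, integral_mul_const, hv.integral_eq, Real.negMulLog]
  ring

/-- The integrand is nonnegative at every point: log x ≥ 1 − 1/x bounds it below by a sum of P a *
(v a y − mixture), which is zero. -/
lemma infoD_nonneg (hv : IsDensity ν v) (hP : P ∈ stdSimplex ℝ A) : 0 ≤ infoD ν v P := by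
  refine integral_nonneg fun y => ?_
  have h : ∑ a, P a * (v a y - mixDens v P y) ≤
      ∑ a, P a * (v a y * Real.log (v a y / mixDens v P y)) := by
    refine Finset.sum_le_sum fun a _ => ?_
    rcases (hP.1 a).eq_or_lt with ha | ha
    · simp [← ha]
    have h0 := mixDens_nonneg hv hP y
    rcases (hv.nonneg a y).eq_or_lt with hva | hva
    · simp only [← hva, zero_sub, zero_mul, mul_zero]
      nlinarith
    have hm : 0 < mixDens v P y := (mul_pos ha hva).trans_le (mul_le_mixDens hv hP y a)
    refine mul_le_mul_of_nonneg_left ?_ ha.le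
    have := Real.one_sub_inv_le_log_of_pos (div_pos hva hm)
    calc v a y - mixDens v P y = v a y * (1 - (v a y / mixDens v P y)⁻¹) := by field_simp
      _ ≤ _ := by gcongr
  refine le_trans (le_of_eq ?_) h
  simp_rw [mul_sub, Finset.sum_sub_distrib, ← Finset.sum_mul, hP.2]
  simp [mixDens]

lemma infoD_eq_sum (hv : IsDensity ν v) (hP : P ∈ stdSimplex ℝ A) :
    infoD ν v P = ∑ a, P a * ∫ y, v a y * Real.log (v a y / mixDens v P y) ∂ν := by
  unfold infoD
  rw [integral_finsetSum _ fun a _ => integrable_info_term hv hP a]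
  simp_rw [integral_const_mul]

lemma integrable_log_ratio (hv : IsDensity ν v) (hP : P ∈ stdSimplex ℝ A) {a : A}
    (ha : P a ≠ 0) : Integrable (fun y => v a y * Real.log (v a y / mixDens v P y)) ν := by
  simpa [ha] using (integrable_info_term hv hP a).const_mul (P a)⁻¹

/-- The squared log-likelihood ratio is integrable. -/
lemma integrable_sq_log_ratio (hv : IsDensity ν v) (hP : P ∈ stdSimplex ℝ A) {a : A}
    (ha : P a ≠ 0) :
    Integrable (fun y => v a y * Real.log (v a y / mixDens v P y) ^ 2) ν := by
  have hpos := (hP.1 a).lt_of_ne' ha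
  have hmeas : Measurable (fun y => v a y * Real.log (v a y / mixDens v P y) ^ 2) :=
    (hv.meas a).mul ((Real.measurable_log.comp
      ((hv.meas a).div (measurable_mixDens hv P))).pow_const 2)
  refine ((integrable_mixDens hv P).mul_const
    ((P a)⁻¹ * (8 + 2 * Real.log (P a) ^ 2))).mono hmeas.aestronglyMeasurable ?_
  filter_upwards with y
  have h0 := mixDens_nonneg hv hP y
  have hle : v a y * Real.log (v a y / mixDens v P y) ^ 2 ≤
      mixDens v P y * ((P a)⁻¹ * (8 + 2 * Real.log (P a) ^ 2)) := by
    rcases (hv.nonneg a y).eq_or_lt with hva | hva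
    · rw [← hva]; simp; positivity
    have hm : 0 < mixDens v P y := (mul_pos hpos hva).trans_le (mul_le_mixDens hv hP y a)
    have hp := post_mem hv hP hm.ne'
    have hq : 0 < post v P y a := by unfold post; positivity
    have hq1 := stdSimplex_le_one hp a
    have hv' : v a y = (P a)⁻¹ * (mixDens v P y * post v P y a) := by
      rw [mixDens_mul_post hv hP]; field_simp
    rw [log_ratio_eq hv hP hpos hva]
    set q := post v P y a
    set l := Real.log (P a)
    -- With s = √q one has q log² q = 4 (s log s)², and −s log s lies in [0,1] for s in [0,1].
    have hs : q * Real.log q ^ 2 ≤ 4 := by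
      have h1 := Real.negMulLog_le_one_sub_self (Real.sqrt_nonneg q)
      have h2 := Real.negMulLog_nonneg (Real.sqrt_nonneg q) (Real.sqrt_le_one.2 hq1)
      have h3 : Real.log q = 2 * Real.log (Real.sqrt q) := by
        rw [Real.log_sqrt hq.le]; ring
      have h4 : q * Real.log q ^ 2 = 4 * (Real.sqrt q).negMulLog ^ 2 := by
        rw [h3, Real.negMulLog]
        nth_rewrite 1 [← Real.sq_sqrt hq.le]
        ring
      rw [h4]
      nlinarith [Real.sqrt_nonneg q]
    have h5 : q * (Real.log q - l) ^ 2 ≤ 8 + 2 * l ^ 2 := by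
      nlinarith [mul_nonneg hq.le (sq_nonneg (Real.log q + l)), sq_nonneg l]
    rw [hv']
    calc _ = (P a)⁻¹ * (mixDens v P y * (q * (Real.log q - l) ^ 2)) := by ring
      _ ≤ (P a)⁻¹ * (mixDens v P y * (8 + 2 * l ^ 2)) := by gcongr
      _ = _ := by ring
  rw [Real.norm_of_nonneg (mul_nonneg (hv.nonneg a y) (sq_nonneg _)), Real.norm_eq_abs]
  exact hle.trans (le_abs_self _)

end Info

/-! ### The chain rule -/

section Chain

variable {A₁ A₂ : Type*} [Fintype A₁] [Fintype A₂] {Ω₁ Ω₂ : Type*} [MeasurableSpace Ω₁]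
  [MeasurableSpace Ω₂]

/-- The product of two families of densities. -/
def prodDens (v₁ : A₁ → Ω₁ → ℝ) (v₂ : A₂ → Ω₂ → ℝ) (a : A₁ × A₂) (y : Ω₁ × Ω₂) : ℝ :=
  v₁ a.1 y.1 * v₂ a.2 y.2

/-- The first marginal distribution. -/
def marg (P : A₁ × A₂ → ℝ) (a : A₁) : ℝ := ∑ b, P (a, b)

/-- The conditional distribution of the second input given the first output. -/
noncomputable def condPost (v₁ : A₁ → Ω₁ → ℝ) (P : A₁ × A₂ → ℝ) (y : Ω₁) (b : A₂) : ℝ :=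
  (∑ a, P (a, b) * v₁ a y) / mixDens v₁ (marg P) y

variable {ν₁ : Measure Ω₁} {ν₂ : Measure Ω₂} [SigmaFinite ν₁] [SigmaFinite ν₂]
  {v₁ : A₁ → Ω₁ → ℝ} {v₂ : A₂ → Ω₂ → ℝ} {P : A₁ × A₂ → ℝ}

lemma isDensity_prodDens (h₁ : IsDensity ν₁ v₁) (h₂ : IsDensity ν₂ v₂) :
    IsDensity (ν₁.prod ν₂) (prodDens v₁ v₂) where
  meas a := ((h₁.meas a.1).comp measurable_fst).mul ((h₂.meas a.2).comp measurable_snd)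
  nonneg a y := mul_nonneg (h₁.nonneg _ _) (h₂.nonneg _ _)
  integrable a := (h₁.integrable a.1).mul_prod (h₂.integrable a.2)
  integral_eq a := by
    unfold prodDens
    rw [integral_prod_mul (v₁ a.1) (v₂ a.2), h₁.integral_eq, h₂.integral_eq, one_mul]

lemma marg_mem (hP : P ∈ stdSimplex ℝ (A₁ × A₂)) : marg P ∈ stdSimplex ℝ A₁ := by
  refine ⟨fun a => Finset.sum_nonneg fun b _ => hP.1 _, ?_⟩
  rw [← hP.2, Fintype.sum_prod_type]
  rfl

lemma le_marg (hP : P ∈ stdSimplex ℝ (A₁ × A₂)) (a : A₁) (b : A₂) : P (a, b) ≤ marg P a :=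
  Finset.single_le_sum (f := fun b => P (a, b)) (fun _ _ => hP.1 _) (Finset.mem_univ b)

lemma mixDens_marg (y : Ω₁) :
    mixDens v₁ (marg P) y = ∑ b, ∑ a, P (a, b) * v₁ a y := by
  unfold mixDens marg
  rw [Finset.sum_comm]
  simp_rw [Finset.sum_mul]

lemma condPost_mem (h₁ : IsDensity ν₁ v₁) (hP : P ∈ stdSimplex ℝ (A₁ × A₂)) {y : Ω₁}
    (hy : mixDens v₁ (marg P) y ≠ 0) : condPost v₁ P y ∈ stdSimplex ℝ A₂ := by
  refine ⟨fun b => div_nonneg (Finset.sum_nonneg fun a _ => mul_nonneg (hP.1 _) (h₁.nonneg _ _))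
    (mixDens_nonneg h₁ (marg_mem hP) y), ?_⟩
  unfold condPost
  rw [← Finset.sum_div, ← mixDens_marg]
  exact div_self hy

lemma mixDens_mul_condPost (h₁ : IsDensity ν₁ v₁) (hP : P ∈ stdSimplex ℝ (A₁ × A₂)) (y : Ω₁)
    (b : A₂) : mixDens v₁ (marg P) y * condPost v₁ P y b = ∑ a, P (a, b) * v₁ a y := by
  unfold condPost
  by_cases hy : mixDens v₁ (marg P) y = 0
  · have h0 : ∀ b, 0 ≤ ∑ a, P (a, b) * v₁ a y := fun b =>
      Finset.sum_nonneg fun a _ => mul_nonneg (hP.1 _) (h₁.nonneg _ _)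
    have h2 := Finset.single_le_sum (f := fun b => ∑ a, P (a, b) * v₁ a y) (fun b _ => h0 b)
      (Finset.mem_univ b)
    rw [← mixDens_marg, hy] at h2
    rw [hy, zero_mul]
    linarith [h0 b]
  · field_simp

/-- The channel acts on the second letter without regard to the first, so given the first output the
second output is produced from the conditional law of the second input alone. -/
lemma mixDens_prodDens (h₁ : IsDensity ν₁ v₁) (hP : P ∈ stdSimplex ℝ (A₁ × A₂))
    (y : Ω₁ × Ω₂) : mixDens (prodDens v₁ v₂) P y =
      mixDens v₁ (marg P) y.1 * mixDens v₂ (condPost v₁ P y.1) y.2 := by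
  conv_rhs => unfold mixDens
  change _ = mixDens v₁ (marg P) y.1 * _
  rw [Finset.mul_sum]
  simp_rw [← mul_assoc, mixDens_mul_condPost h₁ hP]
  unfold mixDens prodDens
  rw [Fintype.sum_prod_type_right]
  simp_rw [Finset.sum_mul, mul_assoc]

/-- The factorization of the output density splits the logarithm. The second logarithm depends on
the second input only, so summing over the first input leaves the weight `condPost`. Terms with a
vanishing factor are zero on both sides, which permits taking logarithms in the rest. -/
lemma info_prod_pointwise (h₁ : IsDensity ν₁ v₁) (h₂ : IsDensity ν₂ v₂)
    (hP : P ∈ stdSimplex ℝ (A₁ × A₂)) (y : Ω₁ × Ω₂) :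
    ∑ a, P a * (prodDens v₁ v₂ a y *
        Real.log (prodDens v₁ v₂ a y / mixDens (prodDens v₁ v₂) P y)) =
      (∑ a : A₁ × A₂, P a * (v₁ a.1 y.1 * Real.log (v₁ a.1 y.1 / mixDens v₁ (marg P) y.1) *
        v₂ a.2 y.2)) +
      mixDens v₁ (marg P) y.1 * ∑ b, condPost v₁ P y.1 b *
        (v₂ b y.2 * Real.log (v₂ b y.2 / mixDens v₂ (condPost v₁ P y.1) y.2)) := by
  rw [Finset.mul_sum]
  simp_rw [← mul_assoc (mixDens v₁ (marg P) y.1), mixDens_mul_condPost h₁ hP]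
  have : ∀ b, (∑ a, P (a, b) * v₁ a y.1) *
      (v₂ b y.2 * Real.log (v₂ b y.2 / mixDens v₂ (condPost v₁ P y.1) y.2)) =
      ∑ a, P (a, b) * v₁ a y.1 *
      (v₂ b y.2 * Real.log (v₂ b y.2 / mixDens v₂ (condPost v₁ P y.1) y.2)) :=
    fun b => Finset.sum_mul _ _ _
  simp_rw [this]
  rw [← Fintype.sum_prod_type_right (fun a : A₁ × A₂ => P a * v₁ a.1 y.1 *
      (v₂ a.2 y.2 * Real.log (v₂ a.2 y.2 / mixDens v₂ (condPost v₁ P y.1) y.2))),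
    ← Finset.sum_add_distrib]
  refine Finset.sum_congr rfl fun a _ => ?_
  rw [mixDens_prodDens h₁ hP]
  unfold prodDens
  rcases (hP.1 a).eq_or_lt with ha | ha
  · simp [← ha]
  rcases (h₁.nonneg a.1 y.1).eq_or_lt with hv1 | hv1
  · simp [← hv1]
  rcases (h₂.nonneg a.2 y.2).eq_or_lt with hv2 | hv2
  · simp [← hv2]
  have hm1 : 0 < mixDens v₁ (marg P) y.1 :=
    (mul_pos (ha.trans_le (le_marg hP a.1 a.2)) hv1).trans_le
      (mul_le_mixDens h₁ (marg_mem hP) y.1 a.1)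
  have hc : 0 < condPost v₁ P y.1 a.2 := by
    refine div_pos ?_ hm1
    exact (mul_pos ha hv1).trans_le (Finset.single_le_sum (f := fun c => P (c, a.2) * v₁ c y.1)
      (fun c _ => mul_nonneg (hP.1 _) (h₁.nonneg _ _)) (Finset.mem_univ a.1))
  have hm2 : 0 < mixDens v₂ (condPost v₁ P y.1) y.2 :=
    (mul_pos hc hv2).trans_le (mul_le_mixDens h₂ (condPost_mem h₁ hP hm1.ne') y.2 a.2)
  rw [mul_div_mul_comm, Real.log_mul (by positivity) (by positivity)]
  ring

/-- The chain rule for mutual information over a memoryless channel, with the past output as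
conditioning variable. -/
lemma infoD_prodDens (h₁ : IsDensity ν₁ v₁) (h₂ : IsDensity ν₂ v₂)
    (hP : P ∈ stdSimplex ℝ (A₁ × A₂)) :
    Integrable (fun y => mixDens v₁ (marg P) y * infoD ν₂ v₂ (condPost v₁ P y)) ν₁ ∧
    infoD (ν₁.prod ν₂) (prodDens v₁ v₂) P = infoD ν₁ v₁ (marg P) +
      ∫ y, mixDens v₁ (marg P) y * infoD ν₂ v₂ (condPost v₁ P y) ∂ν₁ := by
  have hF : ∀ a : A₁ × A₂, Integrable (fun y : Ω₁ × Ω₂ =>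
      P a * (v₁ a.1 y.1 * Real.log (v₁ a.1 y.1 / mixDens v₁ (marg P) y.1) * v₂ a.2 y.2))
      (ν₁.prod ν₂) := by
    intro a
    by_cases ha : P a = 0
    · simp [ha]
    have : marg P a.1 ≠ 0 :=
      (((hP.1 a).lt_of_ne' ha).trans_le (le_marg hP a.1 a.2)).ne'
    exact ((integrable_log_ratio h₁ (marg_mem hP) this).mul_prod (h₂.integrable a.2)).const_mul _
  have hF' := integrable_finsetSum Finset.univ fun a _ => hF a
  have hT := integrable_info_sum (isDensity_prodDens h₁ h₂) hP
  have hpt := info_prod_pointwise h₁ h₂ hP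
  -- Integrability of the second part comes by subtraction from the total and the first part, so the
  -- conditional information needs no bound of its own.
  have hG : Integrable (fun y : Ω₁ × Ω₂ => mixDens v₁ (marg P) y.1 * ∑ b, condPost v₁ P y.1 b *
        (v₂ b y.2 * Real.log (v₂ b y.2 / mixDens v₂ (condPost v₁ P y.1) y.2))) (ν₁.prod ν₂) := by
    refine (hT.sub hF').congr (ae_of_all _ fun y => ?_)
    simp only [Pi.sub_apply]
    rw [hpt]
    ring
  have hG1 := hG.integral_prod_left
  have hfib : ∀ y, ∫ z, mixDens v₁ (marg P) y * ∑ b, condPost v₁ P y b *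
      (v₂ b z * Real.log (v₂ b z / mixDens v₂ (condPost v₁ P y) z)) ∂ν₂ =
      mixDens v₁ (marg P) y * infoD ν₂ v₂ (condPost v₁ P y) := fun y => by
    rw [integral_const_mul]; rfl
  simp_rw [hfib] at hG1
  refine ⟨hG1, ?_⟩
  unfold infoD
  simp_rw [hpt]
  rw [integral_add hF' hG, integral_prod _ hG]
  simp_rw [hfib]
  congr 1
  rw [integral_finsetSum _ fun a _ => hF a]
  change _ = infoD ν₁ v₁ (marg P)
  rw [infoD_eq_sum h₁ (marg_mem hP), Fintype.sum_prod_type]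
  refine Finset.sum_congr rfl fun a _ => ?_
  rw [marg, Finset.sum_mul]
  refine Finset.sum_congr rfl fun b _ => ?_
  rw [integral_const_mul, integral_prod_mul
    (fun y => v₁ a y * Real.log (v₁ a y / mixDens v₁ (marg P) y)) (v₂ b), h₂.integral_eq, mul_one]

lemma ent_eq_marg_add (hP : P ∈ stdSimplex ℝ (A₁ × A₂)) :
    ent P = ent (marg P) + ∑ a, marg P a * ent (fun b => P (a, b) / marg P a) := by
  unfold ent
  rw [Fintype.sum_prod_type, ← Finset.sum_add_distrib]
  refine Finset.sum_congr rfl fun a _ => ?_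
  by_cases ha : marg P a = 0
  · have : ∀ b, P (a, b) = 0 := fun b => le_antisymm (ha ▸ le_marg hP a b) (hP.1 _)
    simp [ha, this]
  have h : ∀ b, (P (a, b)).negMulLog = P (a, b) / marg P a * (marg P a).negMulLog +
      marg P a * (P (a, b) / marg P a).negMulLog := by
    intro b
    rw [← Real.negMulLog_mul]
    congr 1
    field_simp
  simp_rw [h]
  rw [Finset.sum_add_distrib, ← Finset.sum_mul, ← Finset.sum_div, Finset.mul_sum]
  change marg P a / marg P a * _ + _ = _
  rw [div_self ha, one_mul]

lemma integrable_mixDens_mul_ent (h₁ : IsDensity ν₁ v₁) (hP : P ∈ stdSimplex ℝ (A₁ × A₂)) :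
    Integrable (fun y => mixDens v₁ (marg P) y * ent (condPost v₁ P y)) ν₁ := by
  have hm : Measurable fun y => ent (condPost v₁ P y) := by
    refine Finset.measurable_sum _ fun b _ => Real.continuous_negMulLog.measurable.comp ?_
    exact (Finset.measurable_sum _ fun a _ => (h₁.meas a).const_mul _).div
      (measurable_mixDens h₁ _)
  refine ((integrable_mixDens h₁ (marg P)).mul_const (Fintype.card A₂ : ℝ)).mono
    ((measurable_mixDens h₁ _).mul hm).aestronglyMeasurable (ae_of_all _ fun y => ?_)
  rw [norm_mul, norm_mul]
  by_cases hy : mixDens v₁ (marg P) y = 0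
  · simp [hy]
  have hc := condPost_mem h₁ hP hy
  gcongr
  rw [Real.norm_of_nonneg (ent_nonneg hc), Real.norm_of_nonneg (by positivity)]
  exact ent_le_card hc

/-- Conditioning on the past output instead of the past input does not decrease the entropy. -/
lemma ent_le_marg_add (h₁ : IsDensity ν₁ v₁) (hP : P ∈ stdSimplex ℝ (A₁ × A₂)) :
    ent P ≤ ent (marg P) + ∫ y, mixDens v₁ (marg P) y * ent (condPost v₁ P y) ∂ν₁ := by
  rw [ent_eq_marg_add hP]
  gcongr
  have hI : ∀ a, Integrable (fun y => marg P a * v₁ a y * ent (fun b => P (a, b) / marg P a)) ν₁ :=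
    fun a => ((h₁.integrable a).const_mul _).mul_const _
  have h : ∑ a, marg P a * ent (fun b => P (a, b) / marg P a) =
      ∫ y, ∑ a, marg P a * v₁ a y * ent (fun b => P (a, b) / marg P a) ∂ν₁ := by
    rw [integral_finsetSum _ fun a _ => hI a]
    simp_rw [integral_mul_const, integral_const_mul, h₁.integral_eq, mul_one]
  rw [h]
  refine integral_mono (integrable_finsetSum _ fun a _ => hI a)
    (integrable_mixDens_mul_ent h₁ hP) fun y => ?_
  have hM := marg_mem hP
  by_cases hy : mixDens v₁ (marg P) y = 0
  · have : ∀ a, marg P a * v₁ a y = 0 := fun a => by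
      rw [← mixDens_mul_post h₁ hM, hy, zero_mul]
    simp [this, hy]
  have hpost := post_mem h₁ hM hy
  simp_rw [← mixDens_mul_post h₁ hM y, mul_assoc]
  rw [← Finset.mul_sum]
  refine mul_le_mul_of_nonneg_left ?_ (mixDens_nonneg h₁ hM y)
  unfold ent
  simp_rw [Finset.mul_sum]
  rw [Finset.sum_comm]
  refine Finset.sum_le_sum fun b _ => ?_
  -- Jensen's inequality: `condPost` is the average of the conditional laws given the first input,
  -- with the posterior of that input as weights.
  have := Real.concaveOn_negMulLog.le_map_sum (t := Finset.univ) (w := post v₁ (marg P) y)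
    (p := fun a => P (a, b) / marg P a) (fun a _ => hpost.1 a) hpost.2
    (fun a _ => div_nonneg (hP.1 _) (hM.1 a))
  simp only [smul_eq_mul] at this
  refine this.trans (le_of_eq ?_)
  congr 1
  unfold condPost post
  rw [Finset.sum_div]
  refine Finset.sum_congr rfl fun a _ => ?_
  by_cases ha : marg P a = 0
  · have : P (a, b) = 0 := le_antisymm (ha ▸ le_marg hP a b) (hP.1 _)
    simp [ha, this]
  · field_simp

end Chain

/-! ### Single-letterization -/

section Tensor

variable {A Y : Type*} [Fintype A] [MeasurableSpace Y]

/-- The densities of the memoryless extension. -/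
def nDens (v : A → Y → ℝ) (n : ℕ) (x : Fin n → A) (y : Fin n → Y) : ℝ := ∏ i, v (x i) (y i)

lemma infoD_comp_equiv {A' Ω Ω' : Type*} [Fintype A'] [MeasurableSpace Ω] [MeasurableSpace Ω']
    {ν : Measure Ω} {ν' : Measure Ω'} (e : Ω' ≃ᵐ Ω) (he : MeasurePreserving e ν' ν)
    (σ : A' ≃ A) (v : A → Ω → ℝ) (P : A → ℝ) :
    infoD ν' (fun a y => v (σ a) (e y)) (fun a => P (σ a)) = infoD ν v P := by
  have hm : ∀ y, mixDens (fun a y => v (σ a) (e y)) (fun a => P (σ a)) y =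
      mixDens v P (e y) := fun y => Equiv.sum_comp σ fun a => P a * v a (e y)
  unfold infoD
  simp_rw [hm]
  rw [← he.integral_comp' (f := e)]
  congr 1
  ext y
  exact Equiv.sum_comp σ fun a => P a * (v a (e y) * Real.log (v a (e y) / mixDens v P (e y)))

lemma ent_comp_equiv {A' : Type*} [Fintype A'] (σ : A' ≃ A) (P : A → ℝ) :
    ent (fun a => P (σ a)) = ent P := Equiv.sum_comp σ fun a => (P a).negMulLog

variable (μ : Measure Y) [SigmaFinite μ] {v : A → Y → ℝ}

lemma isDensity_nDens (hv : IsDensity μ v) (n : ℕ) :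
    IsDensity (Measure.pi fun _ : Fin n => μ) (nDens v n) where
  meas x := Finset.measurable_prod _ fun i _ => (hv.meas (x i)).comp (measurable_pi_apply i)
  nonneg x y := Finset.prod_nonneg fun i _ => hv.nonneg _ _
  integrable x := Integrable.fintype_prod fun i => hv.integrable (x i)
  integral_eq x := by
    unfold nDens
    rw [integral_fintype_prod_eq_prod (fun i => v (x i))]
    simp [hv.integral_eq]

/-- Splitting a sequence into its tail and its head. -/
def tailHead (n : ℕ) (A : Type*) : (Fin (n + 1) → A) ≃ (Fin n → A) × A where
  toFun x := (Fin.tail x, x 0)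
  invFun z := Fin.cons z.2 z.1
  left_inv x := Fin.cons_self_tail x
  right_inv z := by simp

lemma exists_measurePreserving_tailHead (n : ℕ) :
    ∃ e : (Fin (n + 1) → Y) ≃ᵐ (Fin n → Y) × Y, (∀ y, e y = tailHead n Y y) ∧
      MeasurePreserving e (Measure.pi fun _ : Fin (n + 1) => μ)
        ((Measure.pi fun _ : Fin n => μ).prod μ) :=
  ⟨(MeasurableEquiv.piFinSuccAbove (fun _ => Y) 0).trans MeasurableEquiv.prodComm,
    fun _ => rfl,
    Measure.measurePreserving_swap.comp (measurePreserving_piFinSuccAbove (fun _ => μ) 0)⟩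

lemma infoD_nDens_succ (n : ℕ) (P : (Fin (n + 1) → A) → ℝ) :
    infoD (Measure.pi fun _ : Fin (n + 1) => μ) (nDens v (n + 1)) P =
      infoD ((Measure.pi fun _ : Fin n => μ).prod μ) (prodDens (nDens v n) v)
        (fun z => P ((tailHead n A).symm z)) := by
  obtain ⟨e, he, hmp⟩ := exists_measurePreserving_tailHead μ n
  rw [← infoD_comp_equiv e hmp (tailHead n A)]
  congr 1
  · ext x y
    simp only [nDens, prodDens, he, Fin.prod_univ_succ, tailHead, Equiv.coe_fn_mk, Fin.tail]
    ring
  · ext x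
    simp

/-- The closed convex set of pairs of mutual information and entropy. -/
def infoHull (μ : Measure Y) (v : A → Y → ℝ) : Set (ℝ × ℝ) :=
  convexHull ℝ {z | ∃ P ∈ stdSimplex ℝ A, z = (infoD μ v P, ent P)}

/-- Induction on the block length by the chain rule. Both increments, of information and of entropy,
are integrals against the same law of the past output, so the pair of increments is a barycentre of
single-letter pairs and stays in the closed convex hull. The information is kept as an equality
because it is later used both as an upper and as a lower bound. -/
lemma exists_infoHull_nDens [Nonempty A] (hv : IsDensity μ v) (n : ℕ) (P : (Fin n → A) → ℝ)
    (hP : P ∈ stdSimplex ℝ (Fin n → A)) :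
    ∃ p ∈ closure (infoHull μ v),
      infoD (Measure.pi fun _ : Fin n => μ) (nDens v n) P = n * p.1 ∧ ent P ≤ n * p.2 := by
  have hconv : Convex ℝ (closure (infoHull μ v)) := (convex_convexHull ℝ _).closure
  have hmem : ∀ Q ∈ stdSimplex ℝ A, (infoD μ v Q, ent Q) ∈ closure (infoHull μ v) :=
    fun Q hQ => subset_closure (subset_convexHull ℝ _ ⟨Q, hQ, rfl⟩)
  induction n with
  | zero =>
    classical
    obtain ⟨a⟩ := ‹Nonempty A›
    -- For n = 0 both quantities vanish and any point of the hull will do.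
    refine ⟨_, hmem _ (single_mem_stdSimplex ℝ a), ?_, ?_⟩
    · have : ∀ x, P x = 1 := fun x => by
        rw [← hP.2, Fintype.sum_eq_single x fun y hy => (hy (Subsingleton.elim _ _)).elim]
      simp [infoD, mixDens, nDens, this]
    · have : ∀ x, P x = 1 := fun x => by
        rw [← hP.2, Fintype.sum_eq_single x fun y hy => (hy (Subsingleton.elim _ _)).elim]
      simp [ent, this]
  | succ n ih =>
    set Q : (Fin n → A) × A → ℝ := fun z => P ((tailHead n A).symm z) with hQ
    have hQm : Q ∈ stdSimplex ℝ ((Fin n → A) × A) := by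
      refine ⟨fun z => hP.1 _, ?_⟩
      rw [← hP.2]
      exact Equiv.sum_comp (tailHead n A).symm P
    have hd := isDensity_nDens μ hv n
    obtain ⟨p, hp, hp1, hp2⟩ := ih (marg Q) (marg_mem hQm)
    obtain ⟨hI, hchain⟩ := infoD_prodDens hd hv hQm
    have hE := integrable_mixDens_mul_ent hd hQm
    set m := mixDens (nDens v n) (marg Q) with hm
    have hm0 : ∀ y, 0 ≤ m y := mixDens_nonneg hd (marg_mem hQm)
    have hmm : Measurable m := measurable_mixDens hd (marg Q)
    set ρ : Measure (Fin n → Y) :=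
      (Measure.pi fun _ : Fin n => μ).withDensity fun y => ENNReal.ofReal (m y) with hρ
    have hdens : ∀ f : (Fin n → Y) → ℝ, ∫ y, f y ∂ρ =
        ∫ y, m y * f y ∂(Measure.pi fun _ : Fin n => μ) := by
      intro f
      rw [hρ, integral_withDensity_eq_integral_toReal_smul (by fun_prop)
        (ae_of_all _ fun y => ENNReal.ofReal_lt_top)]
      simp_rw [ENNReal.toReal_ofReal (hm0 _), smul_eq_mul]
    have hdint : ∀ f : (Fin n → Y) → ℝ,
        Integrable (fun y => m y * f y) (Measure.pi fun _ : Fin n => μ) → Integrable f ρ := by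
      intro f hf
      rw [hρ, integrable_withDensity_iff_integrable_smul' (by fun_prop)
        (ae_of_all _ fun y => ENNReal.ofReal_lt_top)]
      simp_rw [ENNReal.toReal_ofReal (hm0 _), smul_eq_mul]
      exact hf
    have hprob : IsProbabilityMeasure ρ := by
      constructor
      rw [hρ, withDensity_apply _ .univ, setLIntegral_univ,
        ← ofReal_integral_eq_lintegral_ofReal (integrable_mixDens hd _) (ae_of_all _ hm0),
        integral_mixDens hd (marg_mem hQm), ENNReal.ofReal_one]
    have hae : ∀ᵐ y ∂ρ, (infoD μ v (condPost (nDens v n) Q y), ent (condPost (nDens v n) Q y)) ∈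
        closure (infoHull μ v) := by
      rw [hρ, ae_withDensity_iff (by fun_prop)]
      refine ae_of_all _ fun y hy => hmem _ (condPost_mem hd hQm ?_)
      intro h0
      rw [hm, h0] at hy
      simp at hy
    have hint := (hdint _ hI).prodMk (hdint _ hE)
    have hq := hconv.integral_mem isClosed_closure hae hint
    rw [integral_pair (hdint _ hI) (hdint _ hE), hdens, hdens] at hq
    set q : ℝ × ℝ := (∫ y, m y * infoD μ v (condPost (nDens v n) Q y)
        ∂(Measure.pi fun _ : Fin n => μ),
      ∫ y, m y * ent (condPost (nDens v n) Q y) ∂(Measure.pi fun _ : Fin n => μ)) with hqd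
    have hn : (0 : ℝ) < (n : ℝ) + 1 := by positivity
    -- The n past letters contribute their normalized point p and the new letter the barycentre q,
    -- in proportion n : 1.
    refine ⟨((n : ℝ) / (n + 1)) • p + ((1 : ℝ) / (n + 1)) • q,
      hconv hp hq (by positivity) (by positivity) (by field_simp), ?_, ?_⟩
    · rw [infoD_nDens_succ, hchain, hp1]
      simp only [Prod.fst_add, Prod.smul_fst, smul_eq_mul, hqd]
      push_cast
      field_simp
    · have h1 := ent_le_marg_add hd hQm
      have h2 : ent Q = ent P := ent_comp_equiv (tailHead n A).symm P
      rw [← h2]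
      refine (h1.trans (add_le_add_left hp2 _)).trans (le_of_eq ?_)
      simp only [Prod.snd_add, Prod.smul_snd, smul_eq_mul, hqd]
      push_cast
      field_simp
      rfl

end Tensor

/-! ### Channels with densities -/

section Bridge

variable {A Ω : Type*} [MeasurableSpace Ω] {ν : Measure Ω} {v : A → Ω → ℝ} {V : A → Measure Ω}

/-- The channel `V` has the densities `v` with respect to `ν`. -/
structure HasDens (ν : Measure Ω) (V : A → Measure Ω) (v : A → Ω → ℝ) : Prop
    extends IsDensity ν v where
  eq_withDensity : ∀ a, V a = ν.withDensity fun y => ENNReal.ofReal (v a y)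

/-- The densities of the channel `V`. -/
noncomputable def dens (ν : Measure Ω) (V : A → Measure Ω) (a : A) (y : Ω) : ℝ :=
  ((V a).rnDeriv ν y).toReal

lemma hasDens_dens [SigmaFinite ν] [∀ a, IsProbabilityMeasure (V a)] (h : ∀ a, V a ≪ ν) :
    HasDens ν V (dens ν V) where
  meas a := (Measure.measurable_rnDeriv _ _).ennreal_toReal
  nonneg a y := ENNReal.toReal_nonneg
  integrable a := Measure.integrable_toReal_rnDeriv
  integral_eq a := by
    unfold dens
    rw [Measure.integral_toReal_rnDeriv (h a), probReal_univ]
  eq_withDensity a := by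
    rw [withDensity_congr_ae (g := (V a).rnDeriv ν), Measure.withDensity_rnDeriv_eq _ _ (h a)]
    filter_upwards [Measure.rnDeriv_lt_top (V a) ν] with y hy
    exact ENNReal.ofReal_toReal hy.ne

namespace HasDens

lemma integral_eq_mul (h : HasDens ν V v) (a : A) (f : Ω → ℝ) :
    ∫ y, f y ∂(V a) = ∫ y, v a y * f y ∂ν := by
  rw [h.eq_withDensity, integral_withDensity_eq_integral_toReal_smul
    (h.meas a).ennreal_ofReal (ae_of_all _ fun y => ENNReal.ofReal_lt_top)]
  simp_rw [ENNReal.toReal_ofReal (h.nonneg a _), smul_eq_mul]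

lemma integrable_iff (h : HasDens ν V v) (a : A) (f : Ω → ℝ) :
    Integrable f (V a) ↔ Integrable (fun y => v a y * f y) ν := by
  rw [h.eq_withDensity, integrable_withDensity_iff_integrable_smul'
    (h.meas a).ennreal_ofReal (ae_of_all _ fun y => ENNReal.ofReal_lt_top)]
  simp_rw [ENNReal.toReal_ofReal (h.nonneg a _), smul_eq_mul]

lemma ae_pos (h : HasDens ν V v) (a : A) : ∀ᵐ y ∂(V a), 0 < v a y := by
  rw [h.eq_withDensity, ae_withDensity_iff (h.meas a).ennreal_ofReal]
  refine ae_of_all _ fun y hy => ?_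
  contrapose! hy
  simp [hy]

lemma isProb (h : HasDens ν V v) (a : A) : IsProbabilityMeasure (V a) := by
  constructor
  rw [h.eq_withDensity, withDensity_apply _ .univ, setLIntegral_univ,
    ← ofReal_integral_eq_lintegral_ofReal (h.integrable a) (ae_of_all _ (h.nonneg a)),
    h.integral_eq, ENNReal.ofReal_one]

variable [Fintype A] {P : A → ℝ}

lemma mixture_eq (h : HasDens ν V v) (hP : P ∈ stdSimplex ℝ A) :
    mixture P V = ν.withDensity fun y => ENNReal.ofReal (mixDens v P y) := by
  ext s hs
  rw [withDensity_apply _ hs, mixture]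
  simp only [mixDens]
  simp_rw [ENNReal.ofReal_sum_of_nonneg fun a _ => mul_nonneg (hP.1 a) (h.nonneg a _),
    ENNReal.ofReal_mul (hP.1 _)]
  rw [lintegral_finsetSum _ fun a _ => (h.meas a).ennreal_ofReal.const_mul _]
  simp_rw [lintegral_const_mul _ (h.meas _).ennreal_ofReal]
  rw [Measure.coe_finsetSum, Finset.sum_apply]
  refine Finset.sum_congr rfl fun a _ => ?_
  rw [Measure.smul_apply, h.eq_withDensity, withDensity_apply _ hs, smul_eq_mul]

lemma isProb_mixture (h : HasDens ν V v) (hP : P ∈ stdSimplex ℝ A) :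
    IsProbabilityMeasure (mixture P V) := by
  constructor
  have := h.isProb
  rw [mixture, Measure.coe_finsetSum, Finset.sum_apply]
  simp only [Measure.smul_apply, measure_univ, smul_eq_mul, mul_one]
  rw [← ENNReal.ofReal_sum_of_nonneg fun a _ => hP.1 a, hP.2, ENNReal.ofReal_one]

lemma mixture_ac (h : HasDens ν V v) (hP : P ∈ stdSimplex ℝ A) : mixture P V ≪ ν := by
  rw [h.mixture_eq hP]; exact withDensity_absolutelyContinuous _ _

lemma integral_mixture (h : HasDens ν V v) (hP : P ∈ stdSimplex ℝ A) (f : Ω → ℝ) :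
    ∫ y, f y ∂(mixture P V) = ∫ y, mixDens v P y * f y ∂ν := by
  rw [h.mixture_eq hP, integral_withDensity_eq_integral_toReal_smul
    (measurable_mixDens h.toIsDensity P).ennreal_ofReal (ae_of_all _ fun y => ENNReal.ofReal_lt_top)]
  simp_rw [ENNReal.toReal_ofReal (mixDens_nonneg h.toIsDensity hP _), smul_eq_mul]

lemma integrable_log (h : HasDens ν V v) (hP : P ∈ stdSimplex ℝ A) {a : A} (ha : P a ≠ 0) :
    Integrable (fun y => Real.log (v a y / mixDens v P y)) (V a) :=
  (h.integrable_iff a _).2 (integrable_log_ratio h.toIsDensity hP ha)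

lemma klDiv_mixture (h : HasDens ν V v) (hP : P ∈ stdSimplex ℝ A) {a : A} (ha : P a ≠ 0) :
    0 ≤ ∫ y, Real.log (v a y / mixDens v P y) ∂(V a) ∧
    InformationTheory.klDiv (V a) (mixture P V) =
      ENNReal.ofReal (∫ y, Real.log (v a y / mixDens v P y) ∂(V a)) := by
  have := h.isProb a
  have := h.isProb_mixture hP
  refine klDiv_withDensity ν (h.meas a) (measurable_mixDens h.toIsDensity P) (h.nonneg a)
    (mixDens_nonneg h.toIsDensity hP) (fun y hy => ?_) (h.eq_withDensity a) (h.mixture_eq hP)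
    (h.integrable_log hP ha)
  have h1 := mul_le_mixDens h.toIsDensity hP y a
  have h2 := h.nonneg a y
  have h3 := (hP.1 a).lt_of_ne' ha
  rw [hy] at h1
  nlinarith

/-- The mutual information in bits. -/
lemma mutualInfo_eq (h : HasDens ν V v) (hP : P ∈ stdSimplex ℝ A) :
    mutualInfo V P = ENNReal.ofReal (infoD ν v P / Real.log 2) := by
  have hlog : 0 < Real.log 2 := Real.log_pos one_lt_two
  rw [mutualInfo, infoD_eq_sum h.toIsDensity hP, Finset.sum_div, ENNReal.ofReal_sum_of_nonneg]
  · refine Finset.sum_congr rfl fun a _ => ?_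
    by_cases ha : P a = 0
    · simp [ha]
    rw [klDiv2, (h.klDiv_mixture hP ha).2, ← ENNReal.ofReal_div_of_pos hlog,
      ← ENNReal.ofReal_mul (hP.1 a), h.integral_eq_mul, mul_div_assoc]
  · intro a _
    by_cases ha : P a = 0
    · simp [ha]
    rw [← h.integral_eq_mul]
    exact div_nonneg (mul_nonneg (hP.1 a) (h.klDiv_mixture hP ha).1) hlog.le

end HasDens

lemma entropy_eq [Fintype A] (P : A → ℝ) : entropy P = ent P / Real.log 2 := by
  unfold entropy ent Real.logb Real.negMulLog
  rw [Finset.sum_div, ← Finset.sum_neg_distrib]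
  exact Finset.sum_congr rfl fun a _ => by ring

/-- The conditional entropy of the input given the output in bits. -/
lemma condEntropyY_eq [Fintype A] (h : IsDensity ν (dens ν V)) {P : A → ℝ}
    (hP : P ∈ stdSimplex ℝ A) :
    condEntropyY ν V P = (ent P - infoD ν (dens ν V) P) / Real.log 2 := by
  rw [← integral_ent_post h hP, ← integral_div, condEntropyY]
  congr 1
  ext y
  rw [entropy_eq]
  change ent (post (dens ν V) P y) / _ * mixDens (dens ν V) P y = _
  ring

/-! The quantities conditioned on an auxiliary variable. -/

section Aux

variable [Fintype A] {U : Type*} [Fintype U] {P : U × A → ℝ}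

lemma margU_mem (hP : P ∈ stdSimplex ℝ (U × A)) : margU P ∈ stdSimplex ℝ U := by
  refine ⟨fun a => Finset.sum_nonneg fun b _ => hP.1 _, ?_⟩
  rw [← hP.2, Fintype.sum_prod_type]
  rfl

lemma condU_mem (hP : P ∈ stdSimplex ℝ (U × A)) {u : U} (hu : margU P u ≠ 0) :
    condU P u ∈ stdSimplex ℝ A := by
  refine ⟨fun a => div_nonneg (hP.1 _) ((margU_mem hP).1 u), ?_⟩
  unfold condU
  rw [← Finset.sum_div]
  exact div_self hu

lemma mutualInfoU_eq (h : HasDens ν V v) (hP : P ∈ stdSimplex ℝ (U × A)) :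
    mutualInfoU V P =
      ENNReal.ofReal ((∑ u, margU P u * infoD ν v (condU P u)) / Real.log 2) := by
  have hlog : 0 < Real.log 2 := Real.log_pos one_lt_two
  have h0 : ∀ u, 0 ≤ margU P u * infoD ν v (condU P u) := fun u => by
    by_cases hu : margU P u = 0
    · simp [hu]
    · exact mul_nonneg ((margU_mem hP).1 u) (infoD_nonneg h.toIsDensity (condU_mem hP hu))
  rw [mutualInfoU, Finset.sum_div, ENNReal.ofReal_sum_of_nonneg fun u _ =>
    div_nonneg (h0 u) hlog.le]
  refine Finset.sum_congr rfl fun u _ => ?_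
  by_cases hu : margU P u = 0
  · simp [hu]
  rw [h.mutualInfo_eq (condU_mem hP hu), ← ENNReal.ofReal_mul ((margU_mem hP).1 u), mul_div_assoc]

lemma mul_condU (hP : ∀ z, 0 ≤ P z) (u : U) (a : A) : margU P u * condU P u a = P (u, a) := by
  unfold condU
  by_cases hu : margU P u = 0
  · have : P (u, a) ≤ margU P u :=
      Finset.single_le_sum (f := fun a => P (u, a)) (fun b _ => hP _) (Finset.mem_univ a)
    rw [hu, zero_mul]
    linarith [hP (u, a)]
  · field_simp

lemma condEntropyU_eq (hP : P ∈ stdSimplex ℝ (U × A)) :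
    condEntropyU P = (∑ u, margU P u * ent (condU P u)) / Real.log 2 := by
  unfold condEntropyU ent
  rw [Finset.sum_div, ← Finset.sum_neg_distrib]
  refine Finset.sum_congr rfl fun u _ => ?_
  rw [Finset.mul_sum, Finset.sum_div, ← Finset.sum_neg_distrib]
  refine Finset.sum_congr rfl fun a _ => ?_
  rw [← mul_condU hP.1 u a, Real.negMulLog]
  by_cases hu : margU P u = 0
  · simp [hu]
  rw [mul_div_cancel_left₀ _ hu, Real.logb]
  ring

lemma condEntropyYU_eq (h : IsDensity ν (dens ν V)) (hP : P ∈ stdSimplex ℝ (U × A)) :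
    condEntropyYU ν V P = (∑ u, margU P u * ent (condU P u) -
      ∑ u, margU P u * infoD ν (dens ν V) (condU P u)) / Real.log 2 := by
  unfold condEntropyYU
  rw [← Finset.sum_sub_distrib, Finset.sum_div]
  refine Finset.sum_congr rfl fun u _ => ?_
  by_cases hu : margU P u = 0
  · simp [hu]
  rw [condEntropyY_eq h (condU_mem hP hu)]
  ring

end Aux

end Bridge

/-! ### Memoryless extensions -/

section Memoryless

variable {A Y : Type*} [MeasurableSpace Y] {μ : Measure Y} [SigmaFinite μ] {v : A → Y → ℝ}
  {V : A → Measure Y}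

lemma hasDens_pi [Fintype A] (h : HasDens μ V v) (n : ℕ) :
    HasDens (Measure.pi fun _ : Fin n => μ) (fun x : Fin n → A => Measure.pi fun i => V (x i))
      (nDens v n) where
  toIsDensity := isDensity_nDens μ h.toIsDensity n
  eq_withDensity x := by
    have := fun i => h.isProb (x i)
    have h2 : ∀ i, SigmaFinite (μ.withDensity fun y => ENNReal.ofReal (v (x i) y)) := fun i => by
      rw [← h.eq_withDensity]; infer_instance
    simp_rw [h.eq_withDensity]
    rw [pi_withDensity (fun _ => μ) (fun i y => ENNReal.ofReal (v (x i) y))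
      fun i => (h.meas (x i)).ennreal_ofReal]
    congr 1
    ext y
    rw [nDens, ENNReal.ofReal_prod_of_nonneg fun i _ => h.nonneg _ _]

end Memoryless

/-! ### One-shot converse bounds -/

section OneShot

variable {ι A Ω : Type*} [Fintype ι] [Nonempty ι] [Fintype A] [MeasurableSpace Ω]
  {ν : Measure Ω} {v : A → Ω → ℝ} {V : A → Measure Ω} {enc : ι → A → ℝ}

/-- The distribution of the input when the message is uniformly distributed. -/
noncomputable def inputDist (enc : ι → A → ℝ) (x : A) : ℝ :=
  ∑ m, (Fintype.card ι : ℝ)⁻¹ * enc m x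

lemma card_pos' : (0 : ℝ) < Fintype.card ι := by exact_mod_cast Fintype.card_pos

lemma inputDist_mem (henc : ∀ m, enc m ∈ stdSimplex ℝ A) : inputDist enc ∈ stdSimplex ℝ A := by
  have := card_pos' (ι := ι)
  refine ⟨fun x => Finset.sum_nonneg fun m _ => mul_nonneg (by positivity) ((henc m).1 x), ?_⟩
  unfold inputDist
  rw [Finset.sum_comm]
  simp_rw [← Finset.mul_sum, (henc _).2]
  simp

lemma le_inputDist (henc : ∀ m, enc m ∈ stdSimplex ℝ A) (m : ι) (x : A) :
    (Fintype.card ι : ℝ)⁻¹ * enc m x ≤ inputDist enc x := by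
  have := card_pos' (ι := ι)
  exact Finset.single_le_sum (f := fun m => (Fintype.card ι : ℝ)⁻¹ * enc m x)
    (fun m _ => mul_nonneg (by positivity) ((henc m).1 x)) (Finset.mem_univ m)

lemma inputDist_ne_zero (henc : ∀ m, enc m ∈ stdSimplex ℝ A) {m : ι} {x : A}
    (h : enc m x ≠ 0) : inputDist enc x ≠ 0 := by
  have h1 := card_pos' (ι := ι)
  have h2 := ((henc m).1 x).lt_of_ne' h
  exact ((by positivity : 0 < (Fintype.card ι : ℝ)⁻¹ * enc m x).trans_le
    (le_inputDist henc m x)).ne'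

lemma sum_inputDist_mul (f : A → ℝ) :
    ∑ x, inputDist enc x * f x = ∑ m, (Fintype.card ι : ℝ)⁻¹ * ∑ x, enc m x * f x := by
  unfold inputDist
  simp_rw [Finset.sum_mul, Finset.mul_sum]
  rw [Finset.sum_comm]
  simp_rw [mul_assoc]

lemma infoD_eq_sum_integral (h : HasDens ν V v) {P : A → ℝ} (hP : P ∈ stdSimplex ℝ A) :
    infoD ν v P = ∑ x, P x * ∫ y, Real.log (v x y / mixDens v P y) ∂(V x) := by
  rw [infoD_eq_sum h.toIsDensity hP]
  simp_rw [h.integral_eq_mul]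

lemma avg_const (c : ℝ) : ∑ _m : ι, (Fintype.card ι : ℝ)⁻¹ * c = c := by
  have := card_pos' (ι := ι)
  simp

/-- Fano's inequality for list decoding. -/
lemma fano_list (h : HasDens ν V v) (henc : ∀ m, enc m ∈ stdSimplex ℝ A)
    (D : ι → Set Ω) (hD : ∀ m, MeasurableSet (D m)) {L : ℝ} (hL : 0 < L)
    (hLM : L ≤ Fintype.card ι)
    (hcard : ∀ y, ∑ m, (D m).indicator (fun _ => (1 : ℝ)) y ≤ L) {ε : ℝ}
    (hε : ∀ m, 1 - ε ≤ ∑ x, enc m x * (V x).real (D m)) :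
    (1 - ε) * Real.log (Fintype.card ι / L) - Real.log 2 ≤ infoD ν v (inputDist enc) := by
  have hM := card_pos' (ι := ι)
  have hP := inputDist_mem henc
  have := h.isProb
  have := h.isProb_mixture hP
  set P := inputDist enc with hPdef
  set M := (Fintype.card ι : ℝ) with hMdef
  set Q := mixture P V with hQ
  set t := Real.log (M / L) with ht
  have ht0 : 0 ≤ t := Real.log_nonneg ((one_le_div hL).2 hLM)
  have hexp : Real.exp t = M / L := Real.exp_log (by positivity)
  have key : ∀ m x, enc m x ≠ 0 →
      t * (V x).real (D m) - Real.log 2 + (1 / 2 - (M / L - 1) / 2 * Q.real (D m)) ≤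
        ∫ y, Real.log (v x y / mixDens v P y) ∂(V x) := by
    intro m x hmx
    have hkl := h.klDiv_mixture hP (inputDist_ne_zero henc hmx)
    -- The test function equals M/(2L) on the decoding set and 1/2 off it. Its logarithm produces t
    -- = log(M/L) at the cost log 2. Since at most L sets contain a given output, its Q-integral
    -- averaged over the messages is at most 1, so the linear terms of the variational bound do no
    -- harm.
    set g : Ω → ℝ := fun y => 1 / 2 + (D m).indicator (fun _ => (M / L - 1) / 2) y with hg
    have hlogg : ∀ y, Real.log (g y) = (D m).indicator (fun _ => t) y - Real.log 2 := by
      intro y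
      by_cases hy : y ∈ D m
      · simp only [hg, Set.indicator_of_mem hy]
        rw [ht, ← Real.log_div (by positivity) two_ne_zero]
        congr 1; ring
      · simp only [hg, Set.indicator_of_notMem hy]
        rw [zero_sub, ← Real.log_inv]; congr 1; norm_num
    have hc : 0 ≤ (M / L - 1) / 2 := by
      have := (one_le_div hL).2 hLM
      linarith
    have hgpos : ∀ y, 0 < g y := fun y => by
      have : 0 ≤ (D m).indicator (fun _ => (M / L - 1) / 2) y :=
        Set.indicator_nonneg (fun _ _ => hc) y
      simp only [hg]; linarith
    have hi1 : ∀ (R : Measure Ω) [IsProbabilityMeasure R] (c : ℝ),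
        Integrable ((D m).indicator fun _ => c) R := fun R _ c =>
      (integrable_const c).indicator (hD m)
    have hle := le_klDiv (P := V x) (Q := Q) (g := g) (fun y => (hgpos y).le)
      (ae_of_all _ hgpos) (by simp_rw [hlogg]; exact (hi1 _ t).sub (integrable_const _))
      ((integrable_const _).add (hi1 _ _))
    rw [hkl.2, ENNReal.ofReal_le_ofReal_iff hkl.1] at hle
    refine le_trans (le_of_eq ?_) hle
    simp_rw [hlogg, hg]
    rw [integral_sub (hi1 _ t) (integrable_const _), integral_add (integrable_const _) (hi1 _ _),
      integral_indicator_const _ (hD m), integral_indicator_const _ (hD m)]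
    simp
    ring
  have hQsum : ∑ m, Q.real (D m) ≤ L := by
    have h1 : ∀ m, Q.real (D m) = ∫ y, (D m).indicator (fun _ => (1 : ℝ)) y ∂Q := fun m => by
      rw [integral_indicator_const _ (hD m)]; simp
    have hi : ∀ m, Integrable ((D m).indicator fun _ => (1 : ℝ)) Q := fun m =>
      (integrable_const 1).indicator (hD m)
    simp_rw [h1]
    rw [← integral_finsetSum _ fun m _ => hi m]
    calc _ ≤ ∫ _y, L ∂Q := integral_mono (integrable_finsetSum _ fun m _ => hi m)
          (integrable_const _) hcard
      _ = L := by simp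
  rw [infoD_eq_sum_integral h hP, sum_inputDist_mul]
  have hm : ∀ m, t * (1 - ε) - Real.log 2 + (1 / 2 - (M / L - 1) / 2 * Q.real (D m)) ≤
      ∑ x, enc m x * ∫ y, Real.log (v x y / mixDens v P y) ∂(V x) := by
    intro m
    calc _ ≤ t * (∑ x, enc m x * (V x).real (D m)) - Real.log 2 +
          (1 / 2 - (M / L - 1) / 2 * Q.real (D m)) := by gcongr; exact hε m
      _ = ∑ x, enc m x * (t * (V x).real (D m) - Real.log 2 +
          (1 / 2 - (M / L - 1) / 2 * Q.real (D m))) := by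
        have e : ∀ x, enc m x * (t * (V x).real (D m) - Real.log 2 +
            (1 / 2 - (M / L - 1) / 2 * Q.real (D m))) = t * (enc m x * (V x).real (D m)) +
            enc m x * (-Real.log 2 + (1 / 2 - (M / L - 1) / 2 * Q.real (D m))) :=
          fun x => by ring
        simp_rw [e]
        rw [Finset.sum_add_distrib, ← Finset.mul_sum, ← Finset.sum_mul, (henc m).2]
        ring
      _ ≤ _ := by
        refine Finset.sum_le_sum fun x _ => ?_
        by_cases hmx : enc m x = 0
        · simp [hmx]
        · exact mul_le_mul_of_nonneg_left (key m x hmx) ((henc m).1 x)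
  calc _ ≤ ∑ m, M⁻¹ * (t * (1 - ε) - Real.log 2 + (1 / 2 - (M / L - 1) / 2 * Q.real (D m))) := by
        have e1 : ∀ m, M⁻¹ * (t * (1 - ε) - Real.log 2 + (1 / 2 - (M / L - 1) / 2 * Q.real (D m))) =
            M⁻¹ * (t * (1 - ε) - Real.log 2 + 1 / 2) - M⁻¹ * ((M / L - 1) / 2 * Q.real (D m)) :=
          fun m => by ring
        simp_rw [e1]
        rw [Finset.sum_sub_distrib, avg_const, ← Finset.mul_sum, ← Finset.mul_sum]
        have e4 : M⁻¹ * ((M / L - 1) / 2 * ∑ m, Q.real (D m)) ≤ 1 / 2 := by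
          have hc : 0 ≤ (M / L - 1) / 2 := by
            have := (one_le_div hL).2 hLM
            linarith
          calc _ ≤ M⁻¹ * ((M / L - 1) / 2 * L) := by gcongr
            _ = 1 / 2 - L / M / 2 := by field_simp
            _ ≤ 1 / 2 := by
              have : 0 ≤ L / M := by positivity
              linarith
        linarith
    _ ≤ _ := Finset.sum_le_sum fun m _ => mul_le_mul_of_nonneg_left (hm m) (by positivity)

lemma integral_mixture_eq_sum (h : HasDens ν V v) {P : A → ℝ} (hP : P ∈ stdSimplex ℝ A)
    {f : Ω → ℝ} (hf : ∀ x, P x ≠ 0 → Integrable f (V x)) :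
    Integrable f (mixture P V) ∧ ∫ y, f y ∂(mixture P V) = ∑ x, P x * ∫ y, f y ∂(V x) := by
  have hI : ∀ x, Integrable (fun y => P x * (v x y * f y)) ν := fun x => by
    by_cases hx : P x = 0
    · simp [hx]
    · exact ((h.integrable_iff x f).1 (hf x hx)).const_mul _
  have he : ∀ y, mixDens v P y * f y = ∑ x, P x * (v x y * f y) := fun y => by
    simp_rw [mixDens, Finset.sum_mul, mul_assoc]
  constructor
  · rw [h.mixture_eq hP, integrable_withDensity_iff_integrable_smul'
      (measurable_mixDens h.toIsDensity P).ennreal_ofReal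
      (ae_of_all _ fun y => ENNReal.ofReal_lt_top)]
    simp_rw [ENNReal.toReal_ofReal (mixDens_nonneg h.toIsDensity hP _), smul_eq_mul, he]
    exact integrable_finsetSum _ fun x _ => hI x
  · rw [h.integral_mixture hP]
    simp_rw [he]
    rw [integral_finsetSum _ fun x _ => hI x]
    simp_rw [integral_const_mul, h.integral_eq_mul]

lemma mixDens_inputDist (y : Ω) :
    mixDens v (inputDist enc) y = ∑ m, (Fintype.card ι : ℝ)⁻¹ * mixDens v (enc m) y :=
  sum_inputDist_mul fun x => v x y

/-- The information gained about the message is at least that gained about the input, up to the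
randomness of the encoder. -/
lemma infoD_sub_le_avg_klDiv (h : HasDens ν V v) (henc : ∀ m, enc m ∈ stdSimplex ℝ A)
    (Q : Measure Ω) [IsProbabilityMeasure Q]
    (hfin : ∀ m, InformationTheory.klDiv (mixture (enc m) V) Q ≠ ∞) :
    infoD ν v (inputDist enc) - ∑ m, (Fintype.card ι : ℝ)⁻¹ * ent (enc m) ≤
      ∑ m, (Fintype.card ι : ℝ)⁻¹ * (InformationTheory.klDiv (mixture (enc m) V) Q).toReal := by
  have hM := card_pos' (ι := ι)
  have hP := inputDist_mem henc
  have hd := h.toIsDensity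
  have := h.isProb
  have := fun m => h.isProb_mixture (henc m)
  have hmd := fun y => mixDens_inputDist (v := v) (enc := enc) y
  have hne : ∀ m x, enc m x ≠ 0 → inputDist enc x ≠ 0 := fun m x => inputDist_ne_zero henc
  set P := inputDist enc with hPdef
  set M := (Fintype.card ι : ℝ) with hMdef
  have hmle : ∀ m y, mixDens v (enc m) y ≤ M * mixDens v P y := fun m y => by
    have : M⁻¹ * mixDens v (enc m) y ≤ mixDens v P y := by
      rw [hmd]
      exact Finset.single_le_sum (f := fun m => M⁻¹ * mixDens v (enc m) y)
        (fun m _ => mul_nonneg (by positivity) (mixDens_nonneg hd (henc m) y)) (Finset.mem_univ m)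
    calc _ = M * (M⁻¹ * mixDens v (enc m) y) := by field_simp
      _ ≤ _ := by gcongr
  -- The likelihood ratio of message m against the average output. Averaged over m it is at most 1
  -- at every point, so one family of test functions serves for every Q and no optimal Q has to be
  -- identified.
  set g : ι → Ω → ℝ := fun m y => mixDens v (enc m) y / mixDens v P y with hg
  have hg0 : ∀ m y, 0 ≤ g m y := fun m y =>
    div_nonneg (mixDens_nonneg hd (henc m) y) (mixDens_nonneg hd hP y)
  have hgM : ∀ m y, g m y ≤ M := fun m y =>
    div_le_of_le_mul₀ (mixDens_nonneg hd hP y) hM.le (hmle m y)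
  have hgmeas : ∀ m, Measurable (g m) := fun m =>
    (measurable_mixDens hd _).div (measurable_mixDens hd _)
  have hgQ : ∀ m, Integrable (g m) Q := fun m =>
    (integrable_const M).mono (hgmeas m).aestronglyMeasurable (ae_of_all _ fun y => by
      rw [Real.norm_of_nonneg (hg0 m y), Real.norm_of_nonneg hM.le]
      exact hgM m y)
  have hglow : ∀ m x, enc m x ≠ 0 → ∀ᵐ y ∂(V x), 0 < g m y ∧
      Real.log (enc m x) + Real.log (v x y / mixDens v P y) ≤ Real.log (g m y) := by
    intro m x hmx
    have hx := ((henc m).1 x).lt_of_ne' hmx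
    filter_upwards [h.ae_pos x] with y hy
    have h1 : enc m x * v x y ≤ mixDens v (enc m) y := mul_le_mixDens hd (henc m) y x
    have h2 : 0 < mixDens v (enc m) y := (mul_pos hx hy).trans_le h1
    have h3 : 0 < mixDens v P y := by
      have := h2.trans_le (hmle m y)
      exact (pos_iff_pos_of_mul_pos this).1 hM
    refine ⟨div_pos h2 h3, ?_⟩
    rw [← Real.log_mul hx.ne' (div_pos hy h3).ne']
    refine Real.log_le_log (mul_pos hx (div_pos hy h3)) ?_
    simp only [hg]
    rw [← mul_div_assoc]
    gcongr
  have hlogI : ∀ m x, enc m x ≠ 0 → Integrable (fun y => Real.log (g m y)) (V x) := by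
    intro m x hmx
    refine ((((integrable_const (Real.log (enc m x))).add
      (h.integrable_log hP (hne m x hmx))).abs).add (integrable_const |Real.log M|)).mono
      (Real.measurable_log.comp (hgmeas m)).aestronglyMeasurable ?_
    filter_upwards [hglow m x hmx] with y hy
    have h4 : Real.log (g m y) ≤ Real.log M := Real.log_le_log hy.1 (hgM m y)
    rw [Real.norm_eq_abs, Real.norm_eq_abs]
    refine le_trans ?_ (le_abs_self _)
    simp only [Pi.add_apply]
    rw [abs_le]
    constructor
    · have := neg_abs_le (Real.log (enc m x) + Real.log (v x y / mixDens v P y))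
      linarith [hy.2, abs_nonneg (Real.log M)]
    · linarith [le_abs_self (Real.log M),
        abs_nonneg (Real.log (enc m x) + Real.log (v x y / mixDens v P y))]
  have hkey : ∀ m, ∑ x, enc m x * ∫ y, Real.log (v x y / mixDens v P y) ∂(V x) - ent (enc m) -
      ∫ y, g m y ∂Q + 1 ≤ (InformationTheory.klDiv (mixture (enc m) V) Q).toReal := by
    intro m
    obtain ⟨hI, hint⟩ := integral_mixture_eq_sum h (henc m) (hlogI m)
    have hpos : ∀ᵐ y ∂(mixture (enc m) V), 0 < g m y := by
      rw [h.mixture_eq (henc m), ae_withDensity_iff (measurable_mixDens hd _).ennreal_ofReal]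
      refine ae_of_all _ fun y hy => ?_
      have h2 : 0 < mixDens v (enc m) y := by
        contrapose! hy
        exact ENNReal.ofReal_eq_zero.2 hy
      exact div_pos h2 ((pos_iff_pos_of_mul_pos (h2.trans_le (hmle m y))).1 hM)
    have hle := le_klDiv (hg0 m) hpos hI (hgQ m)
    have hle' := (ENNReal.ofReal_le_iff_le_toReal (hfin m)).1 hle
    refine le_trans ?_ hle'
    rw [hint]
    gcongr
    unfold ent
    rw [← Finset.sum_sub_distrib]
    refine Finset.sum_le_sum fun x _ => ?_
    by_cases hmx : enc m x = 0
    · simp [hmx]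
    have : Real.log (enc m x) + ∫ y, Real.log (v x y / mixDens v P y) ∂(V x) ≤
        ∫ y, Real.log (g m y) ∂(V x) := by
      have hi := h.integrable_log hP (hne m x hmx)
      calc _ = ∫ y, (Real.log (enc m x) + Real.log (v x y / mixDens v P y)) ∂(V x) := by
            rw [integral_add (integrable_const _) hi]; simp
        _ ≤ _ := integral_mono_ae ((integrable_const _).add hi) (hlogI m x hmx)
          ((hglow m x hmx).mono fun y hy => hy.2)
    rw [Real.negMulLog]
    nlinarith [mul_le_mul_of_nonneg_left this ((henc m).1 x)]
  have hgsum : ∑ m, M⁻¹ * ∫ y, g m y ∂Q ≤ 1 := by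
    simp_rw [← integral_const_mul]
    rw [← integral_finsetSum _ fun m _ => (hgQ m).const_mul _]
    calc _ ≤ ∫ _y, (1 : ℝ) ∂Q := by
          refine integral_mono (integrable_finsetSum _ fun m _ => (hgQ m).const_mul _)
            (integrable_const _) fun y => ?_
          simp only [hg]
          simp_rw [← mul_div_assoc]
          rw [← Finset.sum_div, ← hmd]
          exact div_self_le_one _
      _ = 1 := by simp
  rw [infoD_eq_sum_integral h hP, sum_inputDist_mul]
  calc _ ≤ ∑ m, M⁻¹ * (∑ x, enc m x * ∫ y, Real.log (v x y / mixDens v P y) ∂(V x) - ent (enc m) -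
      ∫ y, g m y ∂Q + 1) := by
        simp_rw [mul_add, mul_sub]
        rw [Finset.sum_add_distrib, Finset.sum_sub_distrib, Finset.sum_sub_distrib, avg_const]
        linarith
    _ ≤ _ := Finset.sum_le_sum fun m _ => mul_le_mul_of_nonneg_left (hkey m) (by positivity)

/-- Fano's inequality for the message given the input. -/
lemma log_card_add_ent_le [DecidableEq ι] (henc : ∀ m, enc m ∈ stdSimplex ℝ A) (mhat : A → ι) :
    Real.log (Fintype.card ι) + ∑ m, (Fintype.card ι : ℝ)⁻¹ * ent (enc m) ≤
      ent (inputDist enc) + Real.log 2 +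
        (∑ m, (Fintype.card ι : ℝ)⁻¹ * ∑ x, enc m x * (if m = mhat x then 0 else 1)) *
          Real.log (Fintype.card ι) := by
  have hM := card_pos' (ι := ι)
  have hP := inputDist_mem henc
  have hle := fun m x => le_inputDist henc m x
  have hsum : ∀ f : A → ℝ, ∑ x, inputDist enc x * f x =
    ∑ m, (Fintype.card ι : ℝ)⁻¹ * ∑ x, enc m x * f x := sum_inputDist_mul
  set P := inputDist enc with hPdef
  set M := (Fintype.card ι : ℝ) with hMdef
  -- A guess, of total mass at most 1, for the law of the message given the input: half the mass on
  -- `mhat x`, the other half spread evenly. Comparing it with the true joint law by log z ≤ z − 1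
  -- gives the bound, with cost log 2 at the guess and log(2M) elsewhere.
  set G : ι → A → ℝ := fun m x => if m = mhat x then 1 / 2 else 1 / (2 * M) with hG
  have hlogG : ∀ m x, Real.log (G m x) =
      -Real.log 2 - (if m = mhat x then 0 else 1) * Real.log M := by
    intro m x
    simp only [hG]
    split_ifs
    · rw [one_div, Real.log_inv]; ring
    · rw [one_div, Real.log_inv, Real.log_mul two_ne_zero hM.ne']; ring
  have hGpos : ∀ m x, 0 < G m x := fun m x => by
    simp only [hG]; split_ifs <;> positivity
  have hterm : ∀ m x, M⁻¹ * (enc m x).negMulLog + (M⁻¹ * enc m x) * Real.log M ≤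
      G m x * P x - M⁻¹ * enc m x - (M⁻¹ * enc m x) * Real.log (P x) -
        (M⁻¹ * enc m x) * Real.log (G m x) := by
    intro m x
    rcases ((henc m).1 x).eq_or_lt with h0 | h0
    · simp [← h0]; exact mul_nonneg (hGpos m x).le (hP.1 x)
    have hJ : 0 < M⁻¹ * enc m x := by positivity
    have hPx : 0 < P x := hJ.trans_le (hle m x)
    have hlog := Real.log_le_sub_one_of_pos (div_pos (mul_pos (hGpos m x) hPx) hJ)
    have := mul_le_mul_of_nonneg_left hlog hJ.le
    rw [mul_sub, mul_div_cancel₀ _ hJ.ne', Real.log_div (mul_pos (hGpos m x) hPx).ne' hJ.ne',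
      Real.log_mul (hGpos m x).ne' hPx.ne', Real.log_mul (by positivity) h0.ne',
      Real.log_inv] at this
    rw [Real.negMulLog]
    nlinarith
  have hGsum : ∀ x, ∑ m, G m x ≤ 1 := by
    intro x
    have h1 : ∀ m, G m x ≤ 1 / (2 * M) + (if m = mhat x then 1 / 2 else 0) := fun m => by
      simp only [hG]
      split_ifs
      · have : 0 ≤ 1 / (2 * M) := by positivity
        linarith
      · simp
    calc ∑ m, G m x ≤ ∑ m, (1 / (2 * M) + (if m = mhat x then 1 / 2 else 0)) :=
          Finset.sum_le_sum fun m _ => h1 m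
      _ = 1 := by
        rw [Finset.sum_add_distrib, Finset.sum_ite_eq' Finset.univ]
        simp only [Finset.sum_const, Finset.card_univ, nsmul_eq_mul, Finset.mem_univ, if_true]
        rw [← hMdef]
        field_simp
        norm_num
  have hJsum : ∑ m, ∑ x, M⁻¹ * enc m x = 1 := by
    simp_rw [← Finset.mul_sum, (henc _).2]
    rw [Finset.mul_sum]
    exact avg_const 1
  have hGP : ∑ m, ∑ x, G m x * P x ≤ 1 := by
    rw [Finset.sum_comm]
    simp_rw [← Finset.sum_mul]
    calc _ ≤ ∑ x, 1 * P x := Finset.sum_le_sum fun x _ =>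
          mul_le_mul_of_nonneg_right (hGsum x) (hP.1 x)
      _ = 1 := by simp [hP.2]
  have hPlog : ∑ m, ∑ x, (M⁻¹ * enc m x) * Real.log (P x) = -ent P := by
    have h2 := hsum fun x => Real.log (P x)
    simp_rw [mul_assoc, ← Finset.mul_sum]
    simp_rw [← Finset.mul_sum] at h2
    rw [← h2, ent, ← Finset.sum_neg_distrib]
    exact Finset.sum_congr rfl fun x _ => by rw [Real.negMulLog]; ring
  have hGlog : ∑ m, ∑ x, (M⁻¹ * enc m x) * Real.log (G m x) = -Real.log 2 -
      (∑ m, M⁻¹ * ∑ x, enc m x * (if m = mhat x then 0 else 1)) * Real.log M := by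
    have h3 : ∀ m x, (M⁻¹ * enc m x) * Real.log (G m x) = (M⁻¹ * enc m x) * (-Real.log 2) -
        M⁻¹ * (enc m x * (if m = mhat x then 0 else 1)) * Real.log M := fun m x => by
      rw [hlogG]; ring
    simp_rw [h3, Finset.sum_sub_distrib, ← Finset.sum_mul, hJsum, ← Finset.mul_sum]
    ring
  have htot := Finset.sum_le_sum fun m (_ : m ∈ Finset.univ) =>
    Finset.sum_le_sum fun x (_ : x ∈ Finset.univ) => hterm m x
  simp only [Finset.sum_sub_distrib, Finset.sum_add_distrib] at htot
  have l1 : ∑ m, ∑ x, M⁻¹ * (enc m x).negMulLog = ∑ m, M⁻¹ * ent (enc m) := by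
    simp_rw [ent, Finset.mul_sum]
  have l2 : ∑ m, ∑ x, M⁻¹ * enc m x * Real.log M = Real.log M := by
    simp_rw [← Finset.sum_mul, hJsum, one_mul]
  rw [hPlog, hGlog, hJsum, l1, l2] at htot
  linarith

end OneShot

/-! ### Converse bounds for a code -/

section CodeConverse

variable {X Y : Type*} [MeasurableSpace Y] {μ : Measure Y} [SigmaFinite μ] {W : X → Measure Y}
  {𝒳 : Finset X} {n : ℕ} {v : 𝒳 → Y → ℝ}

lemma mixture_real {A Ω : Type*} [Fintype A] [MeasurableSpace Ω] {V : A → Measure Ω}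
    [∀ a, IsProbabilityMeasure (V a)] {P : A → ℝ} (hP : ∀ a, 0 ≤ P a) (s : Set Ω) :
    (mixture P V).real s = ∑ a, P a * (V a).real s := by
  rw [Measure.real, mixture, Measure.coe_finsetSum, Finset.sum_apply, ENNReal.toReal_sum]
  · refine Finset.sum_congr rfl fun a _ => ?_
    rw [Measure.smul_apply, smul_eq_mul, ENNReal.toReal_mul, ENNReal.toReal_ofReal (hP a)]
    rfl
  · intro a _
    rw [Measure.smul_apply, smul_eq_mul]
    exact ENNReal.mul_ne_top ENNReal.ofReal_ne_top (measure_ne_top _ _)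

lemma ent_eq_zero_of_eq_one {A : Type*} [Fintype A] {P : A → ℝ} (hP : P ∈ stdSimplex ℝ A) {x : A}
    (hx : P x = 1) : ent P = 0 := by
  classical
  refine Finset.sum_eq_zero fun y _ => ?_
  by_cases h : y = x
  · rw [h, hx]; simp
  have h1 : P y + P x ≤ ∑ a, P a := by
    rw [← Finset.sum_pair h]
    exact Finset.sum_le_sum_of_subset_of_nonneg (Finset.subset_univ _) fun a _ _ => hP.1 a
  rw [hP.2, hx] at h1
  have : P y = 0 := le_antisymm (by linarith) (hP.1 y)
  simp [this]

lemma ListCode.M_pos (c : ListCode 𝒳 Y n) : 0 < c.M := c.L_pos.trans c.L_lt_M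

/-- The number e is the mean entropy of the encoder. Adding it to log M in the entropy bound and to
the equivocation lets it cancel for stochastic codes, while for deterministic ones it is zero. -/
lemma code_converse (h : HasDens μ (honest W 𝒳) v) (c : ListCode 𝒳 Y n) {ε δ : ℝ} (hε0 : 0 ≤ ε)
    (hδ0 : 0 ≤ δ) (hδ1 : δ < 1) (hε : c.errA W ≤ ENNReal.ofReal ε)
    (hδ : c.bindD W ≤ ENNReal.ofReal δ) :
    ∃ P ∈ stdSimplex ℝ (Fin n → 𝒳), ∃ e : ℝ, 0 ≤ e ∧ (c.IsDeterministic → e = 0) ∧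
      (1 - ε) * (Real.log c.M - Real.log c.L) - Real.log 2 ≤
        infoD (Measure.pi fun _ : Fin n => μ) (nDens v n) P ∧
      Real.log c.M + e ≤ ent P + Real.log 2 + ε / (1 - δ) * Real.log c.M ∧
      c.equivocation μ W ≤ (((Real.log c.M -
        infoD (Measure.pi fun _ : Fin n => μ) (nDens v n) P + e) / Real.log 2 : ℝ) : EReal) := by
  classical
  have : Nonempty (Fin c.M) := ⟨⟨0, c.M_pos⟩⟩
  have hn := hasDens_pi h n
  have hprob := hn.isProb
  set Vn : (Fin n → 𝒳) → Measure (Fin n → Y) := fun x => Measure.pi fun i => honest W 𝒳 (x i)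
    with hVn
  have hM : (0 : ℝ) < c.M := by exact_mod_cast c.M_pos
  have hL : (0 : ℝ) < c.L := by exact_mod_cast c.L_pos
  have hlog2 : 0 < Real.log 2 := Real.log_pos one_lt_two
  have hP := inputDist_mem c.enc_mem
  set D : Fin c.M → Set (Fin n → Y) := fun m => {y | m ∈ c.dec y} with hD
  have hDm : ∀ m, MeasurableSet (D m) := c.measurableSet_dec
  have herr : ∀ m, ∑ x, c.enc m x * (Vn x).real (D m)ᶜ ≤ ε := by
    intro m
    rw [← mixture_real (c.enc_mem m).1]
    have h1 : c.out W m (D m)ᶜ ≤ ENNReal.ofReal ε := (le_iSup (fun m => c.out W m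
      {y | m ∉ c.dec y}) m).trans hε
    exact ENNReal.toReal_le_of_le_ofReal hε0 h1
  have hcompl : ∀ m x, (Vn x).real (D m)ᶜ = 1 - (Vn x).real (D m) := fun m x =>
    probReal_compl_eq_one_sub (hDm m)
  refine ⟨inputDist c.enc, hP, ∑ m, (Fintype.card (Fin c.M) : ℝ)⁻¹ * ent (c.enc m), ?_, ?_, ?_,
    ?_, ?_⟩
  · exact Finset.sum_nonneg fun m _ => mul_nonneg (by positivity) (ent_nonneg (c.enc_mem m))
  · intro hdet
    refine Finset.sum_eq_zero fun m _ => ?_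
    obtain ⟨x, hx⟩ := hdet m
    rw [ent_eq_zero_of_eq_one (c.enc_mem m) hx, mul_zero]
  · have hf := fano_list (L := c.L) (ε := ε) hn c.enc_mem D hDm hL (by
      simpa using c.L_lt_M.le) (fun y => by
        have : ∀ m, (D m).indicator (fun _ => (1 : ℝ)) y = if m ∈ c.dec y then 1 else 0 :=
          fun m => by simp [hD, Set.indicator_apply]
        simp_rw [this]
        rw [Finset.sum_ite_mem, Finset.univ_inter, Finset.sum_const, nsmul_eq_mul, mul_one]
        exact_mod_cast c.card_dec_le y) (fun m => by
        have h2 := herr m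
        simp_rw [hcompl, mul_sub, mul_one, Finset.sum_sub_distrib, (c.enc_mem m).2] at h2
        linarith)
    rw [Fintype.card_fin, Real.log_div hM.ne' hL.ne'] at hf
    exact hf
  -- The binding condition at an honest input: two messages listed with probability above δ would
  -- contradict it. A message other than `mhat x` is then missed with probability at least 1 − δ, so
  -- it is encoded as x with total probability at most ε/(1 − δ).
  · have hne : ∀ x, ∃ m', ∀ m, m ≠ m' → (Vn x).real (D m) ≤ δ := by
      intro x
      by_cases hx : ∃ m, ENNReal.ofReal δ < Vn x (D m)
      · obtain ⟨m', hm'⟩ := hx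
        refine ⟨m', fun m hm => ENNReal.toReal_le_of_le_ofReal hδ0 ?_⟩
        by_contra! hlt
        have h1 : min (Vn x (D m)) (Vn x (D m')) ≤ ENNReal.ofReal δ := by
          refine le_trans ?_ hδ
          unfold ListCode.bindD ListCode.bindAt
          exact le_iSup_of_le (fun i => (x i : X)) (le_iSup_of_le m (le_iSup_of_le m'
            (le_iSup_of_le hm le_rfl)))
        exact absurd (lt_min hlt hm') (not_lt.2 h1)
      · push Not at hx
        exact ⟨Classical.arbitrary _, fun m _ => ENNReal.toReal_le_of_le_ofReal hδ0 (hx m)⟩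
    choose mhat hmhat using hne
    have hf := log_card_add_ent_le c.enc_mem mhat
    rw [Fintype.card_fin] at hf ⊢
    refine hf.trans ?_
    have hlogM : 0 ≤ Real.log c.M := Real.log_nonneg (by exact_mod_cast c.M_pos)
    gcongr
    have hm : ∀ m, ∑ x, c.enc m x * (if m = mhat x then 0 else 1) ≤ ε / (1 - δ) := by
      intro m
      rw [le_div_iff₀ (by linarith)]
      refine le_trans ?_ (herr m)
      rw [Finset.sum_mul]
      refine Finset.sum_le_sum fun x _ => ?_
      rw [mul_assoc]
      refine mul_le_mul_of_nonneg_left ?_ ((c.enc_mem m).1 x)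
      split_ifs with hmx
      · simp
      · rw [hcompl]
        linarith [hmhat x m hmx]
    calc _ ≤ ∑ _m : Fin c.M, (c.M : ℝ)⁻¹ * (ε / (1 - δ)) :=
          Finset.sum_le_sum fun m _ => mul_le_mul_of_nonneg_left (hm m) (by positivity)
      _ = ε / (1 - δ) := by simpa using avg_const (ι := Fin c.M) (ε / (1 - δ))
  · set I := infoD (Measure.pi fun _ : Fin n => μ) (nDens v n) (inputDist c.enc) with hI
    set e := ∑ m, (Fintype.card (Fin c.M) : ℝ)⁻¹ * ent (c.enc m) with he
    have hkey : ((((I - e) / Real.log 2 : ℝ)) : EReal) ≤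
        ((⨅ Q ∈ acProb (Measure.pi fun _ : Fin n => μ),
          ∑ m, (c.M : ℝ≥0∞)⁻¹ * klDiv2 (c.out W m) Q : ℝ≥0∞) : EReal) := by
      have hlow : ENNReal.ofReal ((I - e) / Real.log 2) ≤
          ⨅ Q ∈ acProb (Measure.pi fun _ : Fin n => μ),
          ∑ m, (c.M : ℝ≥0∞)⁻¹ * klDiv2 (c.out W m) Q := by
        refine le_iInf₂ fun Q hQ => ?_
        have := hQ.1
        by_cases hfin : ∀ m, InformationTheory.klDiv (mixture (c.enc m) Vn) Q ≠ ∞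
        · have hle := infoD_sub_le_avg_klDiv hn c.enc_mem Q hfin
          have hsum : ∑ m, (c.M : ℝ≥0∞)⁻¹ * klDiv2 (c.out W m) Q =
              ENNReal.ofReal ((∑ m, (Fintype.card (Fin c.M) : ℝ)⁻¹ *
                (InformationTheory.klDiv (mixture (c.enc m) Vn) Q).toReal) / Real.log 2) := by
            rw [Finset.sum_div, ENNReal.ofReal_sum_of_nonneg fun m _ => by positivity]
            refine Finset.sum_congr rfl fun m _ => ?_
            rw [mul_div_assoc, ENNReal.ofReal_mul (by positivity), Fintype.card_fin,
              ENNReal.ofReal_inv_of_pos hM, ENNReal.ofReal_natCast,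
              ENNReal.ofReal_div_of_pos hlog2, ENNReal.ofReal_toReal (hfin m)]
            rfl
          rw [hsum]
          exact ENNReal.ofReal_le_ofReal (div_le_div_of_nonneg_right hle hlog2.le)
        · push Not at hfin
          obtain ⟨m, hm⟩ := hfin
          have : (c.M : ℝ≥0∞)⁻¹ * klDiv2 (c.out W m) Q = ∞ := by
            have h1 : klDiv2 (c.out W m) Q = ∞ := by
              change InformationTheory.klDiv (mixture (c.enc m) Vn) Q / _ = ∞
              rw [hm, ENNReal.top_div_of_ne_top ENNReal.ofReal_ne_top]
            rw [h1, ENNReal.mul_top (by simp)]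
          rw [ENNReal.sum_eq_top.2 ⟨m, Finset.mem_univ m, this⟩]
          exact le_top
      calc ((((I - e) / Real.log 2 : ℝ)) : EReal) ≤
          (ENNReal.ofReal ((I - e) / Real.log 2) : EReal) := by
            rw [EReal.coe_ennreal_ofReal]
            exact_mod_cast le_max_left _ _
        _ ≤ _ := by exact_mod_cast hlow
    unfold ListCode.equivocation
    have h2 := EReal.sub_le_sub (le_refl ((Real.logb 2 c.M : ℝ) : EReal)) hkey
    refine h2.trans (le_of_eq ?_)
    rw [← EReal.coe_sub]
    congr 1
    rw [Real.logb]
    ring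

end CodeConverse

/-! ### From the convex hull to the single-letter regions -/

section Hull

variable {A Y : Type*} [Fintype A] [MeasurableSpace Y] {μ : Measure Y} {v : A → Y → ℝ}
  {V : A → Measure Y}

/-- The weights of the convex combination become the law of U and the input laws at its points
become the conditional laws of X given U. Values of U of weight zero, where `condU` is a default
value, do not contribute. -/
lemma exists_aux_of_mem_infoHull {p : ℝ × ℝ} (hp : p ∈ infoHull μ v) :
    ∃ (k : ℕ) (P : Fin k × A → ℝ), P ∈ stdSimplex ℝ (Fin k × A) ∧
      ∑ u, margU P u * infoD μ v (condU P u) = p.1 ∧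
      ∑ u, margU P u * ent (condU P u) = p.2 := by
  obtain ⟨ι, hι, w, z, hw0, hw1, hz, hx⟩ := mem_convexHull_iff_exists_fintype.1 hp
  choose Q hQ hzQ using hz
  set e := Fintype.equivFin ι
  set P : Fin (Fintype.card ι) × A → ℝ := fun z => w (e.symm z.1) * Q (e.symm z.1) z.2 with hP
  have hmarg : ∀ u, margU P u = w (e.symm u) := fun u => by
    simp only [margU, hP, ← Finset.mul_sum, (hQ _).2, mul_one]
  have hcond : ∀ u, w (e.symm u) ≠ 0 → condU P u = Q (e.symm u) := fun u hu => by
    ext a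
    rw [condU, hmarg]
    simp only [hP]
    field_simp
  have hsum : ∀ f : (A → ℝ) → ℝ, ∑ u, margU P u * f (condU P u) = ∑ i, w i * f (Q i) := by
    intro f
    rw [← Equiv.sum_comp e.symm]
    refine Finset.sum_congr rfl fun u _ => ?_
    rw [hmarg]
    by_cases hu : w (e.symm u) = 0
    · simp [hu]
    · rw [hcond u hu]
  refine ⟨_, P, ⟨fun z => mul_nonneg (hw0 _) ((hQ _).1 _), ?_⟩, ?_, ?_⟩
  · rw [Fintype.sum_prod_type]
    calc _ = ∑ u, w (e.symm u) := Finset.sum_congr rfl fun u _ => hmarg u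
      _ = 1 := by rw [Equiv.sum_comp e.symm, hw1]
  · rw [hsum, ← hx, Prod.fst_sum]
    exact Finset.sum_congr rfl fun i _ => by rw [hzQ]; rfl
  · rw [hsum, ← hx, Prod.snd_sum]
    exact Finset.sum_congr rfl fun i _ => by rw [hzQ]; rfl

/-- A non-redundant channel transmits information for every non-degenerate input. -/
lemma infoD_pos (h : HasDens μ V v) (hW2 : CondW2 V) {P : A → ℝ} (hP : P ∈ stdSimplex ℝ A)
    (hent : 0 < ent P) : 0 < infoD μ v P := by
  classical
  refine (infoD_nonneg h.toIsDensity hP).lt_of_ne' fun h0 => ?_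
  have := h.isProb
  have := h.isProb_mixture hP
  -- Zero information forces every letter of positive probability to have the common output law.
  -- Positive entropy supplies two such letters, and (W2) fails at one of them with the point mass
  -- on the other.
  have heq : ∀ a, P a ≠ 0 → V a = mixture P V := by
    intro a ha
    rw [infoD_eq_sum_integral h hP, Finset.sum_eq_zero_iff_of_nonneg] at h0
    · have h1 := h0 a (Finset.mem_univ a)
      have h2 := (h.klDiv_mixture hP ha).2
      rw [(mul_eq_zero.1 h1).resolve_left ha, ENNReal.ofReal_zero] at h2
      exact InformationTheory.klDiv_eq_zero_iff.1 h2
    · intro b _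
      by_cases hb : P b = 0
      · simp [hb]
      · exact mul_nonneg (hP.1 b) (h.klDiv_mixture hP hb).1
  obtain ⟨a, -, ha⟩ := Finset.exists_lt_of_sum_lt
    (show ∑ _a : A, (0 : ℝ) < ∑ a, (P a).negMulLog by rw [Finset.sum_const_zero]; exact hent)
  have ha0 : P a ≠ 0 := fun h => by simp [h] at ha
  have ha1 : P a ≠ 1 := fun h => by simp [h] at ha
  obtain ⟨b, hba, hb⟩ : ∃ b, b ≠ a ∧ P b ≠ 0 := by
    by_contra! hcon
    apply ha1
    rw [← hP.2, Fintype.sum_eq_single a hcon]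
  have hVab : V b = V a := (heq b hb).trans (heq a ha0).symm
  unfold CondW2 at hW2
  refine hW2.not_ge ?_
  refine iInf_le_of_le a (iInf_le_of_le (Pi.single b 1) (iInf_le_of_le
    ⟨single_mem_stdSimplex ℝ b, by simp [hba.symm]⟩ ?_))
  have hmix : mixture (Pi.single b 1 : A → ℝ) V = V b := by
    unfold mixture
    rw [Fintype.sum_eq_single b fun c hc => by simp [hc]]
    simp
  rw [hmix, hVab, klDiv2, InformationTheory.klDiv_self]
  simp

/-- Some value of U has a conditional input law of positive entropy, and by (W2) that value already
contributes positive information. -/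
lemma pos_of_mem_infoHull (h : HasDens μ V v) (hW2 : CondW2 V) {p : ℝ × ℝ}
    (hp : p ∈ infoHull μ v) (hp2 : 0 < p.2) : 0 < p.1 := by
  obtain ⟨k, P, hP, h1, h2⟩ := exists_aux_of_mem_infoHull hp
  rw [← h2] at hp2
  obtain ⟨u, -, hu⟩ := Finset.exists_lt_of_sum_lt
    (show ∑ _u : Fin k, (0 : ℝ) < ∑ u, margU P u * ent (condU P u) by simpa using hp2)
  rw [← h1]
  have hu0 : margU P u ≠ 0 := fun h => by simp [h] at hu
  have hum := (margU_mem hP).1 u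
  refine Finset.sum_pos' (fun u _ => ?_) ⟨u, Finset.mem_univ u, ?_⟩
  · by_cases hu : margU P u = 0
    · simp [hu]
    · exact mul_nonneg ((margU_mem hP).1 u) (infoD_nonneg h.toIsDensity (condU_mem hP hu))
  · exact mul_pos (hum.lt_of_ne' hu0)
      (infoD_pos h hW2 (condU_mem hP hu0) ((pos_iff_pos_of_mul_pos hu).1 (hum.lt_of_ne' hu0)))

lemma mutualInfoU_coe (h : HasDens μ V v) {U : Type*} [Fintype U] {P : U × A → ℝ}
    (hP : P ∈ stdSimplex ℝ (U × A)) : (mutualInfoU V P : EReal) =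
      (((∑ u, margU P u * infoD μ v (condU P u)) / Real.log 2 : ℝ) : EReal) := by
  rw [mutualInfoU_eq h hP, EReal.coe_ennreal_ofReal, max_eq_left]
  refine div_nonneg (Finset.sum_nonneg fun u _ => ?_) (Real.log_pos one_lt_two).le
  by_cases hu : margU P u = 0
  · simp [hu]
  · exact mul_nonneg ((margU_mem hP).1 u) (infoD_nonneg h.toIsDensity (condU_mem hP hu))

lemma mem_regionC_of_mem_infoHull (h : HasDens μ V v) {p : ℝ × ℝ} (hp : p ∈ infoHull μ v)
    {r₁ r₂ r₃ : ℝ} (h1 : 0 < r₁) (h2 : 0 < r₂) (h3 : 0 < r₃) (h12 : 0 < r₁ - r₂)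
    (hlt : (r₁ - r₂) * Real.log 2 < p.1) (hH : r₁ * Real.log 2 < p.2)
    (hE : r₃ * Real.log 2 ≤ r₁ * Real.log 2 - p.1) : (r₁, r₂, r₃) ∈ regionC V := by
  have hlog : 0 < Real.log 2 := Real.log_pos one_lt_two
  obtain ⟨k, P, hP, hI, hHe⟩ := exists_aux_of_mem_infoHull hp
  refine ⟨k, P, hP, h12, ?_, ?_, ?_, h1, h2, h3⟩
  · rw [mutualInfoU_coe h hP, hI]
    exact_mod_cast (lt_div_iff₀ hlog).2 hlt
  · rw [mutualInfoU_coe h hP, hI, ← EReal.coe_sub]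
    have : r₃ ≤ r₁ - p.1 / Real.log 2 := by
      rw [le_sub_iff_add_le, ← le_sub_iff_add_le', div_le_iff₀ hlog]
      linarith
    exact_mod_cast this
  · rw [condEntropyU_eq hP, hHe]
    exact (lt_div_iff₀ hlog).2 hH

lemma mem_regionCs_of_mem_infoHull (h : HasDens μ V (dens μ V)) {p : ℝ × ℝ}
    (hp : p ∈ infoHull μ (dens μ V))
    {r₁ r₂ r₃ : ℝ} (h1 : 0 < r₁) (h2 : 0 < r₂) (h3 : 0 < r₃) (h12 : 0 < r₁ - r₂)
    (hlt : (r₁ - r₂) * Real.log 2 < p.1) (hH : r₁ * Real.log 2 < p.2)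
    (hE : r₃ * Real.log 2 ≤ p.2 - p.1) : (r₁, r₂, r₃) ∈ regionCs μ V := by
  have hlog : 0 < Real.log 2 := Real.log_pos one_lt_two
  obtain ⟨k, P, hP, hI, hHe⟩ := exists_aux_of_mem_infoHull hp
  refine ⟨k, P, hP, h12, ?_, ?_, ?_, h1, h2, h3⟩
  · rw [mutualInfoU_coe h hP, hI]
    exact_mod_cast (lt_div_iff₀ hlog).2 hlt
  · rw [condEntropyYU_eq h.toIsDensity hP, hI, hHe]
    exact (le_div_iff₀ hlog).2 hE
  · rw [condEntropyU_eq hP, hHe]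
    exact (lt_div_iff₀ hlog).2 hH

end Hull

/-! ### The converse -/

section Converse

variable {X Y : Type*} [MeasurableSpace Y] {μ : Measure Y} [SigmaFinite μ] {W : X → Measure Y}
  {𝒳 : Finset X} {v : 𝒳 → Y → ℝ}

/-- A sequence of secure codes determines points of the convex hull. -/
lemma exists_infoHull_of_codes (h : HasDens μ (honest W 𝒳) v) {R₁ R₂ R₃ : ℝ} (hR₁ : 0 < R₁)
    (c : ∀ n, ListCode 𝒳 Y n) (hsec : UltimatelySecure W c) (hrate : HasRates c R₁ R₂)
    (hequiv : (R₃ : EReal) ≤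
      liminf (fun n : ℕ => ((1 / n : ℝ) : EReal) * (c n).equivocation μ W) atTop)
    {η : ℝ} (hη : 0 < η) :
    ∃ p ∈ infoHull μ v, 0 ≤ R₁ - R₂ ∧ (R₁ - R₂) * Real.log 2 ≤ p.1 + η ∧
      R₁ * Real.log 2 ≤ p.2 + η ∧ R₃ * Real.log 2 ≤ p.2 - p.1 + η ∧
      ((∀ n, (c n).IsDeterministic) → R₃ * Real.log 2 ≤ R₁ * Real.log 2 - p.1 + η) := by
  have hlog : 0 < Real.log 2 := Real.log_pos one_lt_two
  have hlog1 : Real.log 2 ≤ 1 := by linarith [Real.log_two_lt_d9]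
  have h12 : 0 ≤ R₁ - R₂ := by
    refine sub_nonneg.2 (le_of_tendsto_of_tendsto' hrate.2 hrate.1 fun n => ?_)
    refine mul_le_mul_of_nonneg_left ?_ (by positivity)
    exact Real.logb_le_logb_of_le one_lt_two (by exact_mod_cast (c n).L_pos)
      (by exact_mod_cast (c n).L_lt_M.le)
  set τ : ℝ := min (η / 16) 1 with hτ
  have hτ0 : 0 < τ := lt_min (by positivity) one_pos
  have hτη : τ ≤ η / 16 := min_le_left _ _
  have hτ1 : τ ≤ 1 := min_le_right _ _
  -- With δ = 1/2 the Fano error term is 2ε times the message rate, which is at most R₁ + 1 in nats;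
  -- this choice makes the term at most τ.
  set ε : ℝ := τ / (2 * (R₁ + 1)) with hεd
  have hε0 : 0 < ε := by positivity
  have hεR : 2 * ε * (R₁ + 1) = τ := by rw [hεd]; field_simp
  have e1 : ∀ᶠ n in atTop, (c n).errA W ≤ ENNReal.ofReal ε :=
    (hsec.1.eventually_lt_const (ENNReal.ofReal_pos.2 hε0)).mono fun n hn => hn.le
  have e2 : ∀ᶠ n in atTop, (c n).bindD W ≤ ENNReal.ofReal (1 / 2) :=
    (hsec.2.eventually_lt_const (ENNReal.ofReal_pos.2 (by norm_num))).mono fun n hn => hn.le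
  have e3 := hrate.1.eventually (Metric.ball_mem_nhds _ hτ0)
  have e4 := hrate.2.eventually (Metric.ball_mem_nhds _ hτ0)
  have e5 : ∀ᶠ n : ℕ in atTop, Real.log 2 / n ≤ τ :=
    ((tendsto_const_div_atTop_nhds_zero_nat (Real.log 2)).eventually_lt_const hτ0).mono
      fun n hn => hn.le
  have e6 : ∀ᶠ n : ℕ in atTop, ((R₃ - τ : ℝ) : EReal) <
      ((1 / n : ℝ) : EReal) * (c n).equivocation μ W := by
    refine eventually_lt_of_lt_liminf (lt_of_lt_of_le ?_ hequiv)
    exact_mod_cast sub_lt_self R₃ hτ0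
  -- No limit is taken beyond this point: a single block length at which every quantity is within τ
  -- of its limit suffices, because η is arbitrary.
  obtain ⟨n, h1, h2, h3, h4, h5, h6, hn⟩ := (e1.and (e2.and (e3.and (e4.and (e5.and
    (e6.and (eventually_gt_atTop 0))))))).exists
  have hn' : (0 : ℝ) < n := by exact_mod_cast hn
  obtain ⟨P, hP, e, he0, hdet, hA, hB, hC⟩ :=
    code_converse h (c n) hε0.le (by norm_num) (by norm_num) h1 h2
  have hne : Nonempty 𝒳 := by
    by_contra hemp
    rw [not_nonempty_iff] at hemp
    have := hP.2
    have : IsEmpty (Fin n → 𝒳) := ⟨fun x => hemp.elim (x ⟨0, hn⟩)⟩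
    simp at *
  obtain ⟨p, hp, hp1, hp2⟩ := exists_infoHull_nDens μ h.toIsDensity n P hP
  set I := infoD (Measure.pi fun _ : Fin n => μ) (nDens v n) P with hI
  set ρ₁ := Real.log (c n).M / n with hρ₁
  set ρ₂ := Real.log (c n).L / n with hρ₂
  have hρ₁e : 1 / (n : ℝ) * Real.logb 2 (c n).M * Real.log 2 = ρ₁ := by
    rw [hρ₁, Real.logb]; field_simp
  have hρ₂e : 1 / (n : ℝ) * Real.logb 2 (c n).L * Real.log 2 = ρ₂ := by
    rw [hρ₂, Real.logb]; field_simp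
  rw [Real.dist_eq, abs_lt] at h3 h4
  have hlow₁ : (R₁ - τ) * Real.log 2 ≤ ρ₁ := by rw [← hρ₁e]; gcongr; linarith
  have hup₁ : ρ₁ ≤ (R₁ + τ) * Real.log 2 := by rw [← hρ₁e]; gcongr; linarith
  have hup₂ : ρ₂ ≤ (R₂ + τ) * Real.log 2 := by rw [← hρ₂e]; gcongr; linarith
  have hρ₂0 : 0 ≤ ρ₂ := div_nonneg (Real.log_nonneg (by exact_mod_cast (c n).L_pos)) hn'.le
  have hρ₁0 : 0 ≤ ρ₁ := div_nonneg (Real.log_nonneg (by exact_mod_cast (c n).M_pos)) hn'.le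
  have hA' : (1 - ε) * (ρ₁ - ρ₂) - Real.log 2 / n ≤ p.1 := by
    rw [hp1] at hA
    rw [hρ₁, hρ₂, ← sub_div, ← mul_div_assoc, ← sub_div, div_le_iff₀ hn', mul_comm p.1]
    exact hA
  have hB' : ρ₁ + e / n ≤ p.2 + Real.log 2 / n + 2 * ε * ρ₁ := by
    have : Real.log (c n).M + e ≤ n * p.2 + Real.log 2 + ε / (1 - 1 / 2) * Real.log (c n).M := by
      linarith
    calc ρ₁ + e / n = (Real.log (c n).M + e) / n := by rw [hρ₁]; ring
      _ ≤ (n * p.2 + Real.log 2 + ε / (1 - 1 / 2) * Real.log (c n).M) / n := by gcongr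
      _ = _ := by rw [hρ₁]; field_simp; ring
  have hC' : (R₃ - τ) * Real.log 2 ≤ ρ₁ - p.1 + e / n := by
    have hlt := h6.trans_le (mul_le_mul_of_nonneg_left hC (by
      exact_mod_cast (by positivity : (0 : ℝ) ≤ 1 / n)))
    have hlt' : R₃ - τ < 1 / n * ((Real.log (c n).M - I + e) / Real.log 2) := by exact_mod_cast hlt
    rw [hp1] at hlt'
    calc (R₃ - τ) * Real.log 2 ≤
        (1 / n * ((Real.log (c n).M - n * p.1 + e) / Real.log 2)) * Real.log 2 := by gcongr
      _ = _ := by rw [hρ₁]; field_simp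
  have hερ : 2 * ε * ρ₁ ≤ τ := by
    rw [← hεR]
    gcongr
    calc ρ₁ ≤ (R₁ + τ) * Real.log 2 := hup₁
      _ ≤ (R₁ + 1) * 1 := by gcongr
      _ = _ := by ring
  have hτl : τ * Real.log 2 ≤ τ := by nlinarith
  have heρ : 0 ≤ ε * ρ₂ := by positivity
  have hen : 0 ≤ e / n := by positivity
  -- Single-letterization yields a point of the closure only; moving it by τ into the hull itself
  -- allows it to be realized by a finite auxiliary variable.
  obtain ⟨q, hq, hpq⟩ := Metric.mem_closure_iff.1 hp τ hτ0
  rw [Prod.dist_eq, max_lt_iff, Real.dist_eq, Real.dist_eq, abs_lt, abs_lt] at hpq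
  refine ⟨q, hq, h12, ?_, ?_, ?_, fun hdet' => ?_⟩
  · linarith
  · linarith
  · linarith
  · have : e = 0 := hdet (hdet' n)
    rw [this, zero_div] at hC'
    linarith

end Converse

/-! ### Converse inclusions between closures of regions -/

section Regions

variable {X Y : Type*} [MeasurableSpace Y] {μ : Measure Y} [SigmaFinite μ] {W : X → Measure Y}
  {𝒳 : Finset X}

/-- Moves a rate difference that satisfies 0 ≤ d ≤ a + κ into the open interval (0, a). Positivity
of a is essential, and this is what (W2) provides. -/
lemma exists_mem_Ioo_near {d a κ : ℝ} (ha : 0 < a) (hκ : 0 < κ) (hd : 0 ≤ d) (hda : d ≤ a + κ) :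
    ∃ d', 0 < d' ∧ d' < a ∧ |d - d'| ≤ 2 * κ := by
  set κ' := min κ a / 2 with hκ'
  have h1 : min κ a ≤ κ := min_le_left _ _
  have h2 : min κ a ≤ a := min_le_right _ _
  have h3 : 0 < min κ a := lt_min hκ ha
  rcases le_total d κ' with h | h
  · exact ⟨κ', by linarith, by linarith, abs_le.2 ⟨by linarith, by linarith⟩⟩
  rcases le_total d (a - κ') with h' | h'
  · exact ⟨d, by linarith, by linarith, by simp [hκ.le]⟩
  · exact ⟨a - κ', by linarith, by linarith, abs_le.2 ⟨by linarith, by linarith⟩⟩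

/-- The perturbation shared by both converses. Lowering R₁ by 2κ makes the entropy constraint
strict, R₂ is readjusted so that the difference lies in (0, a), and R₃ drops by 4κ, enough to absorb
both the loss in R₁ and an error κ. -/
lemma mem_closure_of_forall_near {S : Set (ℝ × ℝ × ℝ)} {R₁ R₂ R₃ : ℝ} (h1 : 0 < R₁) (h2 : 0 < R₂)
    (h3 : 0 < R₃) (h12 : 0 ≤ R₁ - R₂)
    (H : ∀ κ > 0, ∃ a > 0, R₁ - R₂ ≤ a + κ ∧ ∀ r₂ r₃ : ℝ, 0 < R₁ - 2 * κ → 0 < r₂ → 0 < r₃ →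
      0 < R₁ - 2 * κ - r₂ → R₁ - 2 * κ - r₂ < a → r₃ = R₃ - 4 * κ →
      (R₁ - 2 * κ, r₂, r₃) ∈ S) : (R₁, R₂, R₃) ∈ closure S := by
  rw [Metric.mem_closure_iff]
  intro ε hε
  -- No coordinate moves by more than 4κ, so the triple stays within ε and its coordinates stay
  -- positive.
  set κ := min ε (min R₁ (min R₂ R₃)) / 8 with hκ
  have k0 : 0 < min ε (min R₁ (min R₂ R₃)) := lt_min hε (lt_min h1 (lt_min h2 h3))
  have k1 : min ε (min R₁ (min R₂ R₃)) ≤ ε := min_le_left _ _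
  have k2 : min ε (min R₁ (min R₂ R₃)) ≤ R₁ := (min_le_right _ _).trans (min_le_left _ _)
  have k3 : min ε (min R₁ (min R₂ R₃)) ≤ R₂ :=
    (min_le_right _ _).trans ((min_le_right _ _).trans (min_le_left _ _))
  have k4 : min ε (min R₁ (min R₂ R₃)) ≤ R₃ :=
    (min_le_right _ _).trans ((min_le_right _ _).trans (min_le_right _ _))
  obtain ⟨a, ha, haR, hS⟩ := H κ (by linarith)
  obtain ⟨d, hd0, hda, hd⟩ := exists_mem_Ioo_near ha (by linarith : 0 < κ) h12 haR
  rw [abs_le] at hd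
  refine ⟨_, hS (R₁ - 2 * κ - d) (R₃ - 4 * κ) (by linarith) (by linarith) (by linarith)
    (by linarith) (by linarith) rfl, ?_⟩
  rw [Prod.dist_eq, Prod.dist_eq, max_lt_iff, max_lt_iff]
  simp only [Real.dist_eq, abs_lt]
  refine ⟨⟨?_, ?_⟩, ⟨?_, ?_⟩, ?_, ?_⟩ <;> linarith

lemma regionUD_subset (hWμ : ∀ x, W x ≪ μ) [∀ x, IsProbabilityMeasure (W x)]
    (hW2 : CondW2 (honest W 𝒳)) :
    regionUD μ W 𝒳 ⊆ closure (regionC (honest W 𝒳)) := by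
  rintro ⟨R₁, R₂, R₃⟩ ⟨⟨h1, h2, h3⟩, c, hdet, hsec, hrate, hequiv⟩
  have hlog : 0 < Real.log 2 := Real.log_pos one_lt_two
  have : ∀ x, IsProbabilityMeasure (honest W 𝒳 x) := fun x => by unfold honest; infer_instance
  have h : HasDens μ (honest W 𝒳) (dens μ (honest W 𝒳)) := hasDens_dens fun x => hWμ x
  simp only at h1 h2 h3 hrate hequiv
  obtain ⟨-, -, h12, -⟩ := exists_infoHull_of_codes h h1 c hsec hrate hequiv one_pos
  refine mem_closure_of_forall_near h1 h2 h3 h12 fun κ hκ => ?_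
  -- The cap R₁/2 keeps the entropy coordinate of p above a positive multiple of R₁, so that (W2)
  -- applies to p.
  have hκ' : 0 < min κ (R₁ / 2) := lt_min hκ (by linarith)
  obtain ⟨p, hp, -, hI, hH, -, hE⟩ :=
    exists_infoHull_of_codes h h1 c hsec hrate hequiv (mul_pos hκ' hlog)
  have hm1 : min κ (R₁ / 2) * Real.log 2 ≤ κ * Real.log 2 := by gcongr; exact min_le_left _ _
  have hm2 : min κ (R₁ / 2) * Real.log 2 ≤ R₁ / 2 * Real.log 2 := by gcongr; exact min_le_right _ _
  have hpos : 0 < R₁ / 2 * Real.log 2 := by positivity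
  have hκl : 0 < κ * Real.log 2 := by positivity
  have hp1 := pos_of_mem_infoHull h hW2 hp (by linarith)
  refine ⟨p.1 / Real.log 2, by positivity, ?_, fun r₂ r₃ g1 g2 g3 g4 g5 g6 => ?_⟩
  · rw [← sub_le_iff_le_add, le_div_iff₀ hlog]
    linarith
  · refine mem_regionC_of_mem_infoHull h hp g1 g2 g3 g4 ((lt_div_iff₀ hlog).1 g5) ?_ ?_
    · linarith
    · have := hE hdet
      rw [g6]
      linarith

lemma regionUS_subset (hWμ : ∀ x, W x ≪ μ) [∀ x, IsProbabilityMeasure (W x)]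
    (hW2 : CondW2 (honest W 𝒳)) :
    regionUS μ W 𝒳 ⊆ closure (regionCs μ (honest W 𝒳)) := by
  rintro ⟨R₁, R₂, R₃⟩ ⟨⟨h1, h2, h3⟩, c, hsec, hrate, hequiv⟩
  have hlog : 0 < Real.log 2 := Real.log_pos one_lt_two
  have : ∀ x, IsProbabilityMeasure (honest W 𝒳 x) := fun x => by unfold honest; infer_instance
  have h : HasDens μ (honest W 𝒳) (dens μ (honest W 𝒳)) := hasDens_dens fun x => hWμ x
  simp only at h1 h2 h3 hrate hequiv
  obtain ⟨-, -, h12, -⟩ := exists_infoHull_of_codes h h1 c hsec hrate hequiv one_pos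
  refine mem_closure_of_forall_near h1 h2 h3 h12 fun κ hκ => ?_
  have hκ' : 0 < min κ (R₁ / 2) := lt_min hκ (by linarith)
  obtain ⟨p, hp, -, hI, hH, hE, -⟩ :=
    exists_infoHull_of_codes h h1 c hsec hrate hequiv (mul_pos hκ' hlog)
  have hm1 : min κ (R₁ / 2) * Real.log 2 ≤ κ * Real.log 2 := by gcongr; exact min_le_left _ _
  have hm2 : min κ (R₁ / 2) * Real.log 2 ≤ R₁ / 2 * Real.log 2 := by gcongr; exact min_le_right _ _
  have hpos : 0 < R₁ / 2 * Real.log 2 := by positivity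
  have hκl : 0 < κ * Real.log 2 := by positivity
  have hp1 := pos_of_mem_infoHull h hW2 hp (by linarith)
  refine ⟨p.1 / Real.log 2, by positivity, ?_, fun r₂ r₃ g1 g2 g3 g4 g5 g6 => ?_⟩
  · rw [← sub_le_iff_le_add, le_div_iff₀ hlog]
    linarith
  · refine mem_regionCs_of_mem_infoHull h hp g1 g2 g3 g4 ((lt_div_iff₀ hlog).1 g5) ?_ ?_
    · linarith
    · rw [g6]
      linarith

end Regions

/-! ### Sequences with prescribed frequencies -/

/-- A greedy choice: the next letter is one whose count is below its target (n + 1) q a. Counts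
never exceed n q a + 1, and since they sum to n they cannot fall short by more than the alphabet
size. A selected letter has a nonnegative count below its target, hence positive probability. One
infinite sequence serves all block lengths. -/
lemma exists_seq_tendsto_freq {U : Type*} [Fintype U] {q : U → ℝ} (hq : q ∈ stdSimplex ℝ U) :
    ∃ u : ℕ → U, (∀ i, 0 < q (u i)) ∧ ∀ f : U → ℝ,
      Tendsto (fun n : ℕ => (∑ i : Fin n, f (u i)) / n) atTop (𝓝 (∑ a, q a * f a)) := by
  classical
  have hne : Nonempty U := by
    by_contra h
    rw [not_nonempty_iff] at h
    have := hq.2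
    simp at this
  -- Such a letter exists because the counts sum to n while the targets sum to n + 1.
  have hpick : ∀ (n : ℕ) (c : U → ℝ), ∃ a, (∑ b, c b = n → c a < (n + 1) * q a) := by
    intro n c
    by_cases hc : ∑ b, c b = n
    · obtain ⟨a, -, ha⟩ := Finset.exists_lt_of_sum_lt (s := Finset.univ) (f := c)
        (g := fun a => (n + 1) * q a) (by rw [← Finset.mul_sum, hq.2, hc]; linarith)
      exact ⟨a, fun _ => ha⟩
    · exact ⟨Classical.arbitrary U, fun h => (hc h).elim⟩
  choose pick hp using hpick
  let c : ℕ → U → ℝ := fun n => Nat.rec (fun _ => 0) (fun n c => c + Pi.single (pick n c) 1) n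
  have hc0 : c 0 = fun _ => 0 := rfl
  have hcs : ∀ n, c (n + 1) = c n + Pi.single (pick n (c n)) 1 := fun n => rfl
  have hsum : ∀ n, ∑ b, c n b = n := by
    intro n
    induction n with
    | zero => simp [hc0]
    | succ n ih => simp [hcs, Finset.sum_add_distrib, ih]
  have hnn : ∀ n b, 0 ≤ c n b := by
    intro n
    induction n with
    | zero => simp [hc0]
    | succ n ih =>
      intro b
      rw [hcs, Pi.add_apply]
      refine add_nonneg (ih b) ?_
      by_cases hb : b = pick n (c n)
      · rw [hb]; simp
      · simp [hb]
  have hlt : ∀ n, c n (pick n (c n)) < (n + 1) * q (pick n (c n)) := fun n => hp n _ (hsum n)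
  have hup : ∀ n b, c n b ≤ n * q b + 1 := by
    intro n
    induction n with
    | zero => simp [hc0]
    | succ n ih =>
      intro b
      rw [hcs, Pi.add_apply]
      push_cast
      by_cases hb : b = pick n (c n)
      · rw [hb]
        have := hlt n
        simp
        linarith
      · have := ih b
        simp [hb]
        linarith [hq.1 b]
  have hlow : ∀ n b, n * q b - Fintype.card U ≤ c n b := by
    intro n b
    have h1 : ∑ a ∈ Finset.univ.erase b, c n a ≤ ∑ a ∈ Finset.univ.erase b, (n * q a + 1) :=
      Finset.sum_le_sum fun a _ => hup n a
    have h2 := Finset.add_sum_erase Finset.univ (c n) (Finset.mem_univ b)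
    have h3 := Finset.add_sum_erase Finset.univ q (Finset.mem_univ b)
    rw [hsum] at h2
    rw [hq.2] at h3
    rw [Finset.sum_add_distrib, ← Finset.mul_sum] at h1
    have h4 : ∑ _a ∈ Finset.univ.erase b, (1 : ℝ) ≤ Fintype.card U := by
      simp [Finset.card_erase_of_mem]
    have h5 : ∑ a ∈ Finset.univ.erase b, q a = 1 - q b := by linarith
    rw [h5] at h1
    linarith
  have hlim : ∀ b, Tendsto (fun n : ℕ => c n b / n) atTop (𝓝 (q b)) := by
    intro b
    have l1 : Tendsto (fun n : ℕ => q b - (Fintype.card U : ℝ) / n) atTop (𝓝 (q b)) := by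
      simpa using tendsto_const_nhds.sub
        (tendsto_const_div_atTop_nhds_zero_nat (Fintype.card U : ℝ))
    have l2 : Tendsto (fun n : ℕ => q b + (1 : ℝ) / n) atTop (𝓝 (q b)) := by
      simpa using (tendsto_const_nhds (x := q b)).add (tendsto_const_div_atTop_nhds_zero_nat (1 : ℝ))
    refine tendsto_of_tendsto_of_tendsto_of_le_of_le' l1 l2 ?_ ?_
    · filter_upwards [eventually_gt_atTop 0] with n hn
      have hn' : (0 : ℝ) < n := by exact_mod_cast hn
      rw [le_div_iff₀ hn', sub_mul, div_mul_cancel₀ _ hn'.ne']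
      linarith [hlow n b]
    · filter_upwards [eventually_gt_atTop 0] with n hn
      have hn' : (0 : ℝ) < n := by exact_mod_cast hn
      rw [div_le_iff₀ hn', add_mul, div_mul_cancel₀ _ hn'.ne']
      linarith [hup n b]
  refine ⟨fun n => pick n (c n), fun n => ?_, fun f => ?_⟩
  · have := (hnn n _).trans_lt (hlt n)
    exact (pos_iff_pos_of_mul_pos this).1 (by positivity)
  · have hF : ∀ n : ℕ, ∑ i : Fin n, f (pick i (c i)) = ∑ b, c n b * f b := by
      intro n
      induction n with
      | zero => simp [hc0]
      | succ n ih =>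
        rw [Fin.sum_univ_castSucc]
        simp only [Fin.val_castSucc, Fin.val_last]
        rw [ih, hcs]
        simp [add_mul, Finset.sum_add_distrib, Pi.single_apply, ite_mul]
    simp_rw [hF, Finset.sum_div]
    refine tendsto_finsetSum _ fun b _ => ?_
    simpa [div_mul_eq_mul_div] using (hlim b).mul_const (f b)

/-! ### Weights on finite sets -/

section Weights

variable {B : Type*} [Fintype B]

/-- The total weight of a set. -/
noncomputable def wt (w : B → ℝ) (S : Set B) : ℝ := ∑ x, S.indicator w x

lemma wt_mono {w : B → ℝ} (hw : ∀ x, 0 ≤ w x) {S T : Set B} (h : S ⊆ T) : wt w S ≤ wt w T :=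
  Finset.sum_le_sum fun x _ => Set.indicator_le_indicator_of_subset h hw x

lemma wt_union_le {w : B → ℝ} (hw : ∀ x, 0 ≤ w x) (S T : Set B) :
    wt w (S ∪ T) ≤ wt w S + wt w T := by
  unfold wt
  rw [← Finset.sum_add_distrib]
  refine Finset.sum_le_sum fun x _ => ?_
  by_cases h1 : x ∈ S <;> by_cases h2 : x ∈ T <;> simp [h1, h2, hw x]

lemma wt_add_compl (w : B → ℝ) (S : Set B) : wt w S + wt w Sᶜ = ∑ x, w x := by
  unfold wt
  rw [← Finset.sum_add_distrib]
  exact Finset.sum_congr rfl fun x _ => by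
    rw [← Pi.add_apply, Set.indicator_self_add_compl]

/-- Markov's inequality. -/
lemma wt_mul_le {w g : B → ℝ} (hw : ∀ x, 0 ≤ w x) (hg : ∀ x, 0 ≤ g x) (t : ℝ) {S : Set B}
    (hS : ∀ x ∈ S, t ≤ g x) : t * wt w S ≤ ∑ x, w x * g x := by
  unfold wt
  rw [Finset.mul_sum]
  refine Finset.sum_le_sum fun x _ => ?_
  by_cases h : x ∈ S
  · rw [Set.indicator_of_mem h, mul_comm]
    exact mul_le_mul_of_nonneg_left (hS x h) (hw x)
  · rw [Set.indicator_of_notMem h, mul_zero]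
    exact mul_nonneg (hw x) (hg x)

/-- Successive selection of elements with few conflicts. -/
lemma exists_selection {w : B → ℝ} (hw : ∀ x, 0 ≤ w x) {S : Set B} (hS : 1 / 2 ≤ wt w S)
    {f : B → B → ℝ} {β : ℝ} (hβ : 0 ≤ β)
    (h1 : ∀ a ∈ S, ∑ b, S.indicator (fun b => w b * f a b) b ≤ β)
    (h2 : ∀ a ∈ S, ∑ b, S.indicator (fun b => w b * f b a) b ≤ β) (N : ℕ) :
    ∃ c : Fin N → B, (∀ i, c i ∈ S ∧ 0 < w (c i)) ∧
      ∑ i, ∑ j, (if i = j then 0 else f (c i) (c j)) ≤ 2 * β * N ^ 2 := by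
  classical
  induction N with
  | zero => exact ⟨Fin.elim0, fun i => i.elim0, by simp⟩
  | succ N ih =>
    obtain ⟨c, hc, hsum⟩ := ih
    -- The conflicts of a new element with those already chosen, in both orders. The weighted sum of
    -- F over S is at most 2Nβ and S has weight at least 1/2, so some element of positive weight has
    -- F ≤ 4Nβ; and 2βN² + 4βN ≤ 2β(N + 1)².
    set F : B → ℝ := fun b => ∑ i, (f (c i) b + f b (c i)) with hF
    have hFle : ∑ b, S.indicator (fun b => w b * F b) b ≤ 2 * N * β := by
      have : ∀ b, S.indicator (fun b => w b * F b) b =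
          ∑ i, (S.indicator (fun b => w b * f (c i) b) b +
            S.indicator (fun b => w b * f b (c i)) b) := by
        intro b
        by_cases hb : b ∈ S
        · simp [hb, hF, Finset.mul_sum, mul_add]
        · simp [hb]
      simp_rw [this]
      rw [Finset.sum_comm]
      calc _ ≤ ∑ _i : Fin N, (β + β) := Finset.sum_le_sum fun i _ => by
            rw [Finset.sum_add_distrib]
            exact add_le_add (h1 _ (hc i).1) (h2 _ (hc i).1)
        _ = _ := by simp; ring
    set T : Finset B := Finset.univ.filter fun b => b ∈ S ∧ 0 < w b with hT
    have hTsum : ∀ g : B → ℝ, ∑ b ∈ T, w b * g b = ∑ b, S.indicator (fun b => w b * g b) b := by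
      intro g
      rw [hT, Finset.sum_filter]
      refine Finset.sum_congr rfl fun b _ => ?_
      by_cases hb : b ∈ S
      · rcases (hw b).eq_or_lt with h0 | h0
        · simp [hb, ← h0]
        · simp [hb, h0]
      · simp [hb]
    have hwtT : ∑ b ∈ T, w b * (4 * N * β) = wt w S * (4 * N * β) := by
      rw [← Finset.sum_mul]
      congr 1
      have := hTsum fun _ => 1
      simp only [mul_one] at this
      exact this
    have hTne : T.Nonempty := by
      by_contra hemp
      rw [Finset.not_nonempty_iff_eq_empty] at hemp
      have := hTsum fun _ => 1
      simp only [mul_one, hemp, Finset.sum_empty] at this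
      change 0 = wt w S at this
      linarith
    obtain ⟨b, hb, hle⟩ := Finset.exists_le_of_sum_le (s := T) (f := fun b => w b * F b)
      (g := fun b => w b * (4 * N * β)) hTne (by
        rw [hTsum, hwtT]
        refine hFle.trans ?_
        have : 0 ≤ 4 * N * β := by positivity
        nlinarith)
    rw [hT, Finset.mem_filter] at hb
    have hFb : F b ≤ 4 * N * β := le_of_mul_le_mul_left hle hb.2.2
    refine ⟨Fin.cons b c, fun i => ?_, ?_⟩
    · refine Fin.cases ?_ (fun i => ?_) i
      · simpa using hb.2
      · simpa using hc i
    · simp only [Fin.sum_univ_succ, Fin.cons_zero, Fin.cons_succ, if_true, Fin.succ_inj,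
        Fin.succ_ne_zero, (Fin.succ_ne_zero _).symm, if_false, Finset.sum_add_distrib, zero_add]
      rw [hF] at hFb
      simp only [Finset.sum_add_distrib] at hFb
      push_cast
      nlinarith

/-- Selection followed by expurgation. -/
lemma exists_expurgated {w : B → ℝ} (hw : ∀ x, 0 ≤ w x) {S : Set B} (hS : 1 / 2 ≤ wt w S)
    {f : B → B → ℝ} (hf : ∀ a b, 0 ≤ f a b) {β : ℝ} (hβ : 0 < β)
    (h1 : ∀ a ∈ S, ∑ b, S.indicator (fun b => w b * f a b) b ≤ β)
    (h2 : ∀ a ∈ S, ∑ b, S.indicator (fun b => w b * f b a) b ≤ β) {M : ℕ} (hM : 0 < M) :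
    ∃ c : Fin M → B, (∀ i, c i ∈ S ∧ 0 < w (c i)) ∧
      ∀ i, ∑ j, (if i = j then 0 else f (c i) (c j)) ≤ 8 * β * M := by
  classical
  -- Twice as many elements as needed: the conflicts total at most 8βM², so at most M of the 2M
  -- elements exceed 8βM and M good ones remain. Passing to a subset only decreases the row sums.
  obtain ⟨c, hc, hsum⟩ := exists_selection hw hS hβ.le h1 h2 (2 * M)
  have hM' : (0 : ℝ) < M := by exact_mod_cast hM
  set g : Fin (2 * M) → ℝ := fun i => ∑ j, (if i = j then 0 else f (c i) (c j)) with hg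
  have hg0 : ∀ i, 0 ≤ g i := fun i => Finset.sum_nonneg fun j _ => by
    split_ifs
    · exact le_rfl
    · exact hf _ _
  set bad := Finset.univ.filter fun i => 8 * β * M < g i with hbad
  have hbadcard : bad.card ≤ M := by
    have : (bad.card : ℝ) * (8 * β * M) ≤ 8 * β * M * M := by
      calc (bad.card : ℝ) * (8 * β * M) = ∑ _i ∈ bad, 8 * β * M := by simp
        _ ≤ ∑ i ∈ bad, g i := Finset.sum_le_sum fun i hi => (Finset.mem_filter.1 hi).2.le
        _ ≤ ∑ i, g i := Finset.sum_le_sum_of_subset_of_nonneg (Finset.subset_univ _)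
            fun i _ _ => hg0 i
        _ ≤ _ := hsum.trans (le_of_eq (by push_cast; ring))
    have h3 : (bad.card : ℝ) ≤ M := by
      rw [mul_comm] at this
      exact le_of_mul_le_mul_left this (by positivity)
    exact_mod_cast h3
  have hgood : M ≤ badᶜ.card := by
    rw [Finset.card_compl, Fintype.card_fin]
    omega
  obtain ⟨T, hT, hTcard⟩ := Finset.exists_subset_card_eq hgood
  set e := T.orderEmbOfFin hTcard with he
  refine ⟨fun i => c (e i), fun i => hc _, fun i => ?_⟩
  have hi : e i ∉ bad := Finset.mem_compl.1 (hT (T.orderEmbOfFin_mem hTcard i))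
  have hgi : g (e i) ≤ 8 * β * M := by
    by_contra! h
    exact hi (Finset.mem_filter.2 ⟨Finset.mem_univ _, h⟩)
  refine le_trans ?_ hgi
  calc ∑ j, (if i = j then 0 else f (c (e i)) (c (e j))) =
        ∑ j ∈ Finset.univ.map e.toEmbedding, (if e i = j then 0 else f (c (e i)) (c j)) := by
        rw [Finset.sum_map]
        exact Finset.sum_congr rfl fun j _ => by simp
    _ ≤ g (e i) := Finset.sum_le_sum_of_subset_of_nonneg (Finset.subset_univ _) fun j _ _ => by
        split_ifs
        · exact le_rfl
        · exact hf _ _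

end Weights

/-! ### Product weights -/

section ProdWeights

variable {A : Type*} [Fintype A]

/-- The product of the weights `p i`. -/
def prodW {n : ℕ} (p : Fin n → A → ℝ) (x : Fin n → A) : ℝ := ∏ i, p i (x i)

lemma sum_prod_pi {n : ℕ} (p : Fin n → A → ℝ) : ∑ x, prodW p x = ∏ i, ∑ a, p i a := by
  classical
  unfold prodW
  rw [Finset.prod_univ_sum, Fintype.piFinset_univ]

lemma prodW_nonneg {n : ℕ} {p : Fin n → A → ℝ} (hp : ∀ i, p i ∈ stdSimplex ℝ A)
    (x : Fin n → A) : 0 ≤ prodW p x := Finset.prod_nonneg fun i _ => (hp i).1 _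

lemma prodW_mem {n : ℕ} {p : Fin n → A → ℝ} (hp : ∀ i, p i ∈ stdSimplex ℝ A) :
    prodW p ∈ stdSimplex ℝ (Fin n → A) :=
  ⟨prodW_nonneg hp, by rw [sum_prod_pi]; simp [(hp _).2]⟩

lemma sum_tailHead {n : ℕ} (F : (Fin (n + 1) → A) → ℝ) :
    ∑ x, F x = ∑ a, ∑ x : Fin n → A, F (Fin.cons a x) := by
  rw [← Equiv.sum_comp (tailHead n A).symm, Fintype.sum_prod_type_right]
  rfl

/-- Cross terms vanish by independence and centring. The first moment is part of the statement
because the inductive step for the second moment needs it. -/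
lemma sum_prodW_second_moment {n : ℕ} (p : Fin n → A → ℝ) (hp : ∀ i, p i ∈ stdSimplex ℝ A)
    (f : Fin n → A → ℝ) (hf : ∀ i, ∑ a, p i a * f i a = 0) :
    ∑ x, prodW p x * (∑ i, f i (x i)) = 0 ∧
    ∑ x, prodW p x * (∑ i, f i (x i)) ^ 2 = ∑ i, ∑ a, p i a * f i a ^ 2 := by
  induction n with
  | zero => simp
  | succ n ih =>
    obtain ⟨ih1, ih2⟩ := ih (fun i => p i.succ) (fun i => hp _) (fun i => f i.succ) fun i => hf _
    have hone := (prodW_mem fun i : Fin n => hp i.succ).2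
    have hW : ∀ a (x : Fin n → A), prodW p (Fin.cons a x) =
        p 0 a * prodW (fun i => p i.succ) x := fun a x => by
      simp [prodW, Fin.prod_univ_succ]
    rw [sum_tailHead, sum_tailHead]
    simp_rw [hW, Fin.sum_univ_succ, Fin.cons_zero, Fin.cons_succ]
    constructor
    · have : ∀ a (x : Fin n → A), p 0 a * prodW (fun i => p i.succ) x *
          (f 0 a + ∑ i : Fin n, f i.succ (x i)) =
          p 0 a * f 0 a * prodW (fun i => p i.succ) x +
          p 0 a * (prodW (fun i => p i.succ) x * ∑ i : Fin n, f i.succ (x i)) :=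
        fun a x => by ring
      simp_rw [this, Finset.sum_add_distrib, ← Finset.mul_sum, ih1, hone]
      simp [hf 0]
    · have : ∀ a (x : Fin n → A), p 0 a * prodW (fun i => p i.succ) x *
          (f 0 a + ∑ i : Fin n, f i.succ (x i)) ^ 2 =
          p 0 a * f 0 a ^ 2 * prodW (fun i => p i.succ) x +
          2 * (p 0 a * f 0 a) * (prodW (fun i => p i.succ) x * ∑ i : Fin n, f i.succ (x i)) +
          p 0 a * (prodW (fun i => p i.succ) x * (∑ i : Fin n, f i.succ (x i)) ^ 2) :=
        fun a x => by ring
      simp_rw [this, Finset.sum_add_distrib, ← Finset.mul_sum, ih1, ih2, hone]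
      simp [← Finset.sum_mul, (hp 0).2]

/-- Chebyshev's inequality for product weights. -/
lemma wt_prodW_le {n : ℕ} (hn : 0 < n) {p : Fin n → A → ℝ} (hp : ∀ i, p i ∈ stdSimplex ℝ A)
    (f : Fin n → A → ℝ) {C η : ℝ} (hη : 0 < η)
    (hC : ∀ i, ∑ a, p i a * (f i a - ∑ b, p i b * f i b) ^ 2 ≤ C) :
    wt (prodW p) {x | η * n ≤ |∑ i, f i (x i) - ∑ i, ∑ a, p i a * f i a|} ≤ C / (η ^ 2 * n) := by
  have hn' : (0 : ℝ) < n := by exact_mod_cast hn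
  have h2 := (sum_prodW_second_moment p hp (fun i a => f i a - ∑ b, p i b * f i b) fun i => by
    simp_rw [mul_sub, Finset.sum_sub_distrib, ← Finset.sum_mul, (hp i).2]
    ring).2
  have h3 := wt_mul_le (prodW_nonneg hp)
    (g := fun x => (∑ i, (f i (x i) - ∑ b, p i b * f i b)) ^ 2) (fun x => sq_nonneg _)
    ((η * n) ^ 2) (S := {x | η * n ≤ |∑ i, f i (x i) - ∑ i, ∑ a, p i a * f i a|}) (by
      intro x hx
      rw [Finset.sum_sub_distrib, ← sq_abs (∑ i, f i (x i) - _)]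
      exact pow_le_pow_left₀ (by positivity) hx 2)
  rw [h2] at h3
  have h4 : ∑ i, ∑ a, p i a * (f i a - ∑ b, p i b * f i b) ^ 2 ≤ n * C :=
    (Finset.sum_le_sum fun i _ => hC i).trans (by simp)
  rw [le_div_iff₀ (by positivity)]
  have h5 : (η * n) ^ 2 * wt (prodW p) {x | η * n ≤ |∑ i, f i (x i) - ∑ i, ∑ a, p i a * f i a|} ≤
    n * C := h3.trans h4
  refine le_of_mul_le_mul_left ?_ hn'
  linarith

end ProdWeights

/-! ### Hamming balls -/

/-- A Chernoff bound for counting: inside the ball the indicator is at most s^(dist − κn), since s ≤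
1, and the sum of s^dist over all sequences factorizes over the coordinates. -/
lemma card_hammingBall_le {A : Type*} [Fintype A] [DecidableEq A] {n : ℕ} (a : Fin n → A) {s κ : ℝ}
    (hs0 : 0 < s) (hs1 : s ≤ 1) :
    ∑ b : Fin n → A, ({b | (hammingDist a b : ℝ) < κ * n} : Set _).indicator (fun _ => (1 : ℝ)) b ≤
      (s ^ (-κ) * (1 + Fintype.card A * s)) ^ n := by
  have h1 : ∀ b : Fin n → A,
      ({b | (hammingDist a b : ℝ) < κ * n} : Set _).indicator (fun _ => (1 : ℝ)) b ≤
      s ^ (-κ * n) * ∏ i, (if a i = b i then 1 else s) := by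
    intro b
    have hprod : ∏ i, (if a i = b i then 1 else s) = s ^ (hammingDist a b : ℝ) := by
      rw [Real.rpow_natCast, hammingDist, Finset.prod_ite]
      simp
    rw [hprod, ← Real.rpow_add hs0]
    by_cases hb : (hammingDist a b : ℝ) < κ * n
    · rw [Set.indicator_of_mem (by exact hb)]
      exact Real.one_le_rpow_of_pos_of_le_one_of_nonpos hs0 hs1 (by linarith)
    · rw [Set.indicator_of_notMem (by exact hb)]
      positivity
  calc _ ≤ ∑ b : Fin n → A, s ^ (-κ * n) * ∏ i, (if a i = b i then 1 else s) :=
        Finset.sum_le_sum fun b _ => h1 b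
    _ = s ^ (-κ * n) * ∏ i, ∑ c, (if a i = c then 1 else s) := by
        rw [← Finset.mul_sum]
        congr 1
        exact sum_prod_pi fun i c => if a i = c then 1 else s
    _ ≤ s ^ (-κ * n) * ∏ _i : Fin n, (1 + Fintype.card A * s) := by
        gcongr with i
        calc ∑ c, (if a i = c then 1 else s) ≤ ∑ c, ((if a i = c then 1 else 0) + s) :=
              Finset.sum_le_sum fun c _ => by split_ifs <;> simp [hs0.le]
          _ = _ := by simp [Finset.sum_add_distrib]
    _ = _ := by
        rw [Real.rpow_mul hs0.le, Real.rpow_natCast]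
        simp [mul_pow]

/-! ### The binding test -/

section Binding

variable {X Y : Type*} [MetricSpace X] [MeasurableSpace Y] {W : X → Measure Y} {𝒳 : Finset X}
  {ξ : X → Y → ℝ} {C : ℝ}

lemma log2_neg_iff {s : ℝ≥0∞} : log2 s < 0 ↔ s < 1 := by
  have hlog : 0 < Real.log 2 := Real.log_pos one_lt_two
  constructor
  · intro h
    by_contra! h1
    exact absurd (EReal.div_nonneg (ENNReal.zero_le_log_iff.2 h1)
      (by exact_mod_cast hlog.le : (0 : EReal) ≤ ((Real.log 2 : ℝ) : EReal))) (not_le.2 h)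
  · intro h
    unfold log2
    rw [EReal.div_eq_inv_mul, ← EReal.coe_inv]
    exact EReal.mul_neg_iff.2 (Or.inl ⟨by exact_mod_cast inv_pos.2 hlog,
      ENNReal.log_lt_zero_iff.2 h⟩)

/-- The moment of a likelihood test for the input `x` under the input `x'`. -/
noncomputable def testMoment (W : X → Measure Y) (ξ : X → Y → ℝ) (x x' : X) : ℝ≥0∞ :=
  ∫⁻ y, ENNReal.ofReal ((2 : ℝ) ^ ((1 / 4 : ℝ) * (ξ x y - ξ x' y))) ∂(W x')

/-- A family of test functions that separates the inputs in `𝒳` from all distant inputs. -/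
structure IsTest (W : X → Measure Y) (𝒳 : Finset X) (ξ : X → Y → ℝ) (C : ℝ) : Prop where
  meas : ∀ x, Measurable (ξ x)
  memLp : ∀ x, MemLp (ξ x) 2 (W x)
  mean : ∀ x, ∫ y, ξ x y ∂(W x) = 0
  var : ∀ x, Var[ξ x; W x] ≤ C
  moment_le_one : ∀ x ∈ 𝒳, ∀ x', testMoment W ξ x x' ≤ 1
  moment_far : ∀ r > 0, ∃ ρ : ℝ, 0 < ρ ∧ ρ < 1 ∧ ∀ x ∈ 𝒳, ∀ x', r ≤ dist x x' →
    testMoment W ξ x x' ≤ ENNReal.ofReal ρ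

/-- Condition (W3) at the single exponent t = 1/4. Its factor −1/t is negative, so positivity of the
product means that the supremum of moments is below 1. At x' = x the moment is 1, and at any other
x' the condition applies with r = dist x x'. -/
lemma exists_isTest [∀ x, IsProbabilityMeasure (W x)] (hW3 : CondW3 W 𝒳) :
    ∃ (ξ : X → Y → ℝ) (C : ℝ), IsTest W 𝒳 ξ C := by
  obtain ⟨ξ, hmeas, hmean, hsep, hvar⟩ := hW3
  have hlt : ∀ r > 0, supMoment W 𝒳 ξ (1 / 4) r < 1 := by
    intro r hr
    have h := hsep r hr (1 / 4) ⟨by norm_num, by norm_num⟩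
    rcases EReal.mul_pos_iff.1 h with h1 | h1
    · have : (-1 / (1 / 4) : ℝ) < 0 := by norm_num
      exact absurd h1.1 (not_lt.2 (by exact_mod_cast this.le))
    · exact log2_neg_iff.1 h1.2
  have hle : ∀ r, ∀ x ∈ 𝒳, ∀ x', r ≤ dist x x' →
      testMoment W ξ x x' ≤ supMoment W 𝒳 ξ (1 / 4) r := fun r x hx x' hr =>
    le_iSup_of_le x (le_iSup_of_le hx (le_iSup_of_le x' (le_iSup_of_le hr le_rfl)))
  refine ⟨ξ, (⨆ x, evariance (ξ x) (W x)).toReal, hmeas, fun x => ?_, fun x => (hmean x).2,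
    fun x => ?_, fun x hx x' => ?_, fun r hr => ?_⟩
  · exact (evariance_lt_top_iff_memLp (hmeas x).aestronglyMeasurable).1
      ((le_iSup (fun x => evariance (ξ x) (W x)) x).trans_lt hvar)
  · exact ENNReal.toReal_mono hvar.ne (le_iSup (fun x => evariance (ξ x) (W x)) x)
  · by_cases hxx : x = x'
    · simp [testMoment, hxx]
    · exact (hle _ x hx x' le_rfl).trans (hlt _ (dist_pos.2 hxx)).le
  · have h1 := hlt r hr
    -- The maximum with 1/2 keeps ρ positive even if the supremum is zero, as real powers of ρ are
    -- taken later.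
    refine ⟨max (supMoment W 𝒳 ξ (1 / 4) r).toReal (1 / 2), by positivity,
      max_lt ?_ (by norm_num), fun x hx x' hxx => (hle r x hx x' hxx).trans ?_⟩
    · rw [← ENNReal.toReal_one]
      exact (ENNReal.toReal_lt_toReal h1.ne_top ENNReal.one_ne_top).2 h1
    · rw [← ENNReal.ofReal_toReal h1.ne_top]
      exact ENNReal.ofReal_le_ofReal (by
        rw [ENNReal.toReal_ofReal ENNReal.toReal_nonneg]; exact le_max_left _ _)

/-- The outputs that pass the test for the codeword `a`. -/
def testSet {n : ℕ} (ξ : X → Y → ℝ) (ε : ℝ) (a : Fin n → X) : Set (Fin n → Y) :=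
  {y | -(ε * n) ≤ ∑ i, ξ (a i) (y i)}

lemma measurableSet_testSet {n : ℕ} (h : IsTest W 𝒳 ξ C) (ε : ℝ) (a : Fin n → X) :
    MeasurableSet (testSet ξ ε a) :=
  measurableSet_le measurable_const
    (Finset.measurable_sum _ fun i _ => (h.meas (a i)).comp (measurable_pi_apply i))

lemma prodChannel_deviation_le [∀ x, IsProbabilityMeasure (W x)] {n : ℕ} (hn : 0 < n)
    (h : IsTest W 𝒳 ξ C) {ε : ℝ} (hε : 0 < ε) (x : Fin n → X) :
    prodChannel W n x {y | ε * n ≤ |∑ i, ξ (x i) (y i)|} ≤ ENNReal.ofReal (C / (ε ^ 2 * n)) := by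
  have := pi_sum_le_sub_le (fun i => W (x i)) (fun i => ξ (x i)) (fun i => h.memLp _) C
    (fun i => h.var _) hε hn
  simp only [h.mean, Finset.sum_const_zero, sub_zero] at this
  exact this

/-- The codeword that was sent passes its test. -/
lemma prodChannel_compl_testSet_le [∀ x, IsProbabilityMeasure (W x)] {n : ℕ} (hn : 0 < n)
    (h : IsTest W 𝒳 ξ C) {ε : ℝ} (hε : 0 < ε) (x : Fin n → X) :
    prodChannel W n x (testSet ξ ε x)ᶜ ≤ ENNReal.ofReal (C / (ε ^ 2 * n)) := by
  refine (measure_mono fun y hy => ?_).trans (prodChannel_deviation_le hn h hε x)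
  simp only [testSet, Set.mem_compl_iff, Set.mem_ofPred_eq, not_le] at hy ⊢
  rw [le_abs]
  right
  linarith

/-- A sequence far from the codeword `a` fails the test for `a`. -/
lemma prodChannel_testSet_le [∀ x, IsProbabilityMeasure (W x)] {n : ℕ} (hn : 0 < n)
    (h : IsTest W 𝒳 ξ C) {ε r ρ κ : ℝ} (hε : 0 < ε) (hρ0 : 0 < ρ) (hρ1 : ρ < 1)
    (hρ : ∀ x ∈ 𝒳, ∀ x', r ≤ dist x x' → testMoment W ξ x x' ≤ ENNReal.ofReal ρ)
    (a : Fin n → X) (ha : ∀ i, a i ∈ 𝒳) (x : Fin n → X)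
    (hfar : κ * n ≤ ((Finset.univ.filter fun i => r ≤ dist (a i) (x i)).card : ℝ)) :
    prodChannel W n x (testSet ξ ε a) ≤ ENNReal.ofReal (C / (ε ^ 2 * n)) +
      ENNReal.ofReal ((2 ^ (ε / 2) * ρ ^ κ) ^ n) := by
  -- If y passes the test for a and the sum of the ξ (x i) is below εn, then the difference of the
  -- two sums exceeds −2εn. With exponent 1/4 this puts y in Z, whose probability Markov's
  -- inequality bounds by a product of `testMoment`s: a factor ρ for each far coordinate and at most
  -- 1 for the others.
  set Z : Set (Fin n → Y) := {y | 1 ≤ ENNReal.ofReal (2 ^ (ε / 2 * n)) *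
    ∏ i, ENNReal.ofReal ((2 : ℝ) ^ ((1 / 4 : ℝ) * (ξ (a i) (y i) - ξ (x i) (y i))))} with hZ
  have hsub : testSet ξ ε a ⊆ {y | ε * n ≤ |∑ i, ξ (x i) (y i)|} ∪ Z := by
    intro y hy
    by_contra hcon
    rw [Set.mem_union, not_or] at hcon
    obtain ⟨h1, h2⟩ := hcon
    apply h2
    simp only [Set.mem_ofPred_eq, not_le, abs_lt] at h1
    simp only [testSet, Set.mem_ofPred_eq] at hy
    rw [hZ, Set.mem_ofPred_eq, ← ENNReal.ofReal_prod_of_nonneg (fun i _ => by positivity),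
      ← ENNReal.ofReal_mul (by positivity), ← ENNReal.ofReal_one]
    refine ENNReal.ofReal_le_ofReal ?_
    rw [← Real.rpow_sum_of_pos two_pos, ← Real.rpow_add two_pos]
    refine Real.one_le_rpow one_le_two ?_
    rw [← Finset.mul_sum, Finset.sum_sub_distrib]
    linarith [h1.2]
  have hmeas : ∀ i, Measurable fun y => ENNReal.ofReal
      ((2 : ℝ) ^ ((1 / 4 : ℝ) * (ξ (a i) y - ξ (x i) y))) := fun i =>
    (((h.meas (a i)).sub (h.meas (x i))).const_mul _).const_pow _ |>.ennreal_ofReal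
  have hmprod : Measurable fun y : Fin n → Y => ∏ i, ENNReal.ofReal
      ((2 : ℝ) ^ ((1 / 4 : ℝ) * (ξ (a i) (y i) - ξ (x i) (y i)))) :=
    Finset.measurable_prod _ fun i _ => (hmeas i).comp (measurable_pi_apply i)
  have hint := lintegral_pi_prod (fun i => W (x i)) (fun i y => ENNReal.ofReal
    ((2 : ℝ) ^ ((1 / 4 : ℝ) * (ξ (a i) y - ξ (x i) y)))) hmeas
  have hZle : prodChannel W n x Z ≤ ENNReal.ofReal ((2 ^ (ε / 2) * ρ ^ κ) ^ n) := by
    have hm := mul_meas_ge_le_lintegral (μ := prodChannel W n x)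
      (hmprod.const_mul (ENNReal.ofReal (2 ^ (ε / 2 * n)))) 1
    rw [one_mul, lintegral_const_mul _ hmprod, prodChannel, hint] at hm
    refine hm.trans ?_
    have hfac : ∏ i, ∫⁻ y, ENNReal.ofReal
        ((2 : ℝ) ^ ((1 / 4 : ℝ) * (ξ (a i) y - ξ (x i) y))) ∂(W (x i)) ≤
        ∏ i, (if r ≤ dist (a i) (x i) then ENNReal.ofReal ρ else 1) := by
      refine Finset.prod_le_prod' fun i _ => ?_
      split_ifs with hi
      · exact hρ _ (ha i) _ hi
      · exact h.moment_le_one _ (ha i) _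
    refine (mul_le_mul_right hfac _).trans ?_
    rw [Finset.prod_ite, Finset.prod_const, Finset.prod_const_one, mul_one,
      ← ENNReal.ofReal_pow hρ0.le, ← ENNReal.ofReal_mul (by positivity)]
    refine ENNReal.ofReal_le_ofReal ?_
    rw [mul_pow, ← Real.rpow_natCast (2 ^ (ε / 2)) n, ← Real.rpow_mul two_pos.le,
      ← Real.rpow_natCast (ρ ^ κ) n, ← Real.rpow_mul hρ0.le]
    gcongr
    rw [← Real.rpow_natCast]
    exact Real.rpow_le_rpow_of_exponent_ge hρ0 hρ1.le hfar
  calc _ ≤ prodChannel W n x ({y | ε * n ≤ |∑ i, ξ (x i) (y i)|} ∪ Z) := measure_mono hsub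
    _ ≤ _ := measure_union_le _ _
    _ ≤ _ := add_le_add (prodChannel_deviation_le hn h hε x) hZle

lemma exists_separation (𝒳 : Finset X) : ∃ r > 0, ∀ a ∈ 𝒳, ∀ b ∈ 𝒳, a ≠ b → 2 * r ≤ dist a b := by
  classical
  rcases (𝒳.offDiag).eq_empty_or_nonempty with h | h
  · refine ⟨1, one_pos, fun a ha b hb hab => ?_⟩
    have : (a, b) ∈ 𝒳.offDiag := Finset.mem_offDiag.2 ⟨ha, hb, hab⟩
    simp [h] at this
  · obtain ⟨z, hz, hmin⟩ := Finset.exists_min_image _ (fun z : X × X => dist z.1 z.2) h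
    have hz' := Finset.mem_offDiag.1 hz
    refine ⟨dist z.1 z.2 / 2, half_pos (dist_pos.2 hz'.2.2), fun a ha b hb hab => ?_⟩
    have := hmin (a, b) (Finset.mem_offDiag.2 ⟨ha, hb, hab⟩)
    simp only at this
    linarith

/-- No sequence is close to two codewords that are far from each other. -/
lemma far_or_far [DecidableEq 𝒳] {n : ℕ} {r κ : ℝ}
    (hr : ∀ a ∈ 𝒳, ∀ b ∈ 𝒳, a ≠ b → 2 * r ≤ dist a b) (a b : Fin n → 𝒳)
    (hab : κ * n ≤ (hammingDist a b : ℝ)) (x : Fin n → X) :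
    κ / 2 * n ≤ ((Finset.univ.filter fun i => r ≤ dist (a i : X) (x i)).card : ℝ) ∨
    κ / 2 * n ≤ ((Finset.univ.filter fun i => r ≤ dist (b i : X) (x i)).card : ℝ) := by
  by_contra! hcon
  have hsub : (Finset.univ.filter fun i => a i ≠ b i) ⊆
      (Finset.univ.filter fun i => r ≤ dist (a i : X) (x i)) ∪
      (Finset.univ.filter fun i => r ≤ dist (b i : X) (x i)) := by
    intro i hi
    simp only [Finset.mem_filter, Finset.mem_univ, true_and, Finset.mem_union] at hi ⊢
    by_contra! hlt
    have h1 := hr _ (a i).2 _ (b i).2 fun h => hi (Subtype.ext h)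
    have h2 := dist_triangle_right (a i : X) (b i) (x i)
    linarith [hlt.1, hlt.2]
  have hcard := (Finset.card_le_card hsub).trans (Finset.card_union_le _ _)
  have : (hammingDist a b : ℝ) ≤
      ((Finset.univ.filter fun i => r ≤ dist (a i : X) (x i)).card : ℝ) +
      ((Finset.univ.filter fun i => r ≤ dist (b i : X) (x i)).card : ℝ) := by
    exact_mod_cast hcard
  linarith [hcon.1, hcon.2]

end Binding

/-! ### The likelihood test -/

section Likelihood

variable {B Ω : Type*} [Fintype B] [MeasurableSpace Ω] {ν : Measure Ω} {v : B → Ω → ℝ}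
  {V : B → Measure Ω} {P : B → ℝ} {t : ℝ}

/-- The outputs at which the likelihood of `b` exceeds the average by a factor `exp t`. -/
def likelySet (v : B → Ω → ℝ) (P : B → ℝ) (t : ℝ) (b : B) : Set Ω :=
  {y | 0 < mixDens v P y ∧ Real.exp t * mixDens v P y ≤ v b y}

lemma measurableSet_likelySet (hv : IsDensity ν v) (P : B → ℝ) (t : ℝ) (b : B) :
    MeasurableSet (likelySet v P t b) :=
  (measurableSet_lt measurable_const (measurable_mixDens hv P)).inter
    (measurableSet_le ((measurable_mixDens hv P).const_mul _) (hv.meas b))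

lemma HasDens.measureReal_eq (h : HasDens ν V v) (a : B) {s : Set Ω} (hs : MeasurableSet s) :
    (V a).real s = ∫ y, v a y * s.indicator 1 y ∂ν := by
  rw [← h.integral_eq_mul, integral_indicator_one hs]

lemma HasDens.integrable_mul_indicator (h : HasDens ν V v) (a : B) {s : Set Ω}
    (hs : MeasurableSet s) : Integrable (fun y => v a y * s.indicator 1 y) ν := by
  have := (h.integrable a).indicator hs
  refine this.congr (ae_of_all _ fun y => ?_)
  by_cases hy : y ∈ s <;> simp [hy]

/-- The sent input is fixed and the candidate is random. At each output, P b * v b y sums to the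
mixture density, so the candidates whose likelihood exceeds it by exp t have total probability at
most exp (−t). -/
lemma sum_mul_measureReal_likelySet_le (h : HasDens ν V v) (hP : P ∈ stdSimplex ℝ B) (a : B) :
    ∑ b, P b * (V a).real (likelySet v P t b) ≤ Real.exp (-t) := by
  have := h.isProb a
  have hm := fun b => measurableSet_likelySet h.toIsDensity P t b
  have hint : ∀ b, Integrable (fun y => P b * (likelySet v P t b).indicator 1 y) (V a) :=
    fun b => ((integrable_const (1 : ℝ)).indicator (hm b)).const_mul _
  calc ∑ b, P b * (V a).real (likelySet v P t b)
      = ∫ y, ∑ b, P b * (likelySet v P t b).indicator 1 y ∂(V a) := by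
        rw [integral_finsetSum _ fun b _ => hint b]
        simp_rw [integral_const_mul, integral_indicator_one (hm _)]
    _ ≤ ∫ _y, Real.exp (-t) ∂(V a) := by
        refine integral_mono (integrable_finsetSum _ fun b _ => hint b) (integrable_const _) ?_
        intro y
        rcases (mixDens_nonneg h.toIsDensity hP y).eq_or_lt with h0 | h0
        · have : ∀ b, (likelySet v P t b).indicator (1 : Ω → ℝ) y = 0 := fun b =>
            Set.indicator_of_notMem (fun hb => hb.1.ne h0) _
          simp [this, Real.exp_nonneg]
        · have h1 : ∑ b, P b * (likelySet v P t b).indicator 1 y *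
              (Real.exp t * mixDens v P y) ≤ mixDens v P y := by
            refine Finset.sum_le_sum fun b _ => ?_
            rw [mul_assoc]
            refine mul_le_mul_of_nonneg_left ?_ (hP.1 b)
            by_cases hb : y ∈ likelySet v P t b
            · simpa [hb] using hb.2
            · simpa [hb] using h.nonneg b y
          rw [← Finset.sum_mul] at h1
          have h2 : 0 < Real.exp t * mixDens v P y := by positivity
          have h3 := (le_div_iff₀ h2).2 h1
          refine h3.trans (le_of_eq ?_)
          rw [Real.exp_neg]
          field_simp
    _ = _ := by simp

/-- The candidate is fixed and the sent input is random: on the likely set of a the mixture density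
is at most exp (−t) times v a. Both versions are needed because a newly selected codeword conflicts
with the old ones as sender and as false candidate. -/
lemma sum_mul_measureReal_likelySet_le' (h : HasDens ν V v) (a : B) :
    ∑ b, P b * (V b).real (likelySet v P t a) ≤ Real.exp (-t) := by
  have hm := measurableSet_likelySet h.toIsDensity P t a
  have hint : ∀ b, Integrable (fun y => P b * (v b y * (likelySet v P t a).indicator 1 y)) ν :=
    fun b => (h.integrable_mul_indicator b hm).const_mul _
  calc ∑ b, P b * (V b).real (likelySet v P t a)
      = ∫ y, ∑ b, P b * (v b y * (likelySet v P t a).indicator 1 y) ∂ν := by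
        rw [integral_finsetSum _ fun b _ => hint b]
        simp_rw [integral_const_mul, h.measureReal_eq _ hm]
    _ ≤ ∫ y, Real.exp (-t) * v a y ∂ν := by
        refine integral_mono (integrable_finsetSum _ fun b _ => hint b)
          ((h.integrable a).const_mul _) ?_
        intro y
        by_cases hy : y ∈ likelySet v P t a
        · simp only [Set.indicator_of_mem hy, Pi.one_apply, mul_one]
          have := mul_le_mul_of_nonneg_left hy.2 (Real.exp_nonneg (-t))
          rwa [← mul_assoc, ← Real.exp_add, neg_add_cancel, Real.exp_zero, one_mul] at this
        · simpa [hy] using mul_nonneg (Real.exp_nonneg (-t)) (h.nonneg a y)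
    _ = _ := by rw [integral_const_mul, h.integral_eq, mul_one]

end Likelihood

/-! ### The likelihood test for product input laws -/

section LikelihoodProd

variable {A Y : Type*} [Fintype A] [MeasurableSpace Y] {μ : Measure Y} {v : A → Y → ℝ}
  {V : A → Measure Y}

lemma mixDens_nDens_prodW {n : ℕ} (p : Fin n → A → ℝ) (y : Fin n → Y) :
    mixDens (nDens v n) (prodW p) y = ∏ i, mixDens v (p i) (y i) := by
  have := sum_prod_pi (fun i a => p i a * v a (y i))
  simp only [mixDens]
  rw [← this]
  refine Finset.sum_congr rfl fun x _ => ?_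
  rw [prodW, prodW, nDens, ← Finset.prod_mul_distrib]

/-- The true input passes the likelihood test. -/
lemma pi_compl_likelySet_le (h : HasDens μ V v) {n : ℕ} (hn : 0 < n) {p : Fin n → A → ℝ}
    (hp : ∀ i, p i ∈ stdSimplex ℝ A) {a : Fin n → A} (ha : 0 < prodW p a) {C : ℝ}
    (hC : ∀ i, Var[fun y => Real.log (v (a i) y / mixDens v (p i) y); V (a i)] ≤ C)
    {t η : ℝ} (hη : 0 < η)
    (ht : t + η * n ≤ ∑ i, ∫ y, Real.log (v (a i) y / mixDens v (p i) y) ∂(V (a i))) :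
    Measure.pi (fun i => V (a i)) (likelySet (nDens v n) (prodW p) t a)ᶜ ≤
      ENNReal.ofReal (C / (η ^ 2 * n)) := by
  have := fun i => h.isProb (a i)
  have hpa : ∀ i, p i (a i) ≠ 0 := fun i h0 =>
    ha.ne' (Finset.prod_eq_zero (Finset.mem_univ i) h0)
  have hmem : ∀ i, MemLp (fun y => Real.log (v (a i) y / mixDens v (p i) y)) 2 (V (a i)) := by
    intro i
    refine (memLp_two_iff_integrable_sq (Real.measurable_log.comp
      ((h.meas _).div (measurable_mixDens h.toIsDensity _))).aestronglyMeasurable).2 ?_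
    exact (h.integrable_iff _ _).2 (integrable_sq_log_ratio h.toIsDensity (hp i) (hpa i))
  refine le_trans ?_ (pi_sum_le_sub_le (fun i => V (a i))
    (fun i y => Real.log (v (a i) y / mixDens v (p i) y)) hmem C hC hη hn)
  have hpos : ∀ᵐ y ∂(Measure.pi fun i => V (a i)), ∀ i, 0 < v (a i) (y i) := by
    rw [ae_all_iff]
    intro i
    exact (Measure.quasiMeasurePreserving_eval (fun i => V (a i)) i).ae (h.ae_pos (a i))
  refine measure_mono_ae ?_
  filter_upwards [hpos] with y hy hyT
  change _ ≤ _
  by_contra! hlt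
  apply hyT
  have hm : ∀ i, 0 < mixDens v (p i) (y i) := fun i =>
    (mul_pos (((hp i).1 _).lt_of_ne' (hpa i)) (hy i)).trans_le
      (mul_le_mixDens h.toIsDensity (hp i) (y i) (a i))
  have hM : 0 < mixDens (nDens v n) (prodW p) y := by
    rw [mixDens_nDens_prodW]
    exact Finset.prod_pos fun i _ => hm i
  refine ⟨hM, ?_⟩
  rw [← le_div_iff₀ hM, mixDens_nDens_prodW, nDens, ← Finset.prod_div_distrib,
    ← Real.le_log_iff_exp_le (Finset.prod_pos fun i _ => div_pos (hy i) (hm i)),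
    Real.log_prod fun i _ => (div_pos (hy i) (hm i)).ne']
  have := (abs_lt.1 hlt).1
  linarith

end LikelihoodProd

/-! ### Deterministic codes with threshold decoders -/

section Threshold

variable {X Y : Type*} [MeasurableSpace Y] {𝒳 : Finset X} {n M : ℕ}

open Classical in
/-- The messages `m` whose decoding set `G m` contains `y`. -/
noncomputable def candidates (G : Fin M → Set (Fin n → Y)) (y : Fin n → Y) : Finset (Fin M) :=
  Finset.univ.filter fun m => y ∈ G m

lemma mem_candidates {G : Fin M → Set (Fin n → Y)} {y : Fin n → Y} {m : Fin M} :
    m ∈ candidates G y ↔ y ∈ G m := by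
  simp [candidates]

lemma card_candidates (G : Fin M → Set (Fin n → Y)) (y : Fin n → Y) :
    ((candidates G y).card : ℝ) = ∑ m, (G m).indicator 1 y := by
  classical
  simp [candidates, Set.indicator_apply]

open Classical in
/-- The code that encodes `m` as `x m` and lists the candidates if there are at most `L`. -/
noncomputable def thresholdCode (x : Fin M → Fin n → 𝒳) (G : Fin M → Set (Fin n → Y))
    (hG : ∀ m, MeasurableSet (G m)) {L : ℕ} (hL : 0 < L) (hLM : L < M) : ListCode 𝒳 Y n where
  M := M
  L := L
  L_pos := hL
  L_lt_M := hLM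
  enc m := Pi.single (x m) 1
  enc_mem m := single_mem_stdSimplex ℝ (x m)
  dec y := if (candidates G y).card ≤ L then candidates G y else ∅
  measurableSet_dec m := by
    have hmeas : Measurable fun y => ((candidates G y).card : ℝ) := by
      simp_rw [card_candidates]
      exact Finset.measurable_sum _ fun m _ => measurable_one.indicator (hG m)
    have : {y | m ∈ if (candidates G y).card ≤ L then candidates G y else ∅} =
        G m ∩ {y | ((candidates G y).card : ℝ) ≤ L} := by
      ext y
      by_cases h : (candidates G y).card ≤ L <;> simp [h, mem_candidates]
    rw [this]
    exact (hG m).inter (measurableSet_le hmeas measurable_const)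
  card_dec_le y := by
    split_ifs with h
    · exact h
    · simp

lemma isDeterministic_thresholdCode (x : Fin M → Fin n → 𝒳) (G : Fin M → Set (Fin n → Y))
    (hG : ∀ m, MeasurableSet (G m)) {L : ℕ} (hL : 0 < L) (hLM : L < M) :
    (thresholdCode x G hG hL hLM).IsDeterministic := fun m => ⟨x m, by simp [thresholdCode]⟩

lemma mem_of_mem_dec_thresholdCode {x : Fin M → Fin n → 𝒳} {G : Fin M → Set (Fin n → Y)}
    {hG : ∀ m, MeasurableSet (G m)} {L : ℕ} {hL : 0 < L} {hLM : L < M} {m : Fin M}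
    {y : Fin n → Y} (hy : m ∈ (thresholdCode x G hG hL hLM).dec y) : y ∈ G m := by
  have hy' : m ∈ if (candidates G y).card ≤ L then candidates G y else ∅ := hy
  split_ifs at hy' with h
  · exact mem_candidates.1 hy'
  · simp at hy'

lemma ListCode.out_eq (c : ListCode 𝒳 Y n) (W : X → Measure Y) {m : Fin c.M} {x : Fin n → 𝒳}
    (hx : c.enc m x = 1) : c.out W m = prodChannel W n fun i => (x i : X) := by
  classical
  have h0 : ∀ z ≠ x, c.enc m z = 0 := by
    intro z hz
    have h1 := (c.enc_mem m).2
    have h2 : c.enc m x + c.enc m z ≤ ∑ z, c.enc m z := by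
      rw [← Finset.sum_pair hz.symm]
      exact Finset.sum_le_sum_of_subset_of_nonneg (Finset.subset_univ _)
        fun b _ _ => (c.enc_mem m).1 b
    have := (c.enc_mem m).1 z
    linarith
  rw [ListCode.out, mixture, Finset.sum_eq_single x]
  · simp [hx]
  · intro z _ hz
    simp [h0 z hz]
  · simp

/-- The list misses the message only if a test fails or too many other messages pass. -/
lemma measure_not_mem_dec_le (W : X → Measure Y) [∀ x, IsProbabilityMeasure (W x)]
    (x : Fin M → Fin n → 𝒳) (G T : Fin M → Set (Fin n → Y))
    (hG : ∀ m, MeasurableSet (G m)) (hT : ∀ m, MeasurableSet (T m)) (hGT : ∀ m, G m ⊆ T m)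
    {L : ℕ} (hL : 0 < L) (hLM : L < M) (m : Fin M) (z : Fin n → X) {δ : ℝ}
    (hδ : ∑ j, (if m = j then 0 else (prodChannel W n z).real (T j)) ≤ δ * L) :
    prodChannel W n z {y | m ∉ (thresholdCode x G hG hL hLM).dec y} ≤
      prodChannel W n z (G m)ᶜ + ENNReal.ofReal δ := by
  classical
  have hprob : IsProbabilityMeasure (prodChannel W n z) := by unfold prodChannel; infer_instance
  have hL' : (0 : ℝ) < L := by exact_mod_cast hL
  set F : (Fin n → Y) → ℝ := fun y => ∑ j, (if m = j then 0 else (T j).indicator 1 y) with hF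
  have hFint : ∀ j, Integrable (fun y => if m = j then (0 : ℝ) else (T j).indicator 1 y)
      (prodChannel W n z) := fun j => by
    split_ifs
    · exact integrable_zero _ _ _
    · exact (integrable_const (1 : ℝ)).indicator (hT j)
  have hsub : {y | m ∉ (thresholdCode x G hG hL hLM).dec y} ⊆ (G m)ᶜ ∪ {y | (L : ℝ) ≤ F y} := by
    intro y hy
    by_contra hcon
    rw [Set.mem_union, not_or, Set.notMem_compl_iff] at hcon
    obtain ⟨h1, h2⟩ := hcon
    simp only [Set.mem_ofPred_eq, not_le] at h2
    apply hy
    have hcard : ((candidates G y).card : ℝ) ≤ 1 + F y := by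
      rw [card_candidates, hF]
      have : (1 : ℝ) = ∑ j, (if m = j then 1 else 0) := by simp
      rw [this, ← Finset.sum_add_distrib]
      refine Finset.sum_le_sum fun j _ => ?_
      split_ifs
      · simp only [add_zero]
        exact Set.indicator_le_self' (fun _ _ => zero_le_one) y
      · rw [zero_add]
        exact Set.indicator_le_indicator_of_subset (hGT j) (fun _ => zero_le_one) y
    -- The true message accounts for the extra 1: fewer than L false candidates leave room for it in
    -- a list of size L.
    have hlt : (candidates G y).card < 1 + L := by
      exact_mod_cast (show ((candidates G y).card : ℝ) < 1 + L by linarith)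
    have hle : (candidates G y).card ≤ L := by omega
    change m ∈ if (candidates G y).card ≤ L then candidates G y else ∅
    rw [if_pos hle]
    exact mem_candidates.2 h1
  refine (measure_mono hsub).trans ((measure_union_le _ _).trans (add_le_add le_rfl ?_))
  have hmarkov := mul_meas_ge_le_integral_of_nonneg (μ := prodChannel W n z) (f := F)
    (ae_of_all _ fun y => Finset.sum_nonneg fun j _ => by
      split_ifs
      · exact le_rfl
      · exact Set.indicator_nonneg (fun _ _ => zero_le_one) y)
    (integrable_finsetSum _ fun j _ => hFint j) L
  have hFeq : ∫ y, F y ∂(prodChannel W n z) =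
      ∑ j, (if m = j then 0 else (prodChannel W n z).real (T j)) := by
    rw [hF, integral_finsetSum _ fun j _ => hFint j]
    refine Finset.sum_congr rfl fun j _ => ?_
    split_ifs
    · simp
    · exact integral_indicator_one (hT j)
  rw [hFeq] at hmarkov
  have : (prodChannel W n z).real {y | (L : ℝ) ≤ F y} ≤ δ := by
    have := hmarkov.trans hδ
    rw [mul_comm] at this
    exact le_of_mul_le_mul_right this hL'
  rw [← ENNReal.ofReal_toReal (measure_ne_top (prodChannel W n z) {y | (L : ℝ) ≤ F y})]
  exact ENNReal.ofReal_le_ofReal this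

end Threshold

/-! ### Existence of codes of a given block length -/

section OneBlock

variable {X Y : Type*} [MetricSpace X] [MeasurableSpace Y] {μ : Measure Y} [SigmaFinite μ]
  {W : X → Measure Y} [∀ x, IsProbabilityMeasure (W x)] {𝒳 : Finset X} {v : 𝒳 → Y → ℝ}
  {ξ : X → Y → ℝ} {C : ℝ}

/-- Bounds the mean of two kinds of conflict. The first is controlled on average; the second is a
count of sequences, which becomes a weight through the pointwise bound h on S. -/
lemma sum_indicator_mul_le {B : Type*} [Fintype B] {w g₁ g₂ : B → ℝ} (hw : ∀ b, 0 ≤ w b)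
    (hg₁ : ∀ b, 0 ≤ g₁ b) (hg₂ : ∀ b, 0 ≤ g₂ b) {S : Set B} {β₁ β₂ h : ℝ}
    (h1 : ∑ b, w b * g₁ b ≤ β₁) (hS : ∀ b ∈ S, w b ≤ h) (hh : 0 ≤ h) (h2 : ∑ b, g₂ b ≤ β₂)
    {l : ℝ} (hl : 0 < l) :
    ∑ b, S.indicator (fun b => w b * (g₁ b / l + g₂ b)) b ≤ β₁ / l + β₂ * h := by
  calc ∑ b, S.indicator (fun b => w b * (g₁ b / l + g₂ b)) b
      ≤ ∑ b, (w b * g₁ b / l + g₂ b * h) := by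
        refine Finset.sum_le_sum fun b _ => ?_
        have h3 : 0 ≤ w b * g₁ b / l := div_nonneg (mul_nonneg (hw b) (hg₁ b)) hl.le
        by_cases hb : b ∈ S
        · rw [Set.indicator_of_mem hb, mul_add, mul_div_assoc, mul_comm (w b) (g₂ b)]
          gcongr
          · exact hg₂ b
          · exact hS b hb
        · rw [Set.indicator_of_notMem hb]
          have := mul_nonneg (hg₂ b) hh
          linarith
    _ = (∑ b, w b * g₁ b) / l + (∑ b, g₂ b) * h := by
        rw [Finset.sum_add_distrib, Finset.sum_div, Finset.sum_mul]
    _ ≤ _ := by gcongr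

/-- The conflict of a with b is the probability that b is a false candidate under a, divided by L,
plus 1 if b lies in the Hamming ball about a. A row sum of at most δ < 1 then controls the expected
number of false candidates, by δL, and excludes pairs of close codewords. Decoding sets combine the
likelihood test, which limits the list, with the test from (W3), which gives binding. -/
lemma exists_listCode (h : HasDens μ (honest W 𝒳) v) (hξ : IsTest W 𝒳 ξ C) {n : ℕ} (hn : 0 < n)
    {p : Fin n → 𝒳 → ℝ} (hp : ∀ i, p i ∈ stdSimplex ℝ 𝒳) {S : Set (Fin n → 𝒳)}
    (hS : 1 / 2 ≤ wt (prodW p) S) {t η h₀ C₁ : ℝ} (hη : 0 < η)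
    (hC₁ : ∀ i a, p i a ≠ 0 →
      Var[fun y => Real.log (v a y / mixDens v (p i) y); W a] ≤ C₁)
    (hS₁ : ∀ a ∈ S, 0 < prodW p a →
      t + η * n ≤ ∑ i, ∫ y, Real.log (v (a i) y / mixDens v (p i) y) ∂(W (a i)))
    (hS₂ : ∀ a ∈ S, prodW p a ≤ Real.exp (-h₀))
    {r ρ κ s ε : ℝ} (hr : ∀ a ∈ 𝒳, ∀ b ∈ 𝒳, a ≠ b → 2 * r ≤ dist a b)
    (hρ0 : 0 < ρ) (hρ1 : ρ < 1)
    (hρ : ∀ x ∈ 𝒳, ∀ x', r ≤ dist x x' → testMoment W ξ x x' ≤ ENNReal.ofReal ρ)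
    (hs0 : 0 < s) (hs1 : s ≤ 1) (hε : 0 < ε) {M L : ℕ} (hL : 0 < L) (hLM : L < M) {δ : ℝ}
    (hδ : 8 * (Real.exp (-t) / L +
      (s ^ (-κ) * (1 + Fintype.card 𝒳 * s)) ^ n * Real.exp (-h₀)) * M ≤ δ) (hδ1 : δ < 1) :
    ∃ c : ListCode 𝒳 Y n, c.M = M ∧ c.L = L ∧ c.IsDeterministic ∧
      (∀ m, ∃ x ∈ S, 0 < prodW p x ∧ c.enc m x = 1) ∧
      c.errA W ≤ ENNReal.ofReal (C₁ / (η ^ 2 * n)) + ENNReal.ofReal (C / (ε ^ 2 * n)) +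
        ENNReal.ofReal δ ∧
      c.bindD W ≤ ENNReal.ofReal (C / (ε ^ 2 * n)) +
        ENNReal.ofReal ((2 ^ (ε / 2) * ρ ^ (κ / 2)) ^ n) := by
  classical
  have hL' : (0 : ℝ) < L := by exact_mod_cast hL
  have hN := hasDens_pi h n
  have hP := prodW_mem hp
  set V : (Fin n → 𝒳) → Measure (Fin n → Y) := fun a => prodChannel W n fun i => (a i : X)
    with hV
  have hN' : HasDens (Measure.pi fun _ : Fin n => μ) V (nDens v n) := hN
  set T := likelySet (nDens v n) (prodW p) t with hT
  set D : (Fin n → 𝒳) → (Fin n → 𝒳) → ℝ := fun a b =>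
    ({b | (hammingDist a b : ℝ) < κ * n} : Set _).indicator (fun _ => (1 : ℝ)) b with hD
  have hD0 : ∀ a b, 0 ≤ D a b := fun a b => Set.indicator_nonneg (fun _ _ => zero_le_one) b
  have hDsum : ∀ a, ∑ b, D a b ≤ (s ^ (-κ) * (1 + Fintype.card 𝒳 * s)) ^ n := fun a =>
    card_hammingBall_le a hs0 hs1
  have hDcomm : ∀ a b, D b a = D a b := fun a b => by
    simp only [hD, Set.indicator_apply, Set.mem_ofPred_eq, hammingDist_comm]
  have hf0 : ∀ a b, 0 ≤ (V a).real (T b) / L + D a b := fun a b =>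
    add_nonneg (div_nonneg measureReal_nonneg hL'.le) (hD0 a b)
  have hβ : 0 < Real.exp (-t) / L +
      (s ^ (-κ) * (1 + Fintype.card 𝒳 * s)) ^ n * Real.exp (-h₀) := by positivity
  obtain ⟨x, hx, hsum⟩ := exists_expurgated hP.1 hS hf0 hβ
    (fun a _ => sum_indicator_mul_le hP.1 (fun _ => measureReal_nonneg) (hD0 a)
      (sum_mul_measureReal_likelySet_le hN' hP a) hS₂ (Real.exp_nonneg _) (hDsum a) hL')
    (fun a _ => sum_indicator_mul_le hP.1 (fun _ => measureReal_nonneg) (fun b => hD0 b a)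
      (sum_mul_measureReal_likelySet_le' hN' a) hS₂ (Real.exp_nonneg _)
      ((Finset.sum_congr rfl fun b _ => hDcomm a b).trans_le (hDsum a)) hL')
    (hL.trans hLM)
  have hTm : ∀ m, MeasurableSet (T (x m)) := fun m => measurableSet_likelySet hN'.toIsDensity _ _ _
  have hXm : ∀ m, MeasurableSet (testSet ξ ε fun i => (x m i : X)) := fun m =>
    measurableSet_testSet hξ ε _
  refine ⟨thresholdCode x (fun m => T (x m) ∩ testSet ξ ε fun i => (x m i : X))
    (fun m => (hTm m).inter (hXm m)) hL hLM, rfl, rfl, isDeterministic_thresholdCode _ _ _ _ _,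
    fun m => ⟨x m, (hx m).1, (hx m).2, by simp [thresholdCode]⟩, ?_, ?_⟩
  · refine iSup_le fun m => ?_
    rw [ListCode.out_eq _ W (x := x m) (by simp [thresholdCode])]
    refine (measure_not_mem_dec_le W x _ (fun m => T (x m)) _ hTm
      (fun m => Set.inter_subset_left) hL hLM m _ (δ := δ) ?_).trans
      (add_le_add ?_ le_rfl)
    · have h1 := (hsum m).trans hδ
      rw [← div_le_iff₀ hL', Finset.sum_div]
      refine le_trans (Finset.sum_le_sum fun j _ => ?_) h1
      split_ifs
      · simp
      · exact le_add_of_nonneg_right (hD0 _ _)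
    · rw [Set.compl_inter]
      refine (measure_union_le _ _).trans (add_le_add ?_
        (prodChannel_compl_testSet_le hn hξ hε _))
      have hpa : ∀ i, p i (x m i) ≠ 0 := fun i h0 =>
        (hx m).2.ne' (Finset.prod_eq_zero (Finset.mem_univ i) h0)
      exact pi_compl_likelySet_le h hn hp (hx m).2 (fun i => hC₁ i _ (hpa i)) hη
        (hS₁ _ (hx m).1 (hx m).2)
  · refine iSup_le fun z => iSup_le fun (m : Fin M) =>
      iSup_le fun (m' : Fin M) => iSup_le fun hmm => ?_
    have hmem : ∀ m : Fin M, {y | m ∈ (thresholdCode x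
        (fun m => T (x m) ∩ testSet ξ ε fun i => (x m i : X))
        (fun m => (hTm m).inter (hXm m)) hL hLM).dec y} ⊆ testSet ξ ε fun i => (x m i : X) :=
      fun m y hy => (mem_of_mem_dec_thresholdCode hy).2
    -- A pair within the ball would contribute a full 1 to a row sum that is below 1.
    have hdist : κ * n ≤ (hammingDist (x m) (x m') : ℝ) := by
      by_contra! hlt
      have h1 := ((hsum m).trans hδ).trans_lt hδ1
      have h2 : (1 : ℝ) ≤ ∑ j, (if m = j then 0 else (V (x m)).real (T (x j)) / L +
          D (x m) (x j)) := by
        refine le_trans ?_ (Finset.single_le_sum (fun j _ => ?_) (Finset.mem_univ m'))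
        · have hmm' : ¬(m = m') := hmm
          rw [if_neg hmm']
          have : D (x m) (x m') = 1 := by simp [hD, hlt]
          rw [this]
          exact le_add_of_nonneg_left (div_nonneg measureReal_nonneg hL'.le)
        · split_ifs
          · exact le_rfl
          · exact hf0 _ _
      linarith
    rcases far_or_far hr (x m) (x m') hdist z with hfar | hfar
    · exact (min_le_left _ _).trans ((measure_mono (hmem m)).trans
        (prodChannel_testSet_le hn hξ hε hρ0 hρ1 hρ _ (fun i => (x m i).2) z hfar))
    · exact (min_le_right _ _).trans ((measure_mono (hmem m')).trans
        (prodChannel_testSet_le hn hξ hε hρ0 hρ1 hρ _ (fun i => (x m' i).2) z hfar))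

end OneBlock

/-! ### Existence of sequences of codes -/

/-- The regions ask for a code at every block length; at the finitely many exceptional ones any code
with property D is used. -/
lemma exists_seq_of_eventually {β : ℕ → Type*} {D Q : ∀ n, β n → Prop} (h : ∀ n, ∃ c, D n c)
    (h' : ∀ᶠ n in atTop, ∃ c, D n c ∧ Q n c) :
    ∃ c : ∀ n, β n, (∀ n, D n (c n)) ∧ ∀ᶠ n in atTop, Q n (c n) := by
  have hall : ∀ n, ∃ c, D n c ∧ ((∃ c, D n c ∧ Q n c) → Q n c) := by
    intro n
    by_cases hc : ∃ c, D n c ∧ Q n c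
    · obtain ⟨c, h1, h2⟩ := hc
      exact ⟨c, h1, fun _ => h2⟩
    · obtain ⟨c, h1⟩ := h n
      exact ⟨c, h1, fun h => absurd h hc⟩
  choose c hD hQ using hall
  exact ⟨c, hD, h'.mono hQ⟩

lemma ceil_two_rpow_le {R : ℝ} (hR : 0 ≤ R) (n : ℕ) :
    (⌈(2 : ℝ) ^ (n * R)⌉₊ : ℝ) ≤ 2 * 2 ^ (n * R) := by
  have h1 : (1 : ℝ) ≤ 2 ^ (n * R) := Real.one_le_rpow one_le_two (by positivity)
  have := (Nat.ceil_lt_add_one (zero_le_one.trans h1)).le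
  linarith

lemma tendsto_logb_ceil {R : ℝ} (hR : 0 ≤ R) :
    Tendsto (fun n : ℕ => (1 / n : ℝ) * Real.logb 2 ⌈(2 : ℝ) ^ (n * R)⌉₊) atTop (𝓝 R) := by
  have h1 : Tendsto (fun n : ℕ => R + 1 / (n : ℝ)) atTop (𝓝 R) := by
    simpa using (tendsto_const_nhds (x := R)).add (tendsto_one_div_atTop_nhds_zero_nat (𝕜 := ℝ))
  refine tendsto_of_tendsto_of_tendsto_of_le_of_le' tendsto_const_nhds h1 ?_ ?_
  all_goals
    filter_upwards [eventually_gt_atTop 0] with n hn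
    have hn' : (0 : ℝ) < n := by exact_mod_cast hn
    have hpos : (0 : ℝ) < 2 ^ (n * R) := by positivity
    have hle : (2 : ℝ) ^ (n * R) ≤ ⌈(2 : ℝ) ^ (n * R)⌉₊ := Nat.le_ceil _
  · rw [one_div, ← div_eq_inv_mul, le_div_iff₀ hn', Real.le_logb_iff_rpow_le one_lt_two
      (hpos.trans_le hle), mul_comm]
    exact hle
  · have h2 : Real.logb 2 ⌈(2 : ℝ) ^ (n * R)⌉₊ ≤ 1 + n * R := by
      rw [Real.logb_le_iff_le_rpow one_lt_two (hpos.trans_le hle), Real.rpow_add two_pos,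
        Real.rpow_one]
      exact ceil_two_rpow_le hR n
    calc (1 / n : ℝ) * Real.logb 2 ⌈(2 : ℝ) ^ (n * R)⌉₊ ≤ (1 / n : ℝ) * (1 + n * R) := by gcongr
      _ = _ := by field_simp; ring

lemma eventually_ceil_lt_ceil {R₁ R₂ : ℝ} (h2 : 0 ≤ R₂) (h : R₂ < R₁) :
    ∀ᶠ n : ℕ in atTop, ⌈(2 : ℝ) ^ (n * R₂)⌉₊ < ⌈(2 : ℝ) ^ (n * R₁)⌉₊ := by
  filter_upwards [eventually_ge_atTop ⌈1 / (R₁ - R₂)⌉₊] with n hn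
  have h0 : 0 < R₁ - R₂ := sub_pos.2 h
  have h1 : 1 ≤ n * (R₁ - R₂) := by
    rw [← div_le_iff₀ h0]
    exact Nat.ceil_le.1 hn
  have h3 : (1 : ℝ) ≤ 2 ^ (n * R₂) := Real.one_le_rpow one_le_two (by positivity)
  have h4 : (2 : ℝ) * 2 ^ (n * R₂) ≤ 2 ^ (n * R₁) := by
    rw [← Real.rpow_one_add' two_pos.le (by positivity)]
    exact Real.rpow_le_rpow_of_exponent_le one_le_two (by linarith)
  have h5 := Nat.ceil_lt_add_one (zero_le_one.trans h3)
  have h6 := Nat.le_ceil ((2 : ℝ) ^ (n * R₁))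
  exact_mod_cast (show (⌈(2 : ℝ) ^ (n * R₂)⌉₊ : ℝ) < ⌈(2 : ℝ) ^ (n * R₁)⌉₊ by linarith)

/-- Small Hamming balls have small exponential growth. -/
lemma exists_ball_growth_le (N : ℕ) {η : ℝ} (hη : 0 < η) :
    ∃ s κ : ℝ, 0 < s ∧ s ≤ 1 ∧ 0 < κ ∧ s ^ (-κ) * (1 + N * s) ≤ Real.exp η := by
  set s : ℝ := min 1 (η / (2 * (N + 1))) with hs
  have hs0 : 0 < s := lt_min one_pos (by positivity)
  have hs1 : s ≤ 1 := min_le_left _ _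
  have hlog : Real.log s ≤ 0 := Real.log_nonpos hs0.le hs1
  -- Chosen so that −κ log s ≤ η/2; the 1 in the denominator keeps it positive when s = 1.
  refine ⟨s, η / (2 * (1 - Real.log s)), hs0, hs1, by apply div_pos hη; linarith, ?_⟩
  have h1 : 1 + N * s ≤ Real.exp (η / 2) := by
    have h2 : N * s ≤ η / 2 := by
      have : s ≤ η / (2 * (N + 1)) := min_le_right _ _
      rw [le_div_iff₀ (by positivity)] at this
      nlinarith
    have := Real.add_one_le_exp (η / 2)
    linarith
  have h2 : s ^ (-(η / (2 * (1 - Real.log s)))) ≤ Real.exp (η / 2) := by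
    rw [Real.rpow_def_of_pos hs0]
    refine Real.exp_le_exp.2 ?_
    have : 0 < 1 - Real.log s := by linarith
    rw [mul_neg, ← neg_mul, mul_div_assoc', div_le_div_iff₀ (by positivity) two_pos]
    nlinarith
  calc _ ≤ Real.exp (η / 2) * Real.exp (η / 2) := by gcongr
    _ = Real.exp η := by rw [← Real.exp_add, add_halves]

lemma exists_two_rpow_mul_lt_one {ρ κ : ℝ} (hρ0 : 0 < ρ) (hρ1 : ρ < 1) (hκ : 0 < κ) :
    ∃ ε : ℝ, 0 < ε ∧ (2 : ℝ) ^ (ε / 2) * ρ ^ κ < 1 := by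
  have hlog := Real.log_neg hρ0 hρ1
  have h2 := Real.log_pos one_lt_two
  -- The slack of the test is tuned so that the product equals ρ^(κ/2).
  refine ⟨-(κ * Real.log ρ) / Real.log 2, div_pos (by nlinarith) h2, ?_⟩
  rw [Real.rpow_def_of_pos two_pos, Real.rpow_def_of_pos hρ0, ← Real.exp_add]
  refine Real.exp_zero ▸ Real.exp_lt_exp.2 ?_
  have : Real.log 2 * (-(κ * Real.log ρ) / Real.log 2 / 2) = -(κ * Real.log ρ) / 2 := by
    field_simp
  rw [this]
  nlinarith

/-- A crude common bound for finitely many variances, free of any nonemptiness assumption. -/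
lemma le_sum_abs {U : Type*} [Fintype U] (g : U → ℝ) (a : U) : g a ≤ ∑ b, |g b| :=
  (le_abs_self _).trans (Finset.single_le_sum (fun b _ => abs_nonneg (g b)) (Finset.mem_univ a))

lemma tendsto_ofReal_div (C : ℝ) {η : ℝ} (hη : 0 < η) :
    Tendsto (fun n : ℕ => ENNReal.ofReal (C / (η ^ 2 * n))) atTop (𝓝 0) := by
  rw [← ENNReal.ofReal_zero]
  refine ENNReal.tendsto_ofReal ?_
  refine Tendsto.div_atTop tendsto_const_nhds ?_
  exact tendsto_natCast_atTop_atTop.const_mul_atTop (by positivity)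

/-- The law of large numbers for a product distribution on a finite alphabet. -/
lemma tendsto_wt_deviation {A U : Type*} [Fintype A] [Fintype U] {q : U → A → ℝ} {u : ℕ → U}
    (hq : ∀ i, q (u i) ∈ stdSimplex ℝ A) (f : U → A → ℝ) {η : ℝ} (hη : 0 < η) :
    Tendsto (fun n : ℕ => wt (prodW fun i : Fin n => q (u i))
      {x | η * n ≤ |∑ i : Fin n, f (u i) (x i) - ∑ i : Fin n, ∑ a, q (u i) a * f (u i) a|})
      atTop (𝓝 0) := by
  set g : U → ℝ := fun u => ∑ a, q u a * (f u a - ∑ b, q u b * f u b) ^ 2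
  have h0 : Tendsto (fun n : ℕ => (∑ b, |g b|) / (η ^ 2 * n)) atTop (𝓝 0) :=
    Tendsto.div_atTop tendsto_const_nhds
      (tendsto_natCast_atTop_atTop.const_mul_atTop (by positivity))
  refine tendsto_of_tendsto_of_tendsto_of_le_of_le' tendsto_const_nhds h0 ?_ ?_
  · refine Eventually.of_forall fun n => Finset.sum_nonneg fun x _ =>
      Set.indicator_nonneg (fun x _ => prodW_nonneg (fun i => hq i) x) x
  · filter_upwards [eventually_gt_atTop 0] with n hn
    exact wt_prodW_le hn (fun i => hq i) (fun i => f (u i)) hη fun i => le_sum_abs g (u i)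

lemma tendsto_wt_deviation_limit {A U : Type*} [Fintype A] [Fintype U] {q : U → A → ℝ}
    {u : ℕ → U} (hq : ∀ i, q (u i) ∈ stdSimplex ℝ A) (f : U → A → ℝ) {J η : ℝ} (hη : 0 < η)
    (hJ : Tendsto (fun n : ℕ => (∑ i : Fin n, ∑ a, q (u i) a * f (u i) a) / n) atTop (𝓝 J)) :
    Tendsto (fun n : ℕ => wt (prodW fun i : Fin n => q (u i))
      {x | η * n ≤ |∑ i : Fin n, f (u i) (x i) - J * n|}) atTop (𝓝 0) := by
  refine tendsto_of_tendsto_of_tendsto_of_le_of_le' tendsto_const_nhds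
    (tendsto_wt_deviation hq f (half_pos hη)) ?_ ?_
  · exact Eventually.of_forall fun n => Finset.sum_nonneg fun x _ =>
      Set.indicator_nonneg (fun x _ => prodW_nonneg (fun i => hq i) x) x
  · filter_upwards [eventually_gt_atTop 0,
      Metric.tendsto_nhds.1 hJ (η / 2) (half_pos hη)] with n hn hJn
    have hn' : (0 : ℝ) < n := by exact_mod_cast hn
    refine wt_mono (fun x => prodW_nonneg (fun i => hq i) x) fun x hx => ?_
    rw [Real.dist_eq, div_sub' hn'.ne', abs_div, abs_of_pos hn', div_lt_iff₀ hn'] at hJn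
    rw [Set.mem_ofPred_eq] at hx ⊢
    have := abs_sub_le (∑ i : Fin n, f (u i) (x i))
      (∑ i : Fin n, ∑ a, q (u i) a * f (u i) a) (J * n)
    rw [mul_comm J] at this hx
    linarith

/-! ### Asymptotic selection and expurgation of codewords -/

section Codes

variable {X Y : Type*} [MetricSpace X] [MeasurableSpace Y] {μ : Measure Y} [SigmaFinite μ]
  {W : X → Measure Y} [∀ x, IsProbabilityMeasure (W x)] {𝒳 : Finset X} {v : 𝒳 → Y → ℝ}

lemma exists_isDeterministic (hX : Nonempty 𝒳) (n : ℕ) :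
    ∃ c : ListCode 𝒳 Y n, c.IsDeterministic := by
  obtain ⟨a⟩ := hX
  exact ⟨_, isDeterministic_thresholdCode (Y := Y) (M := 2) (fun _ _ => a) (fun _ => ∅)
    (fun _ => MeasurableSet.empty) one_pos one_lt_two⟩

/-- The sum of the divergences from the output distributions given the letters of `x`. -/
noncomputable def sumDiv (W : X → Measure Y) (v : 𝒳 → Y → ℝ) {n : ℕ} (p : Fin n → 𝒳 → ℝ)
    (x : Fin n → 𝒳) : ℝ :=
  ∑ i, ∫ y, Real.log (v (x i) y / mixDens v (p i) y) ∂(W (x i))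

variable {U : Type*} [Fintype U] {q : U → 𝒳 → ℝ} {u : ℕ → U}

lemma tendsto_wt_sumDiv (h : HasDens μ (honest W 𝒳) v) (hq : ∀ i, q (u i) ∈ stdSimplex ℝ 𝒳)
    {J η : ℝ} (hη : 0 < η)
    (hJ : Tendsto (fun n : ℕ => (∑ i : Fin n, infoD μ v (q (u i))) / n) atTop (𝓝 J)) :
    Tendsto (fun n : ℕ => wt (prodW fun i : Fin n => q (u i))
      {x | η * n ≤ |sumDiv W v (fun i : Fin n => q (u i)) x - J * n|}) atTop (𝓝 0) := by
  refine tendsto_wt_deviation_limit hq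
    (fun u a => ∫ y, Real.log (v a y / mixDens v (q u) y) ∂(W a)) hη ?_
  simp_rw [infoD_eq_sum_integral h (hq _)] at hJ
  exact hJ

lemma prodW_le_exp_neg {n : ℕ} {p : Fin n → 𝒳 → ℝ} {x : Fin n → 𝒳} {t : ℝ}
    (hp : ∀ i, p i ∈ stdSimplex ℝ 𝒳) (ht : t ≤ ∑ i, -Real.log (p i (x i))) :
    prodW p x ≤ Real.exp (-t) := by
  rcases (prodW_nonneg hp x).eq_or_lt with h0 | h0
  · rw [← h0]
    exact Real.exp_nonneg _
  · rw [← Real.log_le_iff_le_exp h0, prodW, Real.log_prod fun i _ h => h0.ne'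
      (Finset.prod_eq_zero (Finset.mem_univ i) h)]
    rw [Finset.sum_neg_distrib] at ht
    linarith

/-- The code size is below the threshold of the expurgation. -/
lemma expurgation_bound_le {A₁ A₂ J H η b : ℝ} {n M L : ℕ} (hM : (M : ℝ) ≤ 2 * Real.exp (n * A₁))
    (hL : Real.exp (n * A₂) ≤ L) (h1 : A₁ - A₂ + 4 * η ≤ J) (h2 : A₁ + 4 * η ≤ H)
    (hb0 : 0 ≤ b) (hb : b ≤ Real.exp η) :
    8 * (Real.exp (-(n * (J - 3 * η))) / L + b ^ n * Real.exp (-(n * (H - 2 * η)))) * M ≤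
      32 * Real.exp (-(n * η)) := by
  have hn : (0 : ℝ) ≤ n := n.cast_nonneg
  have h3 : Real.exp (-(n * (J - 3 * η))) / L ≤ Real.exp (-(n * (J - 3 * η)) - n * A₂) := by
    rw [Real.exp_sub]
    gcongr
  have h4 : b ^ n * Real.exp (-(n * (H - 2 * η))) ≤ Real.exp (n * η - n * (H - 2 * η)) := by
    rw [Real.exp_sub, Real.exp_neg, ← div_eq_mul_inv, Real.exp_nat_mul η n]
    exact div_le_div_of_nonneg_right (pow_le_pow_left₀ hb0 hb n) (Real.exp_nonneg _)
  have h5 : Real.exp (-(n * (J - 3 * η)) - n * A₂) * Real.exp (n * A₁) ≤ Real.exp (-(n * η)) := by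
    rw [← Real.exp_add, Real.exp_le_exp]
    nlinarith
  have h6 : Real.exp (n * η - n * (H - 2 * η)) * Real.exp (n * A₁) ≤ Real.exp (-(n * η)) := by
    rw [← Real.exp_add, Real.exp_le_exp]
    nlinarith
  -- Each exponent, combined with that of M, is at most −nη thanks to the margin 4η. The constant is
  -- 8 from the expurgation, 2 from rounding M up and 2 from the two kinds of conflict.
  calc _ ≤ 8 * (Real.exp (-(n * (J - 3 * η)) - n * A₂) + Real.exp (n * η - n * (H - 2 * η))) *
        (2 * Real.exp (n * A₁)) := by gcongr
    _ ≤ _ := by linarith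

/-- Codes of rates below the information and the entropy, with codewords in given sets. -/
theorem exists_listCode_seq (h : HasDens μ (honest W 𝒳) v) (hW3 : CondW3 W 𝒳)
    (hq : ∀ i, q (u i) ∈ stdSimplex ℝ 𝒳) {J H : ℝ}
    (hJ : Tendsto (fun n : ℕ => (∑ i : Fin n, infoD μ v (q (u i))) / n) atTop (𝓝 J))
    (hH : Tendsto (fun n : ℕ => (∑ i : Fin n, ent (q (u i))) / n) atTop (𝓝 H))
    {R₁ R₂ : ℝ} (hR₂ : 0 < R₂) (hR : R₂ < R₁) (hRJ : (R₁ - R₂) * Real.log 2 < J)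
    (hRH : R₁ * Real.log 2 < H) {S : ∀ n : ℕ, Set (Fin n → 𝒳)}
    (hS : ∀ᶠ n : ℕ in atTop, 3 / 4 ≤ wt (prodW fun i : Fin n => q (u i)) (S n)) :
    ∃ c : ∀ n, ListCode 𝒳 Y n, (∀ n, (c n).IsDeterministic) ∧ UltimatelySecure W c ∧
      HasRates c R₁ R₂ ∧ ∀ᶠ n in atTop, ∀ m, ∃ x ∈ S n,
        0 < prodW (fun i : Fin n => q (u i)) x ∧ (c n).enc m x = 1 := by
  have hR₁ := hR₂.trans hR
  have hX : Nonempty 𝒳 := by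
    by_contra hne
    rw [not_nonempty_iff] at hne
    simpa using (hq 0).2
  obtain ⟨ξ, C, hξ⟩ := exists_isTest hW3
  obtain ⟨r, hr0, hr⟩ := exists_separation 𝒳
  obtain ⟨ρ, hρ0, hρ1, hρ⟩ := hξ.moment_far r hr0
  -- A quarter of the smaller gap: the margin of 4η covers the typical deviations, the likelihood
  -- threshold, the growth of Hamming balls and a final decay exp (−nη).
  set η : ℝ := min (J - (R₁ - R₂) * Real.log 2) (H - R₁ * Real.log 2) / 4 with hηdef
  have hη : 0 < η := div_pos (lt_min (by linarith) (by linarith)) (by norm_num)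
  have hη1 : R₁ * Real.log 2 - R₂ * Real.log 2 + 4 * η ≤ J := by
    have := min_le_left (J - (R₁ - R₂) * Real.log 2) (H - R₁ * Real.log 2)
    rw [hηdef]
    linarith
  have hη2 : R₁ * Real.log 2 + 4 * η ≤ H := by
    have := min_le_right (J - (R₁ - R₂) * Real.log 2) (H - R₁ * Real.log 2)
    rw [hηdef]
    linarith
  obtain ⟨s, κ, hs0, hs1, hκ, hball⟩ := exists_ball_growth_le (Fintype.card 𝒳) hη
  obtain ⟨ε, hε, hερ⟩ := exists_two_rpow_mul_lt_one hρ0 hρ1 (half_pos hκ)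
  set g : U × 𝒳 → ℝ := fun z =>
    Var[fun y => Real.log (v z.2 y / mixDens v (q z.1) y); W z.2] with hg
  have hδlim : Tendsto (fun n : ℕ => 32 * Real.exp (-(n * η))) atTop (𝓝 0) := by
    have : Tendsto (fun n : ℕ => (n : ℝ) * η) atTop atTop :=
      tendsto_natCast_atTop_atTop.atTop_mul_const hη
    simpa using (Real.tendsto_exp_neg_atTop_nhds_zero.comp this).const_mul 32
  have hlimD := tendsto_wt_sumDiv h hq hη hJ
  have hlimH := tendsto_wt_deviation_limit hq (fun u a => -Real.log (q u a)) (J := H) hη (by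
    refine hH.congr fun n => ?_
    congr 1
    refine Finset.sum_congr rfl fun i _ => Finset.sum_congr rfl fun a _ => ?_
    rw [Real.negMulLog]
    ring)
  have hex : ∀ᶠ n : ℕ in atTop, ∃ c : ListCode 𝒳 Y n, c.IsDeterministic ∧
      c.M = ⌈(2 : ℝ) ^ (n * R₁)⌉₊ ∧ c.L = ⌈(2 : ℝ) ^ (n * R₂)⌉₊ ∧
      (∀ m, ∃ x ∈ S n, 0 < prodW (fun i : Fin n => q (u i)) x ∧ c.enc m x = 1) ∧
      c.errA W ≤ ENNReal.ofReal ((∑ z, |g z|) / (η ^ 2 * n)) +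
        ENNReal.ofReal (C / (ε ^ 2 * n)) + ENNReal.ofReal (32 * Real.exp (-(n * η))) ∧
      c.bindD W ≤ ENNReal.ofReal (C / (ε ^ 2 * n)) +
        ENNReal.ofReal ((2 ^ (ε / 2) * ρ ^ (κ / 2)) ^ n) := by
    filter_upwards [eventually_gt_atTop 0, hS, eventually_ceil_lt_ceil hR₂.le hR,
      hlimD.eventually (eventually_le_nhds (show (0 : ℝ) < 1 / 8 by norm_num)),
      hlimH.eventually (eventually_le_nhds (show (0 : ℝ) < 1 / 8 by norm_num)),
      hδlim.eventually (eventually_lt_nhds (show (0 : ℝ) < 1 by norm_num))]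
      with n hn hSn hLM hDn hHn hδ
    have hn' : (0 : ℝ) < n := by exact_mod_cast hn
    set p : Fin n → 𝒳 → ℝ := fun i => q (u i) with hp
    have hpm : ∀ i, p i ∈ stdSimplex ℝ 𝒳 := fun i => hq i
    set SD := {x : Fin n → 𝒳 | η * n ≤ |sumDiv W v p x - J * n|} with hSD
    set SH := {x : Fin n → 𝒳 | η * n ≤ |∑ i, -Real.log (p i (x i)) - H * n|} with hSH
    -- The given set has weight at least 3/4 and each of the two atypical sets at most 1/8.
    have hwt : 1 / 2 ≤ wt (prodW p) (S n ∩ (SD ∪ SH)ᶜ) := by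
      have h1 : wt (prodW p) (S n) ≤ wt (prodW p) (S n ∩ (SD ∪ SH)ᶜ) + wt (prodW p) (SD ∪ SH) :=
        (wt_mono (prodW_nonneg hpm) fun x hx => by
          by_cases hx' : x ∈ SD ∪ SH
          · exact Or.inr hx'
          · exact Or.inl ⟨hx, hx'⟩).trans (wt_union_le (prodW_nonneg hpm) _ _)
      have h2 := wt_union_le (prodW_nonneg hpm) SD SH
      change wt (prodW p) SD ≤ 1 / 8 at hDn
      change wt (prodW p) SH ≤ 1 / 8 at hHn
      linarith
    have htwo : ∀ R : ℝ, (2 : ℝ) ^ (n * R) = Real.exp (n * (R * Real.log 2)) := fun R => by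
      rw [Real.rpow_def_of_pos two_pos]
      ring_nf
    obtain ⟨c, hcM, hcL, hdet, henc, herr, hbind⟩ := exists_listCode h hξ hn hpm hwt
      (t := n * (J - 3 * η)) (h₀ := n * (H - 2 * η)) hη (C₁ := ∑ z, |g z|)
      (fun i a _ => le_sum_abs g (u i, a))
      (fun a ha _ => by
        have h1 : a ∉ SD := fun h => ha.2 (Or.inl h)
        rw [hSD, Set.mem_ofPred_eq, not_le, abs_lt] at h1
        unfold sumDiv at h1
        nlinarith [h1.1])
      (fun a ha => by
        have h1 : a ∉ SH := fun h => ha.2 (Or.inr h)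
        rw [hSH, Set.mem_ofPred_eq, not_le, abs_lt] at h1
        refine prodW_le_exp_neg hpm ?_
        nlinarith [h1.1])
      hr hρ0 hρ1 hρ hs0 hs1 hε
      (Nat.ceil_pos.2 (Real.rpow_pos_of_pos two_pos _)) hLM (κ := κ)
      (δ := 32 * Real.exp (-(n * η)))
      (expurgation_bound_le (by rw [← htwo]; exact ceil_two_rpow_le hR₁.le n)
        (by rw [← htwo]; exact Nat.le_ceil _) hη1 hη2 (by positivity) hball) hδ
    exact ⟨c, hdet, hcM, hcL, fun m => by
      obtain ⟨x, hx, hx'⟩ := henc m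
      exact ⟨x, hx.1, hx'⟩, herr, hbind⟩
  obtain ⟨c, hdet, hev⟩ := exists_seq_of_eventually (exists_isDeterministic (Y := Y) hX) hex
  refine ⟨c, hdet, ⟨?_, ?_⟩, ⟨?_, ?_⟩, hev.mono fun n hn => hn.2.2.1⟩
  · refine tendsto_of_tendsto_of_tendsto_of_le_of_le' tendsto_const_nhds ?_
      (Eventually.of_forall fun _ => zero_le) (hev.mono fun n hn => hn.2.2.2.1)
    have h1 := ENNReal.tendsto_ofReal hδlim
    rw [ENNReal.ofReal_zero] at h1
    simpa using ((tendsto_ofReal_div _ hη).add (tendsto_ofReal_div C hε)).add h1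
  · refine tendsto_of_tendsto_of_tendsto_of_le_of_le' tendsto_const_nhds ?_
      (Eventually.of_forall fun _ => zero_le) (hev.mono fun n hn => hn.2.2.2.2)
    have h1 := ENNReal.tendsto_ofReal
      (tendsto_pow_atTop_nhds_zero_of_lt_one (by positivity) hερ)
    rw [ENNReal.ofReal_zero] at h1
    simpa using (tendsto_ofReal_div C hε).add h1
  · exact (tendsto_logb_ceil hR₁.le).congr' (hev.mono fun n hn => by simp only [hn.1])
  · exact (tendsto_logb_ceil hR₂.le).congr' (hev.mono fun n hn => by simp only [hn.2.1])

end Codes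

/-! ### Achievability of the equivocation rate -/

lemma coe_le_liminf {f : ℕ → EReal} {g : ℕ → ℝ} {R : ℝ} (hg : Tendsto g atTop (𝓝 R))
    (h : ∀ᶠ n in atTop, (g n : EReal) ≤ f n) : (R : EReal) ≤ liminf f atTop := by
  have : Tendsto (fun n => (g n : EReal)) atTop (𝓝 (R : EReal)) :=
    (continuous_coe_real_ereal.tendsto R).comp hg
  rw [← this.liminf_eq]
  exact liminf_le_liminf h

section Equivocation

variable {A Y : Type*} [Fintype A] [MeasurableSpace Y] {μ : Measure Y} {v : A → Y → ℝ}
  {V : A → Measure Y}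

lemma integral_log_nDens (h : HasDens μ V v) {n : ℕ} {p : Fin n → A → ℝ}
    (hp : ∀ i, p i ∈ stdSimplex ℝ A) {a : Fin n → A} (ha : 0 < prodW p a) :
    ∫ y, Real.log (nDens v n a y / mixDens (nDens v n) (prodW p) y)
      ∂(Measure.pi fun i => V (a i)) =
      ∑ i, ∫ y, Real.log (v (a i) y / mixDens v (p i) y) ∂(V (a i)) := by
  have := fun i => h.isProb (a i)
  have hpa : ∀ i, p i (a i) ≠ 0 := fun i h0 =>
    ha.ne' (Finset.prod_eq_zero (Finset.mem_univ i) h0)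
  have hint := fun i => h.integrable_log (hp i) (hpa i)
  have hpos : ∀ᵐ y ∂(Measure.pi fun i => V (a i)), ∀ i, 0 < v (a i) (y i) := by
    rw [ae_all_iff]
    intro i
    exact (Measure.quasiMeasurePreserving_eval (fun i => V (a i)) i).ae (h.ae_pos (a i))
  calc _ = ∫ y : Fin n → Y, ∑ i, Real.log (v (a i) (y i) / mixDens v (p i) (y i))
        ∂(Measure.pi fun i => V (a i)) := by
        refine integral_congr_ae ?_
        filter_upwards [hpos] with y hy
        have hm : ∀ i, 0 < mixDens v (p i) (y i) := fun i =>
          (mul_pos (((hp i).1 _).lt_of_ne' (hpa i)) (hy i)).trans_le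
            (mul_le_mixDens h.toIsDensity (hp i) (y i) (a i))
        rw [mixDens_nDens_prodW, nDens, ← Finset.prod_div_distrib,
          Real.log_prod fun i _ => (div_pos (hy i) (hm i)).ne']
    _ = _ := by
        rw [integral_finsetSum]
        · exact Finset.sum_congr rfl fun i _ => integral_comp_eval
            (μ := fun i => V (a i)) (i := i) (hint i).aestronglyMeasurable
        · intro i _
          exact ((measurePreserving_eval (fun i => V (a i)) i).integrable_comp
            (hint i).aestronglyMeasurable).2 (hint i)

end Equivocation

/-! ### Achievability for the region without Rényi order -/

section Regions

variable {X Y : Type*} [MetricSpace X] [MeasurableSpace Y] {μ : Measure Y} [SigmaFinite μ]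
  {W : X → Measure Y} [∀ x, IsProbabilityMeasure (W x)] {𝒳 : Finset X} {v : 𝒳 → Y → ℝ}

/-- The output law of the product input distribution serves as Q. A codeword of positive weight is
at divergence `sumDiv` from it, by additivity of the log-likelihood ratio. -/
lemma le_equivocation (h : HasDens μ (honest W 𝒳) v) {n : ℕ} {p : Fin n → 𝒳 → ℝ}
    (hp : ∀ i, p i ∈ stdSimplex ℝ 𝒳) (c : ListCode 𝒳 Y n) {b : ℝ} (hb : 0 ≤ b)
    (hc : ∀ m, ∃ x, sumDiv W v p x ≤ b * Real.log 2 ∧ 0 < prodW p x ∧ c.enc m x = 1) :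
    ((Real.logb 2 c.M - b : ℝ) : EReal) ≤ c.equivocation μ W := by
  have hlog : 0 < Real.log 2 := Real.log_pos one_lt_two
  have hN := hasDens_pi h n
  have hP := prodW_mem hp
  rw [EReal.coe_sub]
  refine EReal.sub_le_sub le_rfl ?_
  have hbe : (b : EReal) = ((ENNReal.ofReal b : ℝ≥0∞) : EReal) := by
    rw [EReal.coe_ennreal_ofReal, max_eq_left hb]
  rw [hbe, EReal.coe_ennreal_le_coe_ennreal_iff]
  refine iInf₂_le_of_le (mixture (prodW p) fun x => Measure.pi fun i => honest W 𝒳 (x i))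
    ⟨hN.isProb_mixture hP, hN.mixture_ac hP⟩ ?_
  have hterm : ∀ m, klDiv2 (c.out W m)
      (mixture (prodW p) fun x => Measure.pi fun i => honest W 𝒳 (x i)) ≤ ENNReal.ofReal b := by
    intro m
    obtain ⟨x, hx, hpx, henc⟩ := hc m
    rw [c.out_eq W henc, klDiv2]
    have hkl := (hN.klDiv_mixture hP hpx.ne').2
    rw [integral_log_nDens h hp hpx] at hkl
    change InformationTheory.klDiv (Measure.pi fun i => honest W 𝒳 (x i)) _ / _ ≤ _
    rw [hkl, ← ENNReal.ofReal_div_of_pos hlog]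
    refine ENNReal.ofReal_le_ofReal ?_
    rw [div_le_iff₀ hlog]
    exact hx
  calc _ ≤ ∑ _m : Fin c.M, (c.M : ℝ≥0∞)⁻¹ * ENNReal.ofReal b :=
        Finset.sum_le_sum fun m _ => mul_le_mul_right (hterm m) _
    _ = ENNReal.ofReal b := by
        rw [Finset.sum_const, Finset.card_univ, Fintype.card_fin, nsmul_eq_mul, ← mul_assoc,
          ENNReal.mul_inv_cancel (by exact_mod_cast c.M_pos.ne') (ENNReal.natCast_ne_top _),
          one_mul]

/-- The sequences whose `sumDiv` is within nτ (in bits) of n times the information have weight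
tending to 1, so the codewords can be taken among them. -/
lemma regionC_subset (hWμ : ∀ x, W x ≪ μ) (hW3 : CondW3 W 𝒳) :
    regionC (honest W 𝒳) ⊆ closure (regionUD μ W 𝒳) := by
  rintro ⟨R₁, R₂, R₃⟩ ⟨k, P, hP, h12, hI, hE, hH, h1, h2, h3⟩
  have hlog : 0 < Real.log 2 := Real.log_pos one_lt_two
  have : ∀ x, IsProbabilityMeasure (honest W 𝒳 x) := fun x => by unfold honest; infer_instance
  have h : HasDens μ (honest W 𝒳) (dens μ (honest W 𝒳)) := hasDens_dens fun x => hWμ x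
  set v := dens μ (honest W 𝒳)
  simp only at h12 hI hE hH h1 h2 h3
  rw [mutualInfoU_coe h hP] at hI hE
  rw [condEntropyU_eq hP] at hH
  obtain ⟨u, hu, hlim⟩ := exists_seq_tendsto_freq (margU_mem hP)
  have hq : ∀ i, condU P (u i) ∈ stdSimplex ℝ 𝒳 := fun i => condU_mem hP (hu i).ne'
  set J := ∑ a, margU P a * infoD μ v (condU P a) with hJ
  set H := ∑ a, margU P a * ent (condU P a) with hHd
  have hI' : (R₁ - R₂) * Real.log 2 < J := (lt_div_iff₀ hlog).1 (by exact_mod_cast hI)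
  have hH' : R₁ * Real.log 2 < H := (lt_div_iff₀ hlog).1 hH
  have hE' : R₃ ≤ R₁ - J / Real.log 2 := by exact_mod_cast hE
  have hJ0 : 0 < J := lt_trans (by nlinarith) hI'
  -- The third constraint of 𝒞 may hold with equality, so the rate loses τ and the triple itself is
  -- reached only in the limit.
  have hmem : ∀ τ : ℝ, 0 < τ → τ < R₃ → (R₁, R₂, R₃ - τ) ∈ regionUD μ W 𝒳 := by
    intro τ hτ hτR
    have hη : 0 < τ * Real.log 2 := by positivity
    have hS := tendsto_wt_sumDiv h hq hη (hlim fun a => infoD μ v (condU P a))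
    have hS' : ∀ᶠ n : ℕ in atTop, 3 / 4 ≤ wt (prodW fun i : Fin n => condU P (u i))
        {x | τ * Real.log 2 * n ≤ |sumDiv W v (fun i : Fin n => condU P (u i)) x - J * n|}ᶜ := by
      filter_upwards [hS.eventually (eventually_le_nhds (show (0 : ℝ) < 1 / 4 by norm_num))]
        with n hn
      have h4 := wt_add_compl (prodW fun i : Fin n => condU P (u i))
        {x | τ * Real.log 2 * n ≤ |sumDiv W v (fun i : Fin n => condU P (u i)) x - J * n|}
      rw [(prodW_mem fun i : Fin n => hq i).2] at h4
      linarith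
    obtain ⟨c, hdet, hsec, hrate, hc⟩ := exists_listCode_seq h hW3 hq
      (hlim fun a => infoD μ v (condU P a)) (hlim fun a => ent (condU P a)) h2 (by linarith)
      hI' hH' hS'
    refine ⟨⟨h1, h2, by simpa using hτR⟩, c, hdet, hsec, hrate, ?_⟩
    have hlimit : Tendsto (fun n : ℕ => (1 / n : ℝ) * Real.logb 2 (c n).M -
        (J / Real.log 2 + τ)) atTop (𝓝 (R₁ - (J / Real.log 2 + τ))) := hrate.1.sub_const _
    refine le_trans ?_ (coe_le_liminf hlimit ?_)
    · exact_mod_cast (by linarith : R₃ - τ ≤ R₁ - (J / Real.log 2 + τ))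
    · filter_upwards [hc, eventually_gt_atTop 0] with n hn hn0
      have hn' : (0 : ℝ) < n := by exact_mod_cast hn0
      have hle := le_equivocation h (fun i : Fin n => hq i) (c n)
        (b := n * (J / Real.log 2 + τ)) (by positivity) fun m => by
          obtain ⟨x, hx, hx'⟩ := hn m
          refine ⟨x, ?_, hx'⟩
          rw [Set.mem_compl_iff, Set.mem_ofPred_eq, not_le, abs_lt] at hx
          have : n * (J / Real.log 2 + τ) * Real.log 2 = J * n + τ * Real.log 2 * n := by
            field_simp
          rw [this]
          linarith [hx.2]
      refine le_trans ?_ (mul_le_mul_of_nonneg_left hle (by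
        exact_mod_cast (by positivity : (0 : ℝ) ≤ 1 / n)))
      rw [← EReal.coe_mul]
      refine le_of_eq ?_
      congr 1
      field_simp
  refine mem_closure_of_tendsto (f := fun τ : ℝ => (R₁, R₂, R₃ - τ)) (b := 𝓝[>] 0) ?_ ?_
  · have : Tendsto (fun τ : ℝ => (R₁, R₂, R₃ - τ)) (𝓝 0) (𝓝 (R₁, R₂, R₃ - 0)) :=
      Continuous.tendsto (by fun_prop) 0
    rw [sub_zero] at this
    exact this.mono_left nhdsWithin_le_nhds
  · filter_upwards [Ioo_mem_nhdsGT h3] with τ hτ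
    exact hmem τ hτ.1 hτ.2

end Regions

/-! ### Rényi moments -/

lemma log2_le_iff {x : ℝ≥0∞} {z : EReal} : log2 x ≤ z ↔ x ≤ exp2 z := by
  have hlog : 0 < Real.log 2 := Real.log_pos one_lt_two
  unfold log2 exp2
  rw [EReal.div_le_iff_le_mul (by exact_mod_cast hlog) (EReal.coe_ne_top _),
    ← ENNReal.logOrderIso.le_iff_le (x := x), ENNReal.logOrderIso_apply,
    ENNReal.logOrderIso_apply, EReal.log_exp]

lemma le_log2_iff {x : ℝ≥0∞} {z : EReal} : z ≤ log2 x ↔ exp2 z ≤ x := by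
  have hlog : 0 < Real.log 2 := Real.log_pos one_lt_two
  unfold log2 exp2
  rw [EReal.le_div_iff_mul_le (by exact_mod_cast hlog) (EReal.coe_ne_top _),
    ← ENNReal.logOrderIso.le_iff_le (y := x), ENNReal.logOrderIso_apply,
    ENNReal.logOrderIso_apply, EReal.log_exp, mul_comm]

lemma exp2_log2 (x : ℝ≥0∞) : exp2 (log2 x) = x :=
  le_antisymm (le_log2_iff.1 le_rfl) (log2_le_iff.1 le_rfl)

lemma exp2_coe (r : ℝ) : exp2 (r : EReal) = ENNReal.ofReal (2 ^ r) := by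
  rw [exp2, ← EReal.coe_mul, EReal.exp_coe, Real.rpow_def_of_pos two_pos]

lemma coe_mul_inv_mul {c : ℝ} (hc : c ≠ 0) (z : EReal) :
    (c : EReal) * (((1 / c : ℝ) : EReal) * z) = z := by
  rw [← mul_assoc, ← EReal.coe_mul, mul_one_div_cancel hc, EReal.coe_one, one_mul]

lemma inv_mul_log2_le_iff {c : ℝ} (hc : 0 < c) {x : ℝ≥0∞} {r : ℝ} :
    ((1 / c : ℝ) : EReal) * log2 x ≤ r ↔ x ≤ ENNReal.ofReal (2 ^ (c * r)) := by
  have hc' : (0 : EReal) ≤ c := by exact_mod_cast hc.le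
  have hc'' : (0 : EReal) ≤ ((1 / c : ℝ) : EReal) := by exact_mod_cast (by positivity : 0 ≤ 1 / c)
  rw [← exp2_coe, ← log2_le_iff]
  constructor
  · intro h
    have := mul_le_mul_of_nonneg_left h hc'
    rwa [coe_mul_inv_mul hc.ne', ← EReal.coe_mul] at this
  · intro h
    refine (mul_le_mul_of_nonneg_left h hc'').trans (le_of_eq ?_)
    rw [← EReal.coe_mul, ← mul_assoc, one_div_mul_cancel hc.ne', one_mul]

section Moment

variable {Ω : Type*} [MeasurableSpace Ω] {μ : Measure Ω} [SigmaFinite μ] {α : ℝ}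

lemma exp2_mul_renyiDiv (hα : 1 < α) (P Q : Measure Ω) :
    exp2 (((α - 1 : ℝ) : EReal) * renyiDiv α μ P Q) = renyiMoment α μ P Q := by
  rw [renyiDiv, coe_mul_inv_mul (sub_pos.2 hα).ne', exp2_log2]

/-- A lower bound for the Rényi moments that does not depend on the measures. -/
lemma le_renyiMoment (hα : 1 < α) {P Q : Measure Ω} [IsProbabilityMeasure P]
    [IsProbabilityMeasure Q] (hP : P ≪ μ) (hQ : Q ≪ μ) :
    (1 / 2 : ℝ≥0∞) ^ (α - 1) * (1 / 2) ≤ renyiMoment α μ P Q := by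
  have hα' : 0 ≤ α - 1 := by linarith
  set f := P.rnDeriv μ with hf
  set g := Q.rnDeriv μ with hg
  have hfm : Measurable f := Measure.measurable_rnDeriv P μ
  have hgm : Measurable g := Measure.measurable_rnDeriv Q μ
  -- Off this set the density of P is at most half that of Q, so the set has P-probability at least
  -- 1/2, and on it the ratio of densities is at least 1/2.
  have hAm : MeasurableSet {y | g y ≤ 2 * f y} := measurableSet_le hgm (hfm.const_mul 2)
  have hAc : P {y | g y ≤ 2 * f y}ᶜ ≤ 1 / 2 := by
    rw [← Measure.withDensity_rnDeriv_eq P μ hP, withDensity_apply _ hAm.compl]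
    calc ∫⁻ y in {y | g y ≤ 2 * f y}ᶜ, f y ∂μ
        ≤ ∫⁻ y in {y | g y ≤ 2 * f y}ᶜ, 1 / 2 * g y ∂μ := by
          refine setLIntegral_mono (hgm.const_mul _) fun y hy => ?_
          simp only [Set.mem_compl_iff, Set.mem_ofPred_eq, not_le] at hy
          calc f y = 1 / 2 * (2 * f y) := by
                rw [← mul_assoc, one_div, ENNReal.inv_mul_cancel two_ne_zero ENNReal.ofNat_ne_top,
                  one_mul]
            _ ≤ _ := by gcongr
      _ ≤ ∫⁻ y, 1 / 2 * g y ∂μ := setLIntegral_le_lintegral _ _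
      _ = 1 / 2 := by
          rw [lintegral_const_mul _ hgm, ← setLIntegral_univ, ← withDensity_apply _ .univ, hg,
            Measure.withDensity_rnDeriv_eq Q μ hQ, measure_univ, mul_one]
  have hA : 1 / 2 ≤ P {y | g y ≤ 2 * f y} := by
    have h1 := prob_add_prob_compl (μ := P) hAm
    by_contra! hlt
    have h2 : P {y | g y ≤ 2 * f y} + P {y | g y ≤ 2 * f y}ᶜ < 1 / 2 + 1 / 2 :=
      ENNReal.add_lt_add_of_lt_of_le (measure_ne_top _ _) hlt hAc
    rw [h1, ENNReal.add_halves] at h2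
    exact lt_irrefl _ h2
  have hm : Measurable fun y => (f y / g y) ^ (α - 1) := (hfm.div hgm).pow_const _
  refine le_trans ?_ (mul_meas_ge_le_lintegral hm ((1 / 2 : ℝ≥0∞) ^ (α - 1)))
  refine mul_le_mul_right (hA.trans (measure_mono_ae ?_)) _
  filter_upwards [Measure.rnDeriv_pos hP, hP.ae_le (Measure.rnDeriv_lt_top P μ)] with y h1 h2 hy
  refine ENNReal.rpow_le_rpow ?_ hα'
  have hy' : g y ≤ 2 * f y := hy
  rw [ENNReal.le_div_iff_mul_le (Or.inr h1.ne') (Or.inr h2.ne)]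
  calc 1 / 2 * g y ≤ 1 / 2 * (2 * f y) := by gcongr
    _ = f y := by
      rw [← mul_assoc, one_div, ENNReal.inv_mul_cancel two_ne_zero ENNReal.ofNat_ne_top, one_mul]

lemma pi_eq_withDensity_rnDeriv {n : ℕ} {P : Fin n → Measure Ω} [∀ i, IsProbabilityMeasure (P i)]
    (hP : ∀ i, P i ≪ μ) :
    Measure.pi P = (Measure.pi fun _ => μ).withDensity fun y => ∏ i, (P i).rnDeriv μ (y i) := by
  have h1 : ∀ i, μ.withDensity ((P i).rnDeriv μ) = P i := fun i =>
    Measure.withDensity_rnDeriv_eq (P i) μ (hP i)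
  have h2 : ∀ i, SigmaFinite (μ.withDensity ((P i).rnDeriv μ)) := fun i => by
    rw [h1 i]
    infer_instance
  have h3 := pi_withDensity (fun _ : Fin n => μ) (fun i => (P i).rnDeriv μ)
    fun i => Measure.measurable_rnDeriv _ _
  simp_rw [h1] at h3
  exact h3

lemma pi_absolutelyContinuous {n : ℕ} {P : Fin n → Measure Ω} [∀ i, IsProbabilityMeasure (P i)]
    (hP : ∀ i, P i ≪ μ) : Measure.pi P ≪ Measure.pi fun _ => μ := by
  rw [pi_eq_withDensity_rnDeriv hP]
  exact withDensity_absolutelyContinuous _ _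

lemma rnDeriv_pi {n : ℕ} {P : Fin n → Measure Ω} [∀ i, IsProbabilityMeasure (P i)]
    (hP : ∀ i, P i ≪ μ) :
    (Measure.pi P).rnDeriv (Measure.pi fun _ => μ) =ᵐ[Measure.pi fun _ => μ]
      fun y => ∏ i, (P i).rnDeriv μ (y i) := by
  rw [pi_eq_withDensity_rnDeriv hP]
  exact Measure.rnDeriv_withDensity _
    (Finset.measurable_prod _ fun i _ => (Measure.measurable_rnDeriv _ _).comp
      (measurable_pi_apply i))

/-- The densities of product measures are products of densities. Inverting a product in [0,∞]
requires that 0 and ∞ do not meet; the densities of the Q i are finite almost everywhere, which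
excludes this. -/
lemma renyiMoment_pi (hα : 1 < α) {n : ℕ} {P Q : Fin n → Measure Ω}
    [∀ i, IsProbabilityMeasure (P i)] [∀ i, IsProbabilityMeasure (Q i)]
    (hP : ∀ i, P i ≪ μ) (hQ : ∀ i, Q i ≪ μ) :
    renyiMoment α (Measure.pi fun _ => μ) (Measure.pi P) (Measure.pi Q) =
      ∏ i, renyiMoment α μ (P i) (Q i) := by
  have hα' : 0 ≤ α - 1 := by linarith
  have hac : Measure.pi P ≪ Measure.pi fun _ => μ := pi_absolutelyContinuous hP
  have htop : ∀ᵐ y ∂(Measure.pi P), ∀ i, (Q i).rnDeriv μ (y i) ≠ ∞ := by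
    rw [ae_all_iff]
    intro i
    have h1 : ∀ᵐ y ∂(P i), (Q i).rnDeriv μ y < ∞ := (hP i).ae_le (Measure.rnDeriv_lt_top (Q i) μ)
    exact (Measure.quasiMeasurePreserving_eval P i).ae (h1.mono fun y hy => hy.ne)
  unfold renyiMoment
  rw [← lintegral_pi_prod P (fun i y => ((P i).rnDeriv μ y / (Q i).rnDeriv μ y) ^ (α - 1))
    fun i => ((Measure.measurable_rnDeriv _ _).div (Measure.measurable_rnDeriv _ _)).pow_const _]
  refine lintegral_congr_ae ?_
  filter_upwards [hac.ae_le (rnDeriv_pi hP), hac.ae_le (rnDeriv_pi hQ), htop] with y h1 h2 h3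
  rw [h1, h2, ENNReal.prod_rpow_of_nonneg hα', div_eq_mul_inv,
    ENNReal.prod_inv_distrib fun i _ j _ _ => Or.inr (h3 j), ← Finset.prod_mul_distrib]
  rfl

end Moment

/-! ### Single-letter Rényi information and near-optimal output laws -/

section SingleLetterMoment

variable {A Y : Type*} [Fintype A] [MeasurableSpace Y] {μ : Measure Y} [SigmaFinite μ]
  {V : A → Measure Y} {α : ℝ}

/-- Excludes the value −∞, which would absorb the other terms of the average over U in extended-real
arithmetic. -/
lemma renyiInfo_ne_bot (hα : 1 < α) [∀ a, IsProbabilityMeasure (V a)] (hV : ∀ a, V a ≪ μ)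
    {q : A → ℝ} (hq : q ∈ stdSimplex ℝ A) : renyiInfo α μ V q ≠ ⊥ := by
  have hα' : 0 < α - 1 := sub_pos.2 hα
  have hc : ENNReal.ofReal (2 ^ (-α)) = (1 / 2 : ℝ≥0∞) ^ (α - 1) * (1 / 2) := by
    have h2 : (1 / 2 : ℝ≥0∞) = ENNReal.ofReal (1 / 2) := by
      rw [ENNReal.ofReal_div_of_pos two_pos]
      simp
    rw [h2, ENNReal.ofReal_rpow_of_pos (by norm_num), ← ENNReal.ofReal_mul (by positivity)]
    congr 1
    rw [← Real.rpow_add_one (by norm_num), sub_add_cancel, one_div, Real.inv_rpow two_pos.le,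
      Real.rpow_neg two_pos.le]
  refine ne_bot_of_le_ne_bot (EReal.coe_ne_bot (1 / (α - 1) * -α)) (le_iInf₂ fun Q hQ => ?_)
  have := hQ.1
  rw [EReal.coe_mul]
  refine mul_le_mul_of_nonneg_left ?_ (by exact_mod_cast (by positivity : 0 ≤ 1 / (α - 1)))
  rw [le_log2_iff, exp2_coe, hc]
  calc (1 / 2 : ℝ≥0∞) ^ (α - 1) * (1 / 2)
      = ∑ a, ENNReal.ofReal (q a) * ((1 / 2 : ℝ≥0∞) ^ (α - 1) * (1 / 2)) := by
        rw [← Finset.sum_mul, ← ENNReal.ofReal_sum_of_nonneg fun a _ => hq.1 a, hq.2,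
          ENNReal.ofReal_one, one_mul]
    _ ≤ _ := Finset.sum_le_sum fun a _ => mul_le_mul_right (le_renyiMoment hα (hV a) hQ.2) _

/-- A strict upper bound on the infimum provides a near-optimal Q, so attainment plays no role.
Finiteness of the moments is available exactly for letters of positive probability, hence the
real-valued g. -/
lemma exists_moment_le (hα : 1 < α) {q : A → ℝ} (hq : q ∈ stdSimplex ℝ A) {e : ℝ}
    (h : renyiInfo α μ V q < e) :
    ∃ Q ∈ acProb μ, ∃ g : A → ℝ, (∀ a, 0 ≤ g a) ∧
      (∀ a, q a ≠ 0 → renyiMoment α μ (V a) Q = ENNReal.ofReal (g a)) ∧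
      ∑ a, q a * g a ≤ 2 ^ ((α - 1) * e) := by
  obtain ⟨Q, hQ⟩ := iInf_lt_iff.1 h
  obtain ⟨hQ, hlt⟩ := iInf_lt_iff.1 hQ
  have hle := (inv_mul_log2_le_iff (sub_pos.2 hα)).1 hlt.le
  have htop := ENNReal.sum_ne_top.1 (ne_top_of_le_ne_top ENNReal.ofReal_ne_top hle)
  refine ⟨Q, hQ, fun a => (renyiMoment α μ (V a) Q).toReal, fun a => ENNReal.toReal_nonneg,
    fun a ha => (ENNReal.ofReal_toReal fun ht => htop a (Finset.mem_univ a) ?_).symm, ?_⟩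
  · rw [ht, ENNReal.mul_top (ENNReal.ofReal_pos.2 ((hq.1 a).lt_of_ne' ha)).ne']
  · have h4 := ENNReal.toReal_le_of_le_ofReal (by positivity) hle
    rw [ENNReal.toReal_sum htop] at h4
    simpa only [ENNReal.toReal_mul, ENNReal.toReal_ofReal (hq.1 _)] using h4

lemma sum_ne_bot {U : Type*} (s : Finset U) {f : U → EReal} (hf : ∀ a, f a ≠ ⊥) :
    ∑ a ∈ s, f a ≠ ⊥ := by
  classical
  induction s using Finset.induction_on with
  | empty => simp
  | insert a s ha ih => rw [Finset.sum_insert ha]; exact EReal.add_ne_bot_iff.2 ⟨hf a, ih⟩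

lemma coe_sum {U : Type*} (s : Finset U) (f : U → ℝ) :
    ((∑ a ∈ s, f a : ℝ) : EReal) = ∑ a ∈ s, (f a : EReal) := by
  classical
  induction s using Finset.induction_on with
  | empty => simp
  | insert a s ha ih => rw [Finset.sum_insert ha, Finset.sum_insert ha, EReal.coe_add, ih]

/-- The slack in the third constraint is added in full to the Rényi information at every u. As P_U
has mass 1, this turns the strict inequality into an equality for R₃ while leaving strict room at
each u. -/
lemma exists_renyiInfo_lt (hα : 1 < α) [∀ a, IsProbabilityMeasure (V a)] (hV : ∀ a, V a ≪ μ)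
    {U : Type*} [Fintype U] {P : U × A → ℝ} (hP : P ∈ stdSimplex ℝ (U × A)) {R₁ R₃ : ℝ}
    (h : (R₃ : EReal) < (R₁ : EReal) - renyiInfoU α μ V P) :
    ∃ e : U → ℝ, R₃ = R₁ - ∑ u, margU P u * e u ∧
      ∀ u, 0 < margU P u → renyiInfo α μ V (condU P u) < e u := by
  classical
  have hbot : ∀ u, 0 < margU P u → renyiInfo α μ V (condU P u) ≠ ⊥ := fun u hu =>
    renyiInfo_ne_bot hα hV (condU_mem hP hu.ne')
  have htermbot : ∀ u, ((margU P u : ℝ) : EReal) * renyiInfo α μ V (condU P u) ≠ ⊥ := by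
    intro u
    rcases ((margU_mem hP).1 u).eq_or_lt with hu | hu
    · simp [← hu]
    · rw [Ne, EReal.mul_eq_bot]
      simp [hbot u hu, hu.le.not_gt]
  have htop : ∀ u, 0 < margU P u → renyiInfo α μ V (condU P u) ≠ ⊤ := by
    intro u hu hut
    have : renyiInfoU α μ V P = ⊤ := by
      unfold renyiInfoU
      rw [← Finset.add_sum_erase _ _ (Finset.mem_univ u), hut,
        EReal.coe_mul_top_of_pos hu, EReal.top_add_of_ne_bot (sum_ne_bot _ htermbot)]
    rw [this, EReal.sub_top] at h
    exact not_lt_bot h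
  set r : U → ℝ := fun u => (renyiInfo α μ V (condU P u)).toReal with hr
  have hr' : ∀ u, 0 < margU P u → (r u : EReal) = renyiInfo α μ V (condU P u) := fun u hu =>
    EReal.coe_toReal (htop u hu) (hbot u hu)
  have hsum : renyiInfoU α μ V P = ((∑ u, margU P u * r u : ℝ) : EReal) := by
    rw [coe_sum]
    refine Finset.sum_congr rfl fun u _ => ?_
    rcases ((margU_mem hP).1 u).eq_or_lt with hu | hu
    · simp [← hu]
    · rw [EReal.coe_mul, hr' u hu]
  rw [hsum] at h
  have h' : R₃ < R₁ - ∑ u, margU P u * r u := by exact_mod_cast h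
  refine ⟨fun u => r u + (R₁ - ∑ u, margU P u * r u - R₃), ?_, fun u hu => ?_⟩
  · simp_rw [mul_add, Finset.sum_add_distrib, ← Finset.sum_mul, (margU_mem hP).2]
    ring
  · rw [← hr' u hu]
    exact_mod_cast (by linarith : r u < r u + (R₁ - ∑ u, margU P u * r u - R₃))

end SingleLetterMoment

/-! ### Achievability of the Rényi equivocation rate -/

/-- Markov's inequality for a product of moments: the mean factorizes, and exceeding 4b has weight
at most 1/4, which matches the requirement 3/4 of `exists_listCode_seq`. -/
lemma le_wt_prodW_of_moment_le {A : Type*} [Fintype A] {n : ℕ} {p g : Fin n → A → ℝ}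
    (hp : ∀ i, p i ∈ stdSimplex ℝ A) (hg : ∀ i a, 0 ≤ g i a) {b : ℝ} (hb : 0 < b)
    (h : ∏ i, ∑ a, p i a * g i a ≤ b) : 3 / 4 ≤ wt (prodW p) {x | ∏ i, g i (x i) < 4 * b} := by
  have h1 := wt_mul_le (prodW_nonneg hp) (g := fun x => ∏ i, g i (x i))
    (fun x => Finset.prod_nonneg fun i _ => hg i _) (4 * b)
    (S := {x | ∏ i, g i (x i) < 4 * b}ᶜ) fun x hx => not_lt.1 hx
  have h2 : ∑ x, prodW p x * ∏ i, g i (x i) = ∏ i, ∑ a, p i a * g i a := by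
    rw [← sum_prod_pi]
    exact Finset.sum_congr rfl fun x _ => by rw [prodW, prodW, ← Finset.prod_mul_distrib]
  have h3 := wt_add_compl (prodW p) {x | ∏ i, g i (x i) < 4 * b}
  rw [(prodW_mem hp).2] at h3
  rw [h2] at h1
  have h4 : 4 * wt (prodW p) {x | ∏ i, g i (x i) < 4 * b}ᶜ ≤ 1 := by
    refine le_of_mul_le_mul_right ?_ hb
    linarith
  linarith

/-! ### Inclusions of the Rényi regions -/

section Regions

variable {X Y : Type*} [MetricSpace X] [MeasurableSpace Y] {μ : Measure Y} [SigmaFinite μ]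
  {W : X → Measure Y} [∀ x, IsProbabilityMeasure (W x)] {𝒳 : Finset X} {α : ℝ}

lemma le_renyiEquivocation (hα : 1 < α) (hWμ : ∀ x, W x ≪ μ) {n : ℕ} (c : ListCode 𝒳 Y n)
    {Q : Fin n → Measure Y} (hQ : ∀ i, Q i ∈ acProb μ) {b : ℝ}
    (hc : ∀ m, ∃ x, ∏ i, renyiMoment α μ (W (x i)) (Q i) ≤ ENNReal.ofReal (2 ^ ((α - 1) * b)) ∧
      c.enc m x = 1) :
    ((Real.logb 2 c.M - b : ℝ) : EReal) ≤ c.renyiEquivocation α μ W := by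
  have := fun i => (hQ i).1
  rw [EReal.coe_sub]
  refine EReal.sub_le_sub le_rfl (iInf₂_le_of_le (Measure.pi Q)
    ⟨inferInstance, pi_absolutelyContinuous fun i => (hQ i).2⟩ ?_)
  rw [inv_mul_log2_le_iff (sub_pos.2 hα)]
  calc _ ≤ ∑ _m : Fin c.M, (c.M : ℝ≥0∞)⁻¹ * ENNReal.ofReal (2 ^ ((α - 1) * b)) := by
        refine Finset.sum_le_sum fun m _ => mul_le_mul_right ?_ _
        obtain ⟨x, hx, henc⟩ := hc m
        rw [exp2_mul_renyiDiv hα, c.out_eq W henc, prodChannel,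
          renyiMoment_pi hα (fun i => hWμ _) fun i => (hQ i).2]
        exact hx
    _ = _ := by
        rw [Finset.sum_const, Finset.card_univ, Fintype.card_fin, nsmul_eq_mul, ← mul_assoc,
          ENNReal.mul_inv_cancel (by exact_mod_cast c.M_pos.ne') (ENNReal.natCast_ne_top _),
          one_mul]

/-- The factor 4 from Markov's inequality costs the additive constant 2/c in the exponent,
negligible after division by n. -/
lemma two_rpow_mul_add_sum {c : ℝ} (hc : c ≠ 0) {n : ℕ} (e : Fin n → ℝ) :
    (2 : ℝ) ^ (c * (2 / c + ∑ i, e i)) = 4 * ∏ i, (2 : ℝ) ^ (c * e i) := by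
  rw [← Real.rpow_sum_of_pos two_pos, ← Finset.mul_sum, mul_add, Real.rpow_add two_pos,
    mul_div_cancel₀ _ hc]
  norm_num

/-- No closure is needed here, in contrast to `regionC_subset`: the strict inequality defining 𝒞_α
leaves room for a near-optimal Q at each u, and a set of weight 3/4 with moments within a constant
factor of the mean bound suffices. The rate R₃ is then attained exactly in the limit. -/
lemma regionCα_subset (hα : 1 < α) (hWμ : ∀ x, W x ≪ μ) (hW3 : CondW3 W 𝒳) :
    regionCα α μ (honest W 𝒳) ⊆ regionUDα α μ W 𝒳 := by
  rintro ⟨R₁, R₂, R₃⟩ ⟨k, P, hP, h12, hI, hE, hH, h1, h2, h3⟩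
  have hlog : 0 < Real.log 2 := Real.log_pos one_lt_two
  have hα' : 0 < α - 1 := sub_pos.2 hα
  have : ∀ x, IsProbabilityMeasure (honest W 𝒳 x) := fun x => by unfold honest; infer_instance
  have hV : ∀ x, honest W 𝒳 x ≪ μ := fun x => hWμ x
  have h : HasDens μ (honest W 𝒳) (dens μ (honest W 𝒳)) := hasDens_dens hV
  simp only at h12 hI hE hH h1 h2 h3
  rw [mutualInfoU_coe h hP] at hI
  rw [condEntropyU_eq hP] at hH
  obtain ⟨u, hu, hlim⟩ := exists_seq_tendsto_freq (margU_mem hP)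
  have hq : ∀ i, condU P (u i) ∈ stdSimplex ℝ 𝒳 := fun i => condU_mem hP (hu i).ne'
  obtain ⟨e, he, hlt⟩ := exists_renyiInfo_lt hα hV hP hE
  have hex := fun u hu => exists_moment_le hα (condU_mem hP (ne_of_gt hu)) (hlt u hu)
  choose! Q hQ g hg hgQ hmean using hex
  have hS : ∀ n, 3 / 4 ≤ wt (prodW fun i : Fin n => condU P (u i))
      {x | ∏ i : Fin n, g (u i) (x i) < 4 * ∏ i : Fin n, (2 : ℝ) ^ ((α - 1) * e (u i))} := fun n =>
    le_wt_prodW_of_moment_le (fun i : Fin n => hq i) (fun i => hg _ (hu i))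
      (Finset.prod_pos fun i _ => by positivity) (Finset.prod_le_prod (fun i _ => Finset.sum_nonneg fun a _ =>
        mul_nonneg ((hq i).1 a) (hg _ (hu i) a)) fun i _ => hmean _ (hu i))
  obtain ⟨c, hdet, hsec, hrate, hc⟩ := exists_listCode_seq h hW3 hq
    (hlim fun a => infoD μ (dens μ (honest W 𝒳)) (condU P a)) (hlim fun a => ent (condU P a)) h2
    (by linarith) ((lt_div_iff₀ hlog).1 (by exact_mod_cast hI)) ((lt_div_iff₀ hlog).1 hH)
    (Eventually.of_forall hS)
  refine ⟨⟨h1, h2, h3⟩, c, hdet, hsec, hrate, ?_⟩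
  have hblim : Tendsto (fun n : ℕ => 2 / (α - 1) / n + (∑ i : Fin n, e (u i)) / n) atTop
      (𝓝 (0 + ∑ a, margU P a * e a)) :=
    (tendsto_const_div_atTop_nhds_zero_nat _).add (hlim e)
  have hlimit : Tendsto (fun n : ℕ => (1 / n : ℝ) * Real.logb 2 (c n).M -
      (2 / (α - 1) / n + (∑ i : Fin n, e (u i)) / n)) atTop (𝓝 R₃) := by
    rw [he]
    simpa using hrate.1.sub hblim
  refine coe_le_liminf hlimit ?_
  filter_upwards [hc] with n hn
  have hle := le_renyiEquivocation hα hWμ (c n) (Q := fun i : Fin n => Q (u i)) 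
    (b := 2 / (α - 1) + ∑ i : Fin n, e (u i))
    (fun i => hQ _ (hu i)) fun m => by
      obtain ⟨x, hx, hpx, henc⟩ := hn m
      refine ⟨x, ?_, henc⟩
      have hfac : ∀ i : Fin n, renyiMoment α μ (W (x i)) (Q (u i)) =
          ENNReal.ofReal (g (u i) (x i)) := fun i =>
        hgQ _ (hu i) _ fun h0 => hpx.ne' (Finset.prod_eq_zero (Finset.mem_univ i) h0)
      simp_rw [hfac]
      rw [← ENNReal.ofReal_prod_of_nonneg fun (i : Fin n) _ => hg _ (hu i) (x i),
        two_rpow_mul_add_sum hα'.ne']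
      exact ENNReal.ofReal_le_ofReal (le_of_lt hx)
  refine le_trans ?_ (mul_le_mul_of_nonneg_left hle (by
    exact_mod_cast (by positivity : (0 : ℝ) ≤ 1 / n)))
  rw [← EReal.coe_mul]
  refine le_of_eq ?_
  congr 1
  ring

lemma regionUDα_subset : regionUDα α μ W 𝒳 ⊆ regionUSα α μ W 𝒳 :=
  fun _ ⟨hR, c, _, h⟩ => ⟨hR, c, h⟩

end Regions

end SecureList

theorem mainTheorem7 {X : Type*} [MetricSpace X] {Y : Type*} [MeasurableSpace Y]
    (μ : Measure Y) [SigmaFinite μ]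
    (W : X → Measure Y) [∀ x, IsProbabilityMeasure (W x)] (hWμ : ∀ x, W x ≪ μ)
    (𝒳 : Finset X)
    (hW2 : SecureList.CondW2 (SecureList.honest W 𝒳))
    (hW3 : SecureList.CondW3 W 𝒳) :
    closure (SecureList.regionUD μ W 𝒳) = closure (SecureList.regionC (SecureList.honest W 𝒳)) ∧
    closure (SecureList.regionUS μ W 𝒳) ⊆
      closure (SecureList.regionCs μ (SecureList.honest W 𝒳)) ∧
    ∀ α : ℝ, 1 < α →
      SecureList.regionCα α μ (SecureList.honest W 𝒳) ⊆ SecureList.regionUDα α μ W 𝒳 ∧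
      SecureList.regionUDα α μ W 𝒳 ⊆ SecureList.regionUSα α μ W 𝒳 := by
  refine ⟨Set.Subset.antisymm ?_ ?_, ?_, fun α hα => ⟨?_, ?_⟩⟩
  · exact closure_minimal (SecureList.regionUD_subset hWμ hW2) isClosed_closure
  · exact closure_minimal (SecureList.regionC_subset hWμ hW3) isClosed_closure
  · exact closure_minimal (SecureList.regionUS_subset hWμ hW2) isClosed_closure
  · exact SecureList.regionCα_subset hα hWμ hW3
  · exact SecureList.regionUDα_subset
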